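/- Let $R$ be a ring with identity, not necessarily commutative; $R$-modules are left $R$-modules, $R^\circ$-modules are right $R$-modules, and an $R$-complex is a $\mathbb{Z}$-indexed (unbounded) chain complex of $R$-modules. For an $R$-complex $X$ with differential $\partial$ put $\mathrm{C}_i(X)=X_i/\operatorname{Im}(\partial_{i+1}\colon X_{i+1}\to X_i)$, and let $X_{\ge i}$ be the quotient complex of $X$ that agrees with $X$ in degrees $\ge i$ and is zero in degrees $<i$. An $R$-complex $P$ is semi-projective if every $P_i$ is projective and the functor $\operatorname{Hom}_R(P,-)$ preserves quasi-isomorphisms; a semi-projective resolution of $M$ is a quasi-isomorphism $P\to M$ with $P$ semi-projective. An $R$-complex $F$ is semi-flat if every $F_i$ is flat and the functor $-\otimes_R F$ preserves quasi-isomorphisms; a semi-flat replacement of $M$ is a semi-flat complex $F$ with an isomorphism $F\simeq M$ in the derived category over $R$. A complex $T$ of flat $R$-modules is totally acyclic if $T$ is acyclic and $I\otimes_R T$ is acyclic for every injective $R^\circ$-module $I$. An $R$-module $G$ is Gorenstein flat if $G\cong \mathrm{C}_0(T)$ for some totally acyclic complex $T$ of flat $R$-modules. The ring $R$ is left GF-closed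 if the class of Gorenstein flat $R$-modules is closed under extensions. The Gorenstein flat dimension $\operatorname{Gfd}_R M\in\mathbb{Z}\cup\{\pm\infty\}$ is the infimum of the set of integers $n$ for which there exist a totally acyclic complex $T$ of flat $R$-modules and a semi-flat replacement $F$ of $M$ with $T_{\ge n}\cong F_{\ge n}$ (with $\inf\varnothing=\infty$). Let $M$ be an $R$-complex and $g\in\mathbb{Z}$, and consider the following conditions. (i) $\mathrm{H}_i(M)=0$ for all $i>g$, and for every semi-flat replacement $F\simeq M$ the module $\mathrm{C}_g(F)$ is Gorenstein flat. (ii) $\mathrm{H}_i(M)=0$ for all $i>g$, and there exists a semi-projective resolution $P\to M$ such that the module $\mathrm{C}_g(P)$ is Gorenstein flat. (iii) $\operatorname{Gfd}_R M\le g$. Conditions (i) and (ii) are equivalent, and each implies (iii). If, moreover, $R$ is left GF-closed, then (i), (ii) and (iii) are equivalent. -/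

import Mathlib

open CategoryTheory CategoryTheory.Limits
open scoped TensorProduct

universe u

namespace GFlat

noncomputable section

/-! ### Tensor products over a (not necessarily commutative) ring -/

section Tensor

variable (R : Type u) [Ring R]

/-- The subgroup of `N ⊗[ℤ] M` generated by the elements `(x r) ⊗ m - x ⊗ (r m)`, for a right
`R`-module `N` (a module over `Rᵐᵒᵖ`, with `x r = op r • x`) and a left `R`-module `M`. -/
def balancedRel (N M : Type u) [AddCommGroup N] [Module Rᵐᵒᵖ N] [AddCommGroup M] [Module R M] :
    AddSubgroup (N ⊗[ℤ] M) :=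
  AddSubgroup.closure
    {t | ∃ (x : N) (r : R) (m : M), t = (MulOpposite.op r • x) ⊗ₜ[ℤ] m - x ⊗ₜ[ℤ] (r • m)}

/-- The tensor product `N ⊗_R M` of a right `R`-module `N` and a left `R`-module `M`,
an abelian group. -/
abbrev BalancedTensor (N M : Type u) [AddCommGroup N] [Module Rᵐᵒᵖ N] [AddCommGroup M]
    [Module R M] : Type u :=
  (N ⊗[ℤ] M) ⧸ balancedRel R N M

variable {R}

lemma balancedRel_le_comap {N N' M M' : Type u} [AddCommGroup N] [Module Rᵐᵒᵖ N]
    [AddCommGroup N'] [Module Rᵐᵒᵖ N'] [AddCommGroup M] [Module R M] [AddCommGroup M']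
    [Module R M'] (f : N →ₗ[Rᵐᵒᵖ] N') (h : M →ₗ[R] M') :
    balancedRel R N M ≤ (balancedRel R N' M').comap
      (TensorProduct.map f.toAddMonoidHom.toIntLinearMap
        h.toAddMonoidHom.toIntLinearMap).toAddMonoidHom := by
  refine (AddSubgroup.closure_le _).2 ?_
  rintro _ ⟨x, r, m, rfl⟩
  refine AddSubgroup.subset_closure ⟨f x, r, h m, ?_⟩
  simp

/-- The homomorphism `f ⊗_R h : N ⊗_R M → N' ⊗_R M'`, `x ⊗ m ↦ f x ⊗ h m`. -/
def BalancedTensor.map {N N' M M' : Type u} [AddCommGroup N] [Module Rᵐᵒᵖ N]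
    [AddCommGroup N'] [Module Rᵐᵒᵖ N'] [AddCommGroup M] [Module R M] [AddCommGroup M']
    [Module R M'] (f : N →ₗ[Rᵐᵒᵖ] N') (h : M →ₗ[R] M') :
    BalancedTensor R N M →+ BalancedTensor R N' M' :=
  QuotientAddGroup.map _ _ _ (balancedRel_le_comap f h)

lemma BalancedTensor.hom_ext {N M : Type u} [AddCommGroup N] [Module Rᵐᵒᵖ N] [AddCommGroup M]
    [Module R M] {A : Type*} [AddCommGroup A] {f h : BalancedTensor R N M →+ A}
    (H : ∀ (x : N) (m : M), f (QuotientAddGroup.mk (x ⊗ₜ[ℤ] m)) =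
      h (QuotientAddGroup.mk (x ⊗ₜ[ℤ] m))) : f = h := by
  refine AddMonoidHom.ext fun t => ?_
  obtain ⟨t, rfl⟩ := QuotientAddGroup.mk_surjective t
  induction t using TensorProduct.induction_on with
  | zero => exact (map_zero f).trans (map_zero h).symm
  | tmul x y => exact H x y
  | add x y hx hy => rw [QuotientAddGroup.mk_add, map_add, map_add, hx, hy]

variable (R)

/-- The functor `N ⊗_R -` from left `R`-modules to abelian groups. -/
def tensorObj (N : ModuleCat.{u} Rᵐᵒᵖ) : ModuleCat.{u} R ⥤ AddCommGrpCat.{u} where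
  obj M := AddCommGrpCat.of (BalancedTensor R N M)
  map h := AddCommGrpCat.ofHom (BalancedTensor.map (LinearMap.id (M := N)) h.hom)
  map_id _ := AddCommGrpCat.hom_ext (BalancedTensor.hom_ext fun _ _ => rfl)
  map_comp _ _ := AddCommGrpCat.hom_ext (BalancedTensor.hom_ext fun _ _ => rfl)

/-- The tensor product over `R` as a bifunctor `(N, M) ↦ N ⊗_R M`. -/
def tensor : ModuleCat.{u} Rᵐᵒᵖ ⥤ ModuleCat.{u} R ⥤ AddCommGrpCat.{u} where
  obj N := tensorObj R N
  map f :=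
    { app := fun M => AddCommGrpCat.ofHom
        (BalancedTensor.map f.hom (LinearMap.id (M := M)))
      naturality := fun _ _ _ => AddCommGrpCat.hom_ext (BalancedTensor.hom_ext fun _ _ => rfl) }
  map_id _ := NatTrans.ext (funext fun _ =>
    AddCommGrpCat.hom_ext (BalancedTensor.hom_ext fun _ _ => rfl))
  map_comp _ _ := NatTrans.ext (funext fun _ =>
    AddCommGrpCat.hom_ext (BalancedTensor.hom_ext fun _ _ => rfl))

instance (N : ModuleCat.{u} Rᵐᵒᵖ) : (tensorObj R N).PreservesZeroMorphisms where
  map_zero _ M' := AddCommGrpCat.hom_ext (BalancedTensor.hom_ext fun x _ =>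
    congrArg QuotientAddGroup.mk (TensorProduct.tmul_zero M' x))

instance (N : ModuleCat.{u} Rᵐᵒᵖ) : ((tensor R).obj N).PreservesZeroMorphisms :=
  inferInstanceAs (tensorObj R N).PreservesZeroMorphisms

instance : (tensor R).PreservesZeroMorphisms where
  map_zero _ N' := NatTrans.ext (funext fun _ =>
    AddCommGrpCat.hom_ext (BalancedTensor.hom_ext fun _ m =>
      congrArg QuotientAddGroup.mk (TensorProduct.zero_tmul N' m)))

/-- A left `R`-module `F` is flat if `- ⊗_R F` preserves injectivity of homomorphisms of right
`R`-modules. -/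
def IsFlat (F : ModuleCat.{u} R) : Prop :=
  ∀ ⦃A B : ModuleCat.{u} Rᵐᵒᵖ⦄ (f : A ⟶ B), Function.Injective f →
    Function.Injective (((tensor R).map f).app F)

end Tensor

/-! ### Complexes

An `R`-complex is written with Mathlib's cochain complexes, i.e. with cohomological grading
`M^i = M_{-i}`; the module `M_i` in homological degree `i` is thus `M.X (-i)`. -/

/-- `R`-complexes: complexes of left `R`-modules indexed by `ℤ`. -/
abbrev Cplx (R : Type u) [Ring R] := CochainComplex (ModuleCat.{u} R) ℤ

section Complexes

variable {R : Type u} [Ring R]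

/-- The homology `H_i(M)` in homological degree `i`. -/
abbrev homologyAt (M : Cplx R) (i : ℤ) : ModuleCat.{u} R := M.homology (-i)

/-- The cokernel `C_i(M) = M_i / Im(M_{i+1} → M_i)` in homological degree `i`. -/
abbrev cokerAt (M : Cplx R) (i : ℤ) : ModuleCat.{u} R := M.opcycles (-i)

/-- The quotient complex `M_{≥ g}` of `M`, which agrees with `M` in homological degrees `≥ g`
(cohomological degrees `≤ -g`) and is zero in homological degrees `< g`. -/
abbrev truncGE (M : Cplx R) (g : ℤ) : Cplx R :=
  M.stupidTrunc (ComplexShape.embeddingUpIntLE (-g))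

/-- The morphism of complexes `Hom(P, α) : Hom(P, X) ⟶ Hom(P, Y)` induced by `α : X ⟶ Y`. -/
def homMap (P : Cplx R) {X Y : Cplx R} (α : X ⟶ Y) :
    CochainComplex.HomComplex P X ⟶ CochainComplex.HomComplex P Y where
  f n := AddCommGrpCat.ofHom
    { toFun := fun z : CochainComplex.HomComplex.Cochain P X n =>
        z.comp (CochainComplex.HomComplex.Cochain.ofHom α) (add_zero n)
      map_zero' := by simp
      map_add' := by intros; simp }
  comm' i j _ := by
    ext z
    exact CochainComplex.HomComplex.δ_comp_ofHom z α j

/-- The morphism of complexes of abelian groups `α ⊗_R F : X ⊗_R F ⟶ Y ⊗_R F` (total complexes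
of the tensor product) induced by a morphism `α : X ⟶ Y` of complexes of right `R`-modules. -/
def tensorMap {X Y : Cplx Rᵐᵒᵖ} (α : X ⟶ Y) (F : Cplx R) :
    HomologicalComplex.mapBifunctor X F (tensor R) (ComplexShape.up ℤ) ⟶
      HomologicalComplex.mapBifunctor Y F (tensor R) (ComplexShape.up ℤ) :=
  HomologicalComplex.mapBifunctorMap α (𝟙 F) (tensor R) (ComplexShape.up ℤ)

/-- `P` is semi-projective: each `P_i` is projective, and `Hom(P, -)` preserves
quasi-isomorphisms. -/
def IsSemiProjective (P : Cplx R) : Prop :=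
  (∀ i, Module.Projective R (P.X i)) ∧
    ∀ ⦃X Y : Cplx R⦄ (α : X ⟶ Y), QuasiIso α → QuasiIso (homMap P α)

/-- `F` is semi-flat: each `F_i` is flat, and `- ⊗_R F` preserves quasi-isomorphisms. -/
def IsSemiFlat (F : Cplx R) : Prop :=
  (∀ i, IsFlat R (F.X i)) ∧
    ∀ ⦃X Y : Cplx Rᵐᵒᵖ⦄ (α : X ⟶ Y), QuasiIso α → QuasiIso (tensorMap α F)

/-- `F` and `M` are isomorphic in the derived category over `R`. -/
def DerivedIso (F M : Cplx R) : Prop :=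
  letI := HasDerivedCategory.standard (ModuleCat.{u} R)
  Nonempty (DerivedCategory.Q.obj F ≅ DerivedCategory.Q.obj M)

/-- `F` is a semi-flat replacement of `M`. -/
def IsSemiFlatReplacement (F M : Cplx R) : Prop :=
  IsSemiFlat F ∧ DerivedIso F M

/-- `π : P ⟶ M` is a semi-projective resolution of `M`. -/
def IsSemiProjectiveResolution {P M : Cplx R} (π : P ⟶ M) : Prop :=
  IsSemiProjective P ∧ QuasiIso π

/-- `T` is a totally acyclic complex of flat modules: each `T_i` is flat, `T` is acyclic, and
`I ⊗_R T` is acyclic for every injective right `R`-module `I`. -/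
def IsTotallyAcyclicFlat (T : Cplx R) : Prop :=
  (∀ i, IsFlat R (T.X i)) ∧ T.Acyclic ∧
    ∀ I : ModuleCat.{u} Rᵐᵒᵖ, Module.Injective Rᵐᵒᵖ I →
      ((((tensor R).obj I).mapHomologicalComplex (ComplexShape.up ℤ)).obj T).Acyclic

/-- `G` is Gorenstein flat: `G ≅ C_0(T)` for a totally acyclic complex `T` of flat modules. -/
def IsGorensteinFlat (G : ModuleCat.{u} R) : Prop :=
  ∃ T : Cplx R, IsTotallyAcyclicFlat T ∧ Nonempty (cokerAt T 0 ≅ G)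

/-- `(T, F)` is a Tate flat resolution of `M` with `T_{≥ g} ≅ F_{≥ g}`. -/
def IsTateFlatResolution (T F M : Cplx R) (g : ℤ) : Prop :=
  IsTotallyAcyclicFlat T ∧ IsSemiFlatReplacement F M ∧ Nonempty (truncGE T g ≅ truncGE F g)

/-- The Gorenstein flat dimension of `M`, an element of `ℤ ∪ {±∞}` (as extended real numbers);
it is `+∞` if `M` has no Tate flat resolution. -/
def gfd (M : Cplx R) : EReal :=
  sInf {x | ∃ g : ℤ, x = ((g : ℝ) : EReal) ∧ ∃ T F : Cplx R, IsTateFlatResolution T F M g}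

end Complexes

/-- `R` is left GF-closed: the class of Gorenstein flat `R`-modules is closed under extensions. -/
def IsLeftGFClosed (R : Type u) [Ring R] : Prop :=
  ∀ S : ShortComplex (ModuleCat.{u} R), S.ShortExact →
    IsGorensteinFlat S.X₁ → IsGorensteinFlat S.X₃ → IsGorensteinFlat S.X₂

section Conditions

variable {R : Type u} [Ring R]

/-- `H_i(M) = 0` for all `i > g`, and `C_g(F)` is Gorenstein flat for every semi-flat
replacement `F` of `M`. -/
def SemiFlatCondition (M : Cplx R) (g : ℤ) : Prop :=
  (∀ i : ℤ, g < i → IsZero (homologyAt M i)) ∧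
    ∀ F : Cplx R, IsSemiFlatReplacement F M → IsGorensteinFlat (cokerAt F g)

/-- `H_i(M) = 0` for all `i > g`, and `C_g(P)` is Gorenstein flat for some semi-projective
resolution `P ⟶ M`. -/
def SemiProjectiveCondition (M : Cplx R) (g : ℤ) : Prop :=
  (∀ i : ℤ, g < i → IsZero (homologyAt M i)) ∧
    ∃ (P : Cplx R) (π : P ⟶ M), IsSemiProjectiveResolution π ∧ IsGorensteinFlat (cokerAt P g)

end Conditions

end

end GFlat

/-! The tensor side is tested throughout by characters, that is, homomorphisms to ℚ/ℤ: a character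
of X ⊗ M is the same as a homomorphism X → Hom(M, ℚ/ℤ), or M → Hom(X, ℚ/ℤ). Hence F is flat exactly
when its character module is injective (`isFlat_iff_injective`), and the vanishing of Tor(X, N) can
be read as that of Ext(X, Hom(N, ℚ/ℤ)) (`TorVanishing`). For complexes the same adjunction shows
that semi-projective complexes are semi-flat (`tensorMap_quasiIso`) and that the dual of a semi-flat
complex is K-injective. A quasi-isomorphism of semi-flat complexes therefore dualizes to a homotopy
equivalence, so it stays a quasi-isomorphism under X ⊗ - for every module X
(`IsSemiFlat.quasiIso_tC`).

Let P → F be such a quasi-isomorphism. Its cone stays exact under every X ⊗ -, so the cokernels of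
the cone are flat, and one of them, K, gives an exact sequence 0 → K → C_g(P) ⊕ F_g → C_g(F) → 0
which is pure at K (`exists_pure_sequence`).

If C_g(P) is Gorenstein flat, embed it in a flat U with Gorenstein flat cokernel G and push out: 0 →
K → U ⊕ F_g → N → 0 and 0 → C_g(F) → N → G → 0. Purity and Tor_1(I, G) = 0 for injective I force N
to be flat (`isFlat_of_comp`). Being the kernel of a map from a flat module onto a Gorenstein flat
one, C_g(F) is Gorenstein flat (`IsGorensteinFlat.of_shortExact`); no closure under extensions is
needed. As every M has a semi-projective resolution, which maps quasi-isomorphically to every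
semi-flat replacement, (i) and (ii) are equivalent.

For (iii), vanishing homology above g makes P_{≥g} a flat resolution of C_g(P), and it can replace
the corresponding half of a totally acyclic complex with that cokernel
(`IsTotallyAcyclicFlat.exists_splice`): what has to be checked, exactness of I ⊗ P_{≥g}, depends
only on Tor(I, C_g(P)). Conversely, (iii) yields some F with C_g(F) Gorenstein flat; passing from F
back to P reverses the argument above, and here extensions of Gorenstein flat modules do occur
(`IsLeftGFClosed.isGorensteinFlat_opcycles`). -/

namespace GFlat

noncomputable section

/-! ### Character modules over noncommutative rings -/

section Dual

variable {S T : Type u} [Ring S] [Ring T]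

/-- The divisible group `ℚ/ℤ`. -/
abbrev QZ : Type := AddCircle (1 : ℚ)

/-- The character group `Hom(M, ℚ/ℤ)` of an `S`-module, a `T`-module through `T → Sᵐᵒᵖ`. -/
def Dual (_ : T →+* Sᵐᵒᵖ) (M : Type u) [AddCommGroup M] [Module S M] : Type u := M →+ QZ

namespace Dual

variable (τ : T →+* Sᵐᵒᵖ) (M : Type u) [AddCommGroup M] [Module S M]

instance : AddCommGroup (Dual τ M) := inferInstanceAs (AddCommGroup (M →+ QZ))

variable {M} in
/-- A character as an additive map. -/
def toHom : Dual τ M ≃+ (M →+ QZ) := AddEquiv.refl _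

variable {τ M} in
lemma toHom_ext {φ ψ : Dual τ M} (h : ∀ m, toHom τ φ m = toHom τ ψ m) : φ = ψ :=
  AddMonoidHom.ext h

/-- The scalar t acts by (tφ)(m) = φ(τ(t)m). Leaving τ free lets one construction serve both sides:
the identity of Rᵐᵒᵖ for left modules (`DL`), and R ≃ Rᵐᵒᵖᵐᵒᵖ for right modules (`DR`). -/
instance : Module T (Dual τ M) where
  smul t φ := (toHom τ φ).comp (Module.toAddMonoidEnd S M (τ t).unop)
  one_smul φ := toHom_ext fun m => congrArg (toHom τ φ) (by simp; rfl)
  mul_smul a b φ := toHom_ext fun m => congrArg (toHom τ φ) (by simp; rfl)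
  smul_zero t := rfl
  smul_add t φ ψ := rfl
  add_smul a b φ := toHom_ext fun m => by
    refine (congrArg (toHom τ φ) (?_ : _ = (τ a).unop • m + (τ b).unop • m)).trans (map_add _ _ _)
    simp
    rfl
  zero_smul φ := toHom_ext fun m => by
    refine (congrArg (toHom τ φ) (?_ : _ = (0 : M))).trans (map_zero _)
    simp
    rfl

end Dual

variable (τ : T →+* Sᵐᵒᵖ)

/-- The character module as an object of the category of modules. -/
def dualObj (M : ModuleCat.{u} S) : ModuleCat.{u} T := ModuleCat.of T (Dual τ M)

/-- The evaluation of a character. -/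
def ev {M : ModuleCat.{u} S} : dualObj τ M ≃+ (M →+ QZ) := Dual.toHom τ

variable {τ} in
lemma ev_ext {M : ModuleCat.{u} S} {φ ψ : dualObj τ M} (h : ∀ m, ev τ φ m = ev τ ψ m) : φ = ψ :=
  AddMonoidHom.ext h

/-- The transpose of a homomorphism. -/
def dualMap {M N : ModuleCat.{u} S} (f : M ⟶ N) : dualObj τ N ⟶ dualObj τ M :=
  ModuleCat.ofHom (X := Dual τ N) (Y := Dual τ M)
    { toFun := fun φ => (Dual.toHom τ φ).comp f.hom.toAddMonoidHom
      map_add' := fun _ _ => rfl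
      map_smul' := fun t φ => Dual.toHom_ext fun m =>
        congrArg (Dual.toHom τ φ) (map_smul f.hom (τ t).unop m).symm }

@[simp]
lemma ev_dualMap {M N : ModuleCat.{u} S} (f : M ⟶ N) (φ : dualObj τ N) (m : M) :
    ev τ (dualMap τ f φ) m = ev τ φ (f m) := rfl

@[simp]
lemma dualMap_id (M : ModuleCat.{u} S) : dualMap τ (𝟙 M) = 𝟙 _ := rfl

lemma dualMap_comp {M N K : ModuleCat.{u} S} (f : M ⟶ N) (g : N ⟶ K) :
    dualMap τ (f ≫ g) = dualMap τ g ≫ dualMap τ f := rfl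

@[simp]
lemma dualMap_zero (M N : ModuleCat.{u} S) : dualMap τ (0 : M ⟶ N) = 0 := by
  ext φ
  exact ev_ext fun m => map_zero (ev τ φ)

lemma exists_char_ne_zero {A : Type*} [AddCommGroup A] {a : A} (ha : a ≠ 0) :
    ∃ φ : A →+ QZ, φ a ≠ 0 := CharacterModule.exists_character_apply_ne_zero_of_ne_zero ha

lemma exists_char_extension {A B : Type*} [AddCommGroup A] [AddCommGroup B] (u : A →+ B)
    (hu : Function.Injective u) (φ : A →+ QZ) : ∃ ψ : B →+ QZ, ψ.comp u = φ := by
  obtain ⟨ψ, h⟩ := CharacterModule.dual_surjective_of_injective (R := ℤ) u.toIntLinearMap hu φ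
  exact ⟨ψ, h⟩

/-- A character which vanishes on `ker v` factors through `v`. -/
lemma exists_char_factor {A B : Type*} [AddCommGroup A] [AddCommGroup B] (v : A →+ B)
    (φ : A →+ QZ) (h : ∀ a, v a = 0 → φ a = 0) : ∃ ψ : B →+ QZ, ψ.comp v = φ := by
  obtain ⟨ψ, hψ⟩ := exists_char_extension (QuotientAddGroup.kerLift v)
    (QuotientAddGroup.kerLift_injective v) (QuotientAddGroup.lift v.ker φ fun a ha => h a ha)
  refine ⟨ψ, AddMonoidHom.ext fun a => ?_⟩
  exact DFunLike.congr_fun hψ (QuotientAddGroup.mk a)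

lemma exists_char_separating {A : Type*} [AddCommGroup A] (H : AddSubgroup A) {a : A}
    (ha : a ∉ H) : ∃ φ : A →+ QZ, (∀ x ∈ H, φ x = 0) ∧ φ a ≠ 0 := by
  obtain ⟨φ, hφ⟩ := exists_char_ne_zero (a := (QuotientAddGroup.mk a : A ⧸ H))
    (fun h => ha ((QuotientAddGroup.eq_zero_iff a).1 h))
  refine ⟨φ.comp (QuotientAddGroup.mk' H), fun x hx => ?_, hφ⟩
  have : (QuotientAddGroup.mk' H) x = 0 := (QuotientAddGroup.eq_zero_iff x).2 hx
  exact (congrArg φ this).trans (map_zero φ)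

lemma injective_of_char {A B : Type*} [AddCommGroup A] [AddCommGroup B] (u : A →+ B)
    (h : ∀ φ : A →+ QZ, ∃ ψ : B →+ QZ, ψ.comp u = φ) : Function.Injective u := by
  refine (injective_iff_map_eq_zero u).2 fun a ha => ?_
  by_contra hne
  obtain ⟨φ, hφ⟩ := exists_char_ne_zero hne
  obtain ⟨ψ, rfl⟩ := h φ
  simp [ha] at hφ

/-- An element of ker v outside im u would be detected by a character that kills im u; such a
character factors through v, so it cannot detect it. -/
lemma exact_of_char {A B C : Type*} [AddCommGroup A] [AddCommGroup B] [AddCommGroup C]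
    (u : A →+ B) (v : B →+ C) (w : ∀ a, v (u a) = 0)
    (h : ∀ φ : B →+ QZ, φ.comp u = 0 → ∃ ψ : C →+ QZ, ψ.comp v = φ) : Function.Exact u v := by
  intro b
  refine ⟨fun hb => ?_, ?_⟩
  · by_contra hne
    obtain ⟨φ, hφ, hφ'⟩ := exists_char_separating u.range (a := b) (fun ⟨a, ha⟩ => hne ⟨a, ha⟩)
    obtain ⟨ψ, rfl⟩ := h φ (AddMonoidHom.ext fun a => hφ _ ⟨a, rfl⟩)
    simp [hb] at hφ'
  · rintro ⟨a, rfl⟩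
    exact w a

lemma dualMap_injective {M N : ModuleCat.{u} S} {f : M ⟶ N} (hf : Function.Surjective f) :
    Function.Injective (dualMap τ f) := by
  intro φ ψ h
  refine ev_ext fun n => ?_
  obtain ⟨m, rfl⟩ := hf n
  rw [← ev_dualMap, h, ev_dualMap]

lemma dualMap_surjective {M N : ModuleCat.{u} S} {f : M ⟶ N} (hf : Function.Injective f) :
    Function.Surjective (dualMap τ f) := by
  intro φ
  obtain ⟨ψ, h⟩ := exists_char_extension f.hom.toAddMonoidHom hf (ev τ φ)
  exact ⟨(ev τ).symm ψ, h⟩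

lemma dualMap_exact {M N K : ModuleCat.{u} S} {f : M ⟶ N} {g : N ⟶ K}
    (h : Function.Exact f g) : Function.Exact (dualMap τ g) (dualMap τ f) := by
  intro φ
  constructor
  · intro hφ
    obtain ⟨ψ, h'⟩ := exists_char_factor g.hom.toAddMonoidHom (ev τ φ) (by
      intro n hn
      obtain ⟨m, rfl⟩ := (h n).1 hn
      rw [← ev_dualMap, hφ, map_zero]
      rfl)
    exact ⟨(ev τ).symm ψ, h'⟩
  · rintro ⟨ψ, rfl⟩
    refine ev_ext fun m => ?_
    have : g (f m) = 0 := (h _).2 ⟨m, rfl⟩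
    simp [this]

end Dual

/-! ### The tensor product and the character module -/

section Tensor

variable {R : Type u} [Ring R]

/-- The element `x ⊗ m` of `X ⊗_R M`. -/
def tm {X : ModuleCat.{u} Rᵐᵒᵖ} {M : ModuleCat.{u} R} (x : X) (m : M) : BalancedTensor R X M :=
  QuotientAddGroup.mk (x ⊗ₜ[ℤ] m)

section

variable {X : ModuleCat.{u} Rᵐᵒᵖ} {M : ModuleCat.{u} R}

lemma tm_add_left (x y : X) (m : M) : tm (x + y) m = tm x m + tm y m :=
  congrArg QuotientAddGroup.mk (TensorProduct.add_tmul x y m)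

lemma tm_add_right (x : X) (m n : M) : tm x (m + n) = tm x m + tm x n :=
  congrArg QuotientAddGroup.mk (TensorProduct.tmul_add x m n)

lemma tm_smul (r : R) (x : X) (m : M) : tm (MulOpposite.op r • x) m = tm x (r • m) := by
  rw [← sub_eq_zero]
  refine (QuotientAddGroup.eq_zero_iff
    ((MulOpposite.op r • x) ⊗ₜ[ℤ] m - x ⊗ₜ[ℤ] (r • m))).2 (AddSubgroup.subset_closure ⟨x, r, m, rfl⟩)

lemma tm_induction {p : BalancedTensor R X M → Prop} (t : BalancedTensor R X M)
    (h0 : p 0) (h : ∀ x m, p (tm x m)) (hadd : ∀ s t, p s → p t → p (s + t)) : p t := by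
  obtain ⟨t, rfl⟩ := QuotientAddGroup.mk_surjective t
  induction t using TensorProduct.induction_on with
  | zero => exact h0
  | tmul x y => exact h x y
  | add x y hx hy => exact hadd _ _ hx hy

/-- The homomorphism out of the tensor product given by a balanced biadditive map. -/
def balLift {A : Type*} [AddCommGroup A] (b : X →+ M →+ A)
    (hb : ∀ (r : R) x m, b (MulOpposite.op r • x) m = b x (r • m)) :
    BalancedTensor R X M →+ A :=
  QuotientAddGroup.lift _ (TensorProduct.liftAddHom b (fun n x m => by simp)) (by
    refine (AddSubgroup.closure_le _).2 ?_
    rintro _ ⟨x, r, m, rfl⟩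
    simp [AddMonoidHom.mem_ker, hb])

/-- The biadditive map associated with a homomorphism out of the tensor product. -/
def biadd {A : Type*} [AddCommGroup A] (φ : BalancedTensor R X M →+ A) : X →+ M →+ A :=
  AddMonoidHom.mk' (fun x => AddMonoidHom.mk' (fun m => φ (tm x m))
    (fun m n => by rw [tm_add_right, map_add]))
    (fun x y => by ext m; simp [tm_add_left])

lemma tensor_hom_ext {A : Type*} [AddCommGroup A] {φ ψ : BalancedTensor R X M →+ A}
    (h : ∀ x m, φ (tm x m) = ψ (tm x m)) : φ = ψ := BalancedTensor.hom_ext h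

/-- The right module of characters of a left module. -/
abbrev DL (M : ModuleCat.{u} R) : ModuleCat.{u} Rᵐᵒᵖ := dualObj (RingHom.id Rᵐᵒᵖ) M

/-- The left module of characters of a right module. -/
abbrev DR (X : ModuleCat.{u} Rᵐᵒᵖ) : ModuleCat.{u} R :=
  dualObj ((RingEquiv.opOp R : R ≃+* Rᵐᵒᵖᵐᵒᵖ) : R →+* Rᵐᵒᵖᵐᵒᵖ) X

/-- Evaluation of a character of a left module. -/
abbrev evL {M : ModuleCat.{u} R} : DL M ≃+ (M →+ QZ) := ev _

/-- Evaluation of a character of a right module. -/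
abbrev evR {X : ModuleCat.{u} Rᵐᵒᵖ} : DR X ≃+ (X →+ QZ) := ev _

/-- A character of `X ⊗_R M` as a homomorphism `X → Hom(M, ℚ/ℤ)`. -/
def curryL (φ : BalancedTensor R X M →+ QZ) : X ⟶ DL M :=
  ModuleCat.ofHom (Y := DL M)
    { toFun := fun x => evL.symm (biadd φ x)
      map_add' := fun x y => ev_ext fun m => congrArg φ (tm_add_left x y m) |>.trans (map_add _ _ _)
      map_smul' := fun r x => ev_ext fun m => congrArg φ (tm_smul r.unop x m) }

/-- A character of `X ⊗_R M` as a homomorphism `M → Hom(X, ℚ/ℤ)`. -/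
def curryR (φ : BalancedTensor R X M →+ QZ) : M ⟶ DR X :=
  ModuleCat.ofHom (Y := DR X)
    { toFun := fun m => evR.symm ((biadd φ).flip m)
      map_add' := fun m n => ev_ext fun x =>
        congrArg φ (tm_add_right x m n) |>.trans (map_add _ _ _)
      map_smul' := fun r m => ev_ext fun x => congrArg φ (tm_smul r x m).symm }

/-- The character of `X ⊗_R M` given by a homomorphism `X → Hom(M, ℚ/ℤ)`. -/
def uncurryL (h : X ⟶ DL M) : BalancedTensor R X M →+ QZ :=
  balLift ((evL (M := M)).toAddMonoidHom.comp h.hom.toAddMonoidHom) fun r x m => by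
    have := map_smul h.hom (MulOpposite.op r) x
    simp only [AddMonoidHom.coe_comp, Function.comp_apply, LinearMap.toAddMonoidHom_coe]
    rw [this]
    rfl

@[simp]
lemma uncurryL_tm (h : X ⟶ DL M) (x : X) (m : M) : uncurryL h (tm x m) = evL (h x) m := rfl

/-- The character of `X ⊗_R M` given by a homomorphism `M → Hom(X, ℚ/ℤ)`. -/
def uncurryR (h : M ⟶ DR X) : BalancedTensor R X M →+ QZ :=
  balLift ((evR (X := X)).toAddMonoidHom.comp h.hom.toAddMonoidHom).flip fun r x m => by
    have := map_smul h.hom r m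
    simp only [AddMonoidHom.flip_apply, AddMonoidHom.coe_comp, Function.comp_apply,
      LinearMap.toAddMonoidHom_coe]
    rw [this]
    rfl

@[simp]
lemma uncurryR_tm (h : M ⟶ DR X) (x : X) (m : M) : uncurryR h (tm x m) = evR (h m) x := rfl

end

/-- The homomorphism `X ⊗_R f`. -/
abbrev tR (X : ModuleCat.{u} Rᵐᵒᵖ) {M N : ModuleCat.{u} R} (f : M ⟶ N) :
    BalancedTensor R X M →+ BalancedTensor R X N := (((tensor R).obj X).map f).hom

/-- The homomorphism `f ⊗_R M`. -/
abbrev tL {X Y : ModuleCat.{u} Rᵐᵒᵖ} (f : X ⟶ Y) (M : ModuleCat.{u} R) :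
    BalancedTensor R X M →+ BalancedTensor R Y M := (((tensor R).map f).app M).hom

@[simp]
lemma tR_tm (X : ModuleCat.{u} Rᵐᵒᵖ) {M N : ModuleCat.{u} R} (f : M ⟶ N) (x : X) (m : M) :
    tR X f (tm x m) = tm x (f m) := rfl

@[simp]
lemma tL_tm {X Y : ModuleCat.{u} Rᵐᵒᵖ} (f : X ⟶ Y) (M : ModuleCat.{u} R) (x : X) (m : M) :
    tL f M (tm x m) = tm (f x) m := rfl

lemma tR_comp_apply (X : ModuleCat.{u} Rᵐᵒᵖ) {M N K : ModuleCat.{u} R} (f : M ⟶ N) (g : N ⟶ K)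
    (t : BalancedTensor R X M) : tR X (f ≫ g) t = tR X g (tR X f t) := by
  rw [tR, Functor.map_comp]; rfl

@[simp]
lemma tR_zero_apply (X : ModuleCat.{u} Rᵐᵒᵖ) {M N : ModuleCat.{u} R}
    (t : BalancedTensor R X M) : tR X (0 : M ⟶ N) t = 0 := by
  rw [tR, Functor.map_zero]; rfl

@[simp]
lemma tL_zero_apply {X Y : ModuleCat.{u} Rᵐᵒᵖ} (M : ModuleCat.{u} R)
    (t : BalancedTensor R X M) : tL (0 : X ⟶ Y) M t = 0 := by
  rw [tL, Functor.map_zero]; rfl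

lemma tL_tR {X Y : ModuleCat.{u} Rᵐᵒᵖ} (f : X ⟶ Y) {M N : ModuleCat.{u} R} (g : M ⟶ N)
    (t : BalancedTensor R X M) : tL f N (tR X g t) = tR Y g (tL f M t) :=
  (ConcreteCategory.congr_hom (((tensor R).map f).naturality g) t :)

lemma tR_surjective (X : ModuleCat.{u} Rᵐᵒᵖ) {M N : ModuleCat.{u} R} {f : M ⟶ N}
    (hf : Function.Surjective f) : Function.Surjective (tR X f) := by
  intro t
  induction t using tm_induction with
  | h0 => exact ⟨0, map_zero _⟩
  | h x n => obtain ⟨m, rfl⟩ := hf n; exact ⟨tm x m, rfl⟩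
  | hadd s t hs ht =>
    obtain ⟨s, rfl⟩ := hs
    obtain ⟨t, rfl⟩ := ht
    exact ⟨s + t, map_add _ _ _⟩

lemma hom_factor {S : Type u} [Ring S] {A B C D : ModuleCat.{u} S} {f : A ⟶ B} {g : B ⟶ C}
    (h : Function.Exact f g) (hg : Function.Surjective g) (k : B ⟶ D) (hk : f ≫ k = 0) :
    ∃ l : C ⟶ D, g ≫ l = k := by
  have hk' : LinearMap.ker g.hom ≤ LinearMap.ker k.hom := by
    intro b hb
    obtain ⟨a, rfl⟩ := (h b).1 hb
    exact (ConcreteCategory.congr_hom hk a :)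
  let e := g.hom.quotKerEquivOfSurjective hg
  refine ⟨ModuleCat.ofHom (((LinearMap.ker g.hom).liftQ k.hom hk').comp e.symm.toLinearMap), ?_⟩
  ext b
  have : e.symm (g b) = Submodule.Quotient.mk b := by
    rw [LinearEquiv.symm_apply_eq]; rfl
  change ((LinearMap.ker g.hom).liftQ k.hom hk') (e.symm (g b)) = k b
  rw [this]
  rfl

/-- Right exactness by duality: a character of X ⊗ B that vanishes on the image of X ⊗ A is a map B
→ Hom(X, ℚ/ℤ) that kills f, so it descends to C. -/
lemma tR_exact (X : ModuleCat.{u} Rᵐᵒᵖ) {A B C : ModuleCat.{u} R} {f : A ⟶ B} {g : B ⟶ C}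
    (h : Function.Exact f g) (hg : Function.Surjective g) :
    Function.Exact (tR X f) (tR X g) := by
  have w : f ≫ g = 0 := by ext a; exact (h _).2 ⟨a, rfl⟩
  refine exact_of_char _ _ (fun t => by rw [← tR_comp_apply, w, tR_zero_apply]) fun φ hφ => ?_
  obtain ⟨l, hl⟩ := hom_factor h hg (curryR φ) (by
    ext a
    exact ev_ext fun x => (DFunLike.congr_fun hφ (tm x a) :))
  refine ⟨uncurryR l, tensor_hom_ext fun x m => ?_⟩
  have := ConcreteCategory.congr_hom hl m
  exact (DFunLike.congr_fun (congrArg evR this) x :)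

/-- `X ⊗ f` is injective if and only if homomorphisms `X → Hom(A, ℚ/ℤ)` lift along the transpose
of `f`. -/
lemma tR_injective_iff (X : ModuleCat.{u} Rᵐᵒᵖ) {A B : ModuleCat.{u} R} (f : A ⟶ B) :
    Function.Injective (tR X f) ↔
      ∀ k : X ⟶ DL A, ∃ l : X ⟶ DL B, l ≫ dualMap _ f = k := by
  constructor
  · intro h k
    obtain ⟨ψ, hψ⟩ := exists_char_extension _ h (uncurryL k)
    refine ⟨curryL ψ, ?_⟩
    ext x
    exact ev_ext fun a => (DFunLike.congr_fun hψ (tm x a) :)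
  · intro h
    refine injective_of_char _ fun φ => ?_
    obtain ⟨l, hl⟩ := h (curryL φ)
    refine ⟨uncurryL l, tensor_hom_ext fun x m => ?_⟩
    have := ConcreteCategory.congr_hom hl x
    exact (DFunLike.congr_fun (congrArg evL this) m :)

/-- Lambek's criterion. For a monomorphism A → B, both conditions say that every character of A ⊗ F
extends to B ⊗ F. -/
lemma isFlat_iff_injective (F : ModuleCat.{u} R) : IsFlat R F ↔ Injective (DL F) := by
  constructor
  · intro hF
    refine ⟨fun {A B} k f hf => ?_⟩
    obtain ⟨ψ, hψ⟩ := exists_char_extension (tL f F)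
      (hF f ((ModuleCat.mono_iff_injective f).1 hf)) (uncurryL k)
    refine ⟨curryL ψ, ?_⟩
    ext x
    exact ev_ext fun a => (DFunLike.congr_fun hψ (tm x a) :)
  · intro _ A B f hf
    have : Mono f := (ModuleCat.mono_iff_injective f).2 hf
    refine injective_of_char (tL f F) fun φ => ?_
    refine ⟨uncurryL (Injective.factorThru (curryL φ) f), tensor_hom_ext fun x m => ?_⟩
    have := ConcreteCategory.congr_hom (Injective.comp_factorThru (curryL φ) f) x
    exact (DFunLike.congr_fun (congrArg evL this) m :)

end Tensor

/-! ### Exactness of complexes in terms of cokernels of the differential -/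

section Exactness

lemma exact_iff_injective_desc {A B C D : Type*} [AddCommGroup A] [AddCommGroup B]
    [AddCommGroup C] [AddCommGroup D] {a : A → B} {p : B →+ C} {q : C →+ D} {d : B → D}
    (h : Function.Exact a p) (hp : Function.Surjective p) (hd : ∀ b, q (p b) = d b) :
    Function.Exact a d ↔ Function.Injective q := by
  constructor
  · intro h'
    refine (injective_iff_map_eq_zero q).2 fun c hc => ?_
    obtain ⟨b, rfl⟩ := hp c
    exact (h b).2 ((h' b).1 ((hd b).symm.trans hc))
  · intro hq b
    rw [← h b, ← hd b]
    exact map_eq_zero_iff q hq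

variable {S : Type u} [Ring S]

lemma exactAt_iff_exact (K : Cplx S) {i j k : ℤ} (hij : i + 1 = j) (hjk : j + 1 = k) :
    K.ExactAt j ↔ Function.Exact (K.d i j) (K.d j k) := by
  rw [K.exactAt_iff' i j k (by simp; lia) (by simp; lia),
    ShortComplex.ShortExact.moduleCat_exact_iff_function_exact]
  rfl

lemma pOpcycles_surjective (K : Cplx S) (i : ℤ) : Function.Surjective (K.pOpcycles i) :=
  (ModuleCat.epi_iff_surjective _).1 inferInstance

lemma pOpcycles_exact (K : Cplx S) {i j : ℤ} (hij : i + 1 = j) :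
    Function.Exact (K.d i j) (K.pOpcycles j) := by
  have := (ShortComplex.exact_of_g_is_cokernel
    (ShortComplex.mk _ _ (K.d_pOpcycles i j)) (K.opcyclesIsCokernel i j (by simp; lia)))
  exact (ShortComplex.ShortExact.moduleCat_exact_iff_function_exact _).1 this

lemma fromOpcycles_pOpcycles (K : Cplx S) (i j : ℤ) (x : K.X i) :
    K.fromOpcycles i j (K.pOpcycles i x) = K.d i j x :=
  ConcreteCategory.congr_hom (K.p_fromOpcycles i j) x

lemma exactAt_iff_fromOpcycles_injective (K : Cplx S) {i j : ℤ} (hij : i + 1 = j) :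
    K.ExactAt i ↔ Function.Injective (K.fromOpcycles i j) := by
  rw [exactAt_iff_exact K (i := i - 1) (by lia) hij]
  exact exact_iff_injective_desc (p := (K.pOpcycles i).hom.toAddMonoidHom)
    (q := (K.fromOpcycles i j).hom.toAddMonoidHom) (pOpcycles_exact K (by lia))
    (pOpcycles_surjective K i) (fromOpcycles_pOpcycles K i j)

lemma fromOpcycles_exact (K : Cplx S) {i j : ℤ} (hij : i + 1 = j) :
    Function.Exact (K.fromOpcycles i j) (K.pOpcycles j) := by
  intro x
  rw [pOpcycles_exact K hij x]
  constructor
  · rintro ⟨y, rfl⟩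
    exact ⟨K.pOpcycles i y, fromOpcycles_pOpcycles K i j y⟩
  · rintro ⟨y, rfl⟩
    obtain ⟨y, rfl⟩ := pOpcycles_surjective K i y
    exact ⟨y, (fromOpcycles_pOpcycles K i j y).symm⟩

variable {R : Type u} [Ring R]

/-- The complex `X ⊗_R K` for a right module `X`. -/
abbrev tC (X : ModuleCat.{u} Rᵐᵒᵖ) (K : Cplx R) : CochainComplex AddCommGrpCat.{u} ℤ :=
  (((tensor R).obj X).mapHomologicalComplex (ComplexShape.up ℤ)).obj K

lemma tC_exactAt_iff (X : ModuleCat.{u} Rᵐᵒᵖ) (K : Cplx R) {i j k : ℤ} (hij : i + 1 = j)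
    (hjk : j + 1 = k) :
    (tC X K).ExactAt j ↔ Function.Exact (tR X (K.d i j)) (tR X (K.d j k)) := by
  rw [(tC X K).exactAt_iff' i j k (by simp; lia) (by simp; lia),
    ShortComplex.ab_exact_iff_function_exact]
  rfl

/-- By right exactness X ⊗ C_i(K) is the cokernel of the differential of X ⊗ K, so exactness is
injectivity of the map induced on it. -/
lemma tC_exactAt_iff_injective (X : ModuleCat.{u} Rᵐᵒᵖ) (K : Cplx R) {i j : ℤ}
    (hij : i + 1 = j) :
    (tC X K).ExactAt i ↔ Function.Injective (tR X (K.fromOpcycles i j)) := by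
  rw [tC_exactAt_iff X K (i := i - 1) (by lia) hij]
  refine exact_iff_injective_desc (p := tR X (K.pOpcycles i))
    (tR_exact X (pOpcycles_exact K (by lia)) (pOpcycles_surjective K i))
    (tR_surjective X (pOpcycles_surjective K i)) fun t => ?_
  rw [← tR_comp_apply, K.p_fromOpcycles]

end Exactness

/-! ### Vanishing of Tor through Ext into character modules -/

section Tor

variable {R : Type u} [Ring R]

open Abelian

/-- The vanishing of `Tor_k(X, N)`, `k ≥ 1`, expressed by the vanishing of the character groups
`Ext^k(X, Hom(N, ℚ/ℤ))`. -/
def TorVanishing (X : ModuleCat.{u} Rᵐᵒᵖ) (N : ModuleCat.{u} R) : Prop :=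
  ∀ k : ℕ, Subsingleton (Ext X (DL N) (k + 1))

variable {A B N : ModuleCat.{u} R} {f : A ⟶ B} {g : B ⟶ N}

lemma dual_shortExact (hf : Function.Injective f) (h : Function.Exact f g)
    (hg : Function.Surjective g) :
    ∃ w, (ShortComplex.mk (dualMap (RingHom.id Rᵐᵒᵖ) g) (dualMap _ f) w).ShortExact := by
  have w : f ≫ g = 0 := by ext a; exact (h _).2 ⟨a, rfl⟩
  refine ⟨by rw [← dualMap_comp, w, dualMap_zero], ?_⟩
  refine { exact := ?_, mono_f := ?_, epi_g := ?_ }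
  · exact (ShortComplex.ShortExact.moduleCat_exact_iff_function_exact _).2 (dualMap_exact _ h)
  · exact (ModuleCat.mono_iff_injective _).2 (dualMap_injective _ hg)
  · exact (ModuleCat.epi_iff_surjective _).2 (dualMap_surjective _ hf)

/-- The character module of B is injective, so the long exact sequence exhibits Ext¹(X, DN) as the
cokernel of Hom(X, DB) → Hom(X, DA). Surjectivity of the latter is the lifting criterion
`tR_injective_iff`. -/
lemma tR_injective_iff_ext (X : ModuleCat.{u} Rᵐᵒᵖ) (hB : IsFlat R B) (hf : Function.Injective f)
    (h : Function.Exact f g) (hg : Function.Surjective g) :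
    Function.Injective (tR X f) ↔ Subsingleton (Ext X (DL N) 1) := by
  obtain ⟨w, hS⟩ := dual_shortExact hf h hg
  have : Injective (DL B) := (isFlat_iff_injective B).1 hB
  rw [tR_injective_iff]
  constructor
  · intro H
    refine ⟨fun x y => ?_⟩
    have key : ∀ x : Ext X (DL N) 1, x = 0 := by
      intro x
      obtain ⟨y, rfl⟩ := Ext.covariant_sequence_exact₁ X hS x (Ext.eq_zero_of_injective _) (n₀ := 0)
        (by simp)
      obtain ⟨k, rfl⟩ := (Ext.mk₀_bijective _ _).2 y
      obtain ⟨l, rfl⟩ := H k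
      rw [← Ext.mk₀_comp_mk₀, Ext.comp_assoc_of_second_deg_zero]
      simp [hS.comp_extClass]
    rw [key x, key y]
  · intro _ k
    obtain ⟨y, hy⟩ := Ext.covariant_sequence_exact₃ X hS (Ext.mk₀ k) (n₁ := 1) (by simp)
      (Subsingleton.elim _ _)
    obtain ⟨l, rfl⟩ := (Ext.mk₀_bijective _ _).2 y
    refine ⟨l, (Ext.mk₀_bijective _ _).1 ?_⟩
    rw [← Ext.mk₀_comp_mk₀]
    exact hy

/-- Dimension shifting along the dual sequence 0 → DN → DB → DA → 0, whose middle term is injective.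
-/
lemma ext_dual_subsingleton_iff (X : ModuleCat.{u} Rᵐᵒᵖ) (hB : IsFlat R B)
    (hf : Function.Injective f) (h : Function.Exact f g) (hg : Function.Surjective g) (k : ℕ) :
    Subsingleton (Ext X (DL N) (k + 2)) ↔ Subsingleton (Ext X (DL A) (k + 1)) := by
  obtain ⟨w, hS⟩ := dual_shortExact hf h hg
  have : Injective (DL B) := (isFlat_iff_injective B).1 hB
  constructor
  · intro _
    refine subsingleton_of_forall_eq 0 fun x => ?_
    obtain ⟨y, rfl⟩ := Ext.covariant_sequence_exact₃ X hS x (n₁ := k + 2) (by lia)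
      (Subsingleton.elim _ _)
    rw [Ext.eq_zero_of_injective y, Ext.zero_comp]
  · intro _
    refine subsingleton_of_forall_eq 0 fun x => ?_
    obtain ⟨y, rfl⟩ := Ext.covariant_sequence_exact₁ X hS x (Ext.eq_zero_of_injective _)
      (n₀ := k + 1) (by lia)
    rw [Subsingleton.elim y 0, Ext.zero_comp]

lemma TorVanishing.of_iso {X : ModuleCat.{u} Rᵐᵒᵖ} (h : TorVanishing X A) (e : A ≅ B) :
    TorVanishing X B := fun k => by
  have := h k
  refine subsingleton_of_forall_eq 0 fun x => ?_
  have hx : x = (x.comp (Ext.mk₀ (dualMap _ e.hom)) (add_zero _)).comp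
      (Ext.mk₀ (dualMap _ e.inv)) (add_zero _) := by
    rw [Ext.comp_assoc_of_third_deg_zero, Ext.mk₀_comp_mk₀, ← dualMap_comp, e.inv_hom_id,
      dualMap_id, Ext.comp_mk₀_id]
  rw [hx, Subsingleton.elim (x.comp _ _) 0, Ext.zero_comp]

/-- `X ⊗ -` is exact on short exact sequences with a third term `N` such that `Tor_1(X, N) = 0`. -/
lemma TorVanishing.tR_injective {X : ModuleCat.{u} Rᵐᵒᵖ} (hN : TorVanishing X N)
    (hf : Function.Injective f) (h : Function.Exact f g) (hg : Function.Surjective g) :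
    Function.Injective (tR X f) := by
  obtain ⟨w, hS⟩ := dual_shortExact hf h hg
  have := hN 0
  rw [tR_injective_iff]
  intro k
  obtain ⟨y, hy⟩ := Ext.covariant_sequence_exact₃ X hS (Ext.mk₀ k) (n₁ := 1) (by simp)
    (Subsingleton.elim _ _)
  obtain ⟨l, rfl⟩ := (Ext.mk₀_bijective _ _).2 y
  refine ⟨l, (Ext.mk₀_bijective _ _).1 ?_⟩
  rw [← Ext.mk₀_comp_mk₀]
  exact hy

lemma isFlat_of_shortExact (hB : IsFlat R B) (hf : Function.Injective f)
    (h : Function.Exact f g) (hg : Function.Surjective g)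
    (H : ∀ X : ModuleCat.{u} Rᵐᵒᵖ, Function.Injective (tR X f)) : IsFlat R N := by
  rw [isFlat_iff_injective, injective_iff_subsingleton_ext_one]
  exact fun X => (tR_injective_iff_ext X hB hf h hg).1 (H X)

/-- Let `L` be a complex of flat modules which is exact in degrees `< n`. Then `X ⊗ L` is exact
in degrees `< n` if and only if the higher `Tor` of `X` and the cokernel of `L` in degree `n`
vanish. -/
lemma tC_exactAt_iff_torVanishing (X : ModuleCat.{u} Rᵐᵒᵖ) (L : Cplx R) (n : ℤ)
    (hL : ∀ i ≤ n, IsFlat R (L.X i)) (hL' : ∀ i < n, L.ExactAt i) :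
    (∀ i < n, (tC X L).ExactAt i) ↔ TorVanishing X (L.opcycles n) := by
  have ses (i : ℤ) (hi : i ≤ n) : Function.Injective (L.fromOpcycles (i - 1) i) :=
    (exactAt_iff_fromOpcycles_injective L (by lia)).1 (hL' _ (by lia))
  -- Shifting m times along the short exact sequences 0 → C_{i-1} → L_i → C_i → 0 for i from n - m +
  -- 1 to n.
  have h1 (k : ℕ) : ∀ m : ℕ, Subsingleton (Ext X (DL (L.opcycles (n - m))) (k + 1)) ↔
      Subsingleton (Ext X (DL (L.opcycles n)) (k + m + 1)) := by
    intro m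
    induction m generalizing k with
    | zero => simp
    | succ m ih =>
      have h2 := ext_dual_subsingleton_iff X (hL (n - m) (by lia)) (ses (n - m) (by lia))
        (fromOpcycles_exact L (by lia)) (pOpcycles_surjective L _) k
      rw [show n - ((m + 1 : ℕ) : ℤ) = n - m - 1 by push_cast; ring, ← h2,
        show k + (m + 1) + 1 = (k + 1) + m + 1 by ring]
      exact ih (k + 1)
  -- Each degree below n accounts for exactly one Tor: exactness in degree n - m - 1 is Tor_1 of the
  -- cokernel in degree n - m, hence Tor_{m+1} of the one in degree n.
  have h2 (m : ℕ) : (tC X L).ExactAt (n - m - 1) ↔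
      Subsingleton (Ext X (DL (L.opcycles n)) (m + 1)) := by
    rw [tC_exactAt_iff_injective X L (i := n - m - 1) (j := n - m) (by lia),
      tR_injective_iff_ext X (hL (n - m) (by lia)) (ses (n - m) (by lia))
        (fromOpcycles_exact L (by lia)) (pOpcycles_surjective L _), h1 0 m, zero_add]
  constructor
  · exact fun h m => (h2 m).1 (h _ (by lia))
  · intro h i hi
    obtain ⟨m, hm⟩ := Int.eq_ofNat_of_zero_le (a := n - 1 - i) (by lia)
    obtain rfl : i = n - m - 1 := by lia
    exact (h2 m).2 (h m)

end Tor

/-! ### Quasi-isomorphisms in terms of elements -/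

section QuasiIso

section Ab

variable {K L : CochainComplex AddCommGrpCat.{u} ℤ}

lemma exists_cycles_of_d_eq_zero {j k : ℤ} (hjk : j + 1 = k) (x : K.X j) (hx : K.d j k x = 0) :
    ∃ z : K.cycles j, K.iCycles j z = x := by
  have := ShortComplex.exact_of_f_is_kernel
    (ShortComplex.mk _ _ (K.iCycles_d j k)) (K.cyclesIsKernel j k (by simp; lia))
  exact (((ShortComplex.ab_exact_iff_function_exact _).1 this) x).1 hx

lemma iCycles_injective (j : ℤ) : Function.Injective (K.iCycles j) :=
  (AddCommGrpCat.mono_iff_injective _).1 inferInstance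

lemma homologyπ_eq_zero_iff {i j : ℤ} (hij : i + 1 = j) (z : K.cycles j) :
    K.homologyπ j z = 0 ↔ ∃ y, K.d i j y = K.iCycles j z := by
  have := ShortComplex.exact_of_g_is_cokernel
    (ShortComplex.mk _ _ (K.toCycles_comp_homologyπ i j))
    (K.homologyIsCokernel i j (by simp; lia))
  refine (((ShortComplex.ab_exact_iff_function_exact _).1 this) z).trans ?_
  refine exists_congr fun y => ?_
  rw [← (iCycles_injective j).eq_iff]
  exact Eq.congr_left (ConcreteCategory.congr_hom (K.toCycles_i i j) y)

/-- The two clauses are injectivity and surjectivity on homology in degree j. In this form the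
property can be carried through any identification of elements, such as characters with cochains. -/
lemma quasiIso_iff_ab (f : K ⟶ L) :
    QuasiIso f ↔ ∀ i j k : ℤ, i + 1 = j → j + 1 = k →
      (∀ x : K.X j, K.d j k x = 0 → (∃ y, L.d i j y = f.f j x) → ∃ x', K.d i j x' = x) ∧
      (∀ y : L.X j, L.d j k y = 0 → ∃ x, K.d j k x = 0 ∧ ∃ w, L.d i j w = f.f j x - y) := by
  have iC (j : ℤ) (z : K.cycles j) :
      L.iCycles j (HomologicalComplex.cyclesMap f j z) = f.f j (K.iCycles j z) :=
    ConcreteCategory.congr_hom (HomologicalComplex.cyclesMap_i f j) z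
  have hπ (j : ℤ) (z : K.cycles j) : HomologicalComplex.homologyMap f j (K.homologyπ j z) =
      L.homologyπ j (HomologicalComplex.cyclesMap f j z) :=
    ConcreteCategory.congr_hom (HomologicalComplex.homologyπ_naturality f j) z
  have surjπ (K : CochainComplex AddCommGrpCat.{u} ℤ) (j : ℤ) :
      Function.Surjective (K.homologyπ j) := (AddCommGrpCat.epi_iff_surjective _).1 inferInstance
  have dI (K : CochainComplex AddCommGrpCat.{u} ℤ) (j k : ℤ) (z : K.cycles j) :
      K.d j k (K.iCycles j z) = 0 := ConcreteCategory.congr_hom (K.iCycles_d j k) z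
  rw [quasiIso_iff]
  constructor
  · intro h i j k hij hjk
    have hb : Function.Bijective (HomologicalComplex.homologyMap f j) := by
      have := (quasiIsoAt_iff_isIso_homologyMap _ _).1 (h j)
      exact (ConcreteCategory.isIso_iff_bijective _).1 this
    constructor
    · rintro x hx ⟨y, hy⟩
      obtain ⟨z, rfl⟩ := exists_cycles_of_d_eq_zero hjk x hx
      refine (homologyπ_eq_zero_iff hij z).1 (hb.1 ?_)
      rw [map_zero, hπ, homologyπ_eq_zero_iff hij]
      exact ⟨y, hy.trans (iC j z).symm⟩
    · intro y hy
      obtain ⟨z, rfl⟩ := exists_cycles_of_d_eq_zero hjk y hy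
      obtain ⟨t, ht⟩ := hb.2 (L.homologyπ j z)
      obtain ⟨t, rfl⟩ := surjπ K j t
      refine ⟨K.iCycles j t, dI K j k t, ?_⟩
      obtain ⟨w, hw⟩ := (homologyπ_eq_zero_iff hij (HomologicalComplex.cyclesMap f j t - z)).1
        (by rw [map_sub, ← hπ, ht, sub_self])
      exact ⟨w, by rw [hw, map_sub, iC]⟩
  · intro h j
    rw [quasiIsoAt_iff_isIso_homologyMap, ConcreteCategory.isIso_iff_bijective]
    obtain ⟨h1, h2⟩ := h (j - 1) j (j + 1) (by lia) rfl
    constructor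
    · refine (injective_iff_map_eq_zero (HomologicalComplex.homologyMap f j).hom).2 fun t ht => ?_
      obtain ⟨t, rfl⟩ := surjπ K j t
      have ht' : L.homologyπ j (HomologicalComplex.cyclesMap f j t) = 0 := (hπ j t).symm.trans ht
      rw [homologyπ_eq_zero_iff (i := j - 1) (by lia), iC] at ht'
      exact (homologyπ_eq_zero_iff (by lia) _).2 (h1 _ (dI K j _ t) ht')
    · intro t
      obtain ⟨t, rfl⟩ := surjπ L j t
      obtain ⟨x, hx, w, hw⟩ := h2 _ (dI L j _ t)
      obtain ⟨z, rfl⟩ := exists_cycles_of_d_eq_zero rfl x hx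
      refine ⟨K.homologyπ j z, ?_⟩
      rw [hπ, ← sub_eq_zero, ← map_sub, homologyπ_eq_zero_iff (i := j - 1) (by lia)]
      exact ⟨w, by rw [hw, map_sub, iC]⟩

end Ab

variable {S : Type u} [Ring S] {K L : Cplx S}

lemma quasiIso_iff_elements (f : K ⟶ L) :
    QuasiIso f ↔ ∀ i j k : ℤ, i + 1 = j → j + 1 = k →
      (∀ x : K.X j, K.d j k x = 0 → (∃ y, L.d i j y = f.f j x) → ∃ x', K.d i j x' = x) ∧
      (∀ y : L.X j, L.d j k y = 0 → ∃ x, K.d j k x = 0 ∧ ∃ w, L.d i j w = f.f j x - y) := by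
  rw [← HomologicalComplex.quasiIso_map_iff_of_preservesHomology f (forget₂ (ModuleCat.{u} S) AddCommGrpCat.{u}),
    quasiIso_iff_ab]
  rfl

/-- A criterion for quasi-isomorphisms in terms of characters. -/
lemma quasiIso_of_char {K L : CochainComplex AddCommGrpCat.{u} ℤ} (f : K ⟶ L)
    (hS : ∀ i j k : ℤ, i + 1 = j → j + 1 = k → ∀ φ : K.X j →+ QZ, φ.comp (K.d i j).hom = 0 →
      ∃ ψ : L.X j →+ QZ, ψ.comp (L.d i j).hom = 0 ∧ ∃ h : K.X k →+ QZ,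
        ψ.comp (f.f j).hom - φ = h.comp (K.d j k).hom)
    (hI : ∀ i j k : ℤ, i + 1 = j → j + 1 = k → ∀ ψ : L.X j →+ QZ, ψ.comp (L.d i j).hom = 0 →
      (∃ h : K.X k →+ QZ, ψ.comp (f.f j).hom = h.comp (K.d j k).hom) →
      ∃ h : L.X k →+ QZ, ψ = h.comp (L.d j k).hom) : QuasiIso f := by
  rw [quasiIso_iff_ab]
  intro i j k hij hjk
  have comm (j k : ℤ) (x : K.X j) : f.f k (K.d j k x) = L.d j k (f.f j x) :=
    (ConcreteCategory.congr_hom (f.comm j k) x).symm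
  have dd (K : CochainComplex AddCommGrpCat.{u} ℤ) (y : K.X i) : K.d j k (K.d i j y) = 0 :=
    ConcreteCategory.congr_hom (K.d_comp_d i j k) y
  constructor
  · rintro x hx ⟨y, hy⟩
    by_contra hne
    obtain ⟨φ, hφ, hφ'⟩ := exists_char_separating (K.d i j).hom.range (a := x)
      (fun ⟨a, ha⟩ => hne ⟨a, ha⟩)
    obtain ⟨ψ, hψ, h, hh⟩ := hS i j k hij hjk φ (AddMonoidHom.ext fun a => hφ _ ⟨a, rfl⟩)
    have h1 : ψ (f.f j x) - φ x = h (K.d j k x) := DFunLike.congr_fun hh x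
    have h2 : ψ (L.d i j y) = 0 := DFunLike.congr_fun hψ y
    rw [hx, map_zero, ← hy, h2, zero_sub, neg_eq_zero] at h1
    exact hφ' h1
  · intro y hy
    by_contra hne
    -- Boundaries plus images of cycles: y lies outside H exactly when its homology class is not
    -- hit.
    let H : AddSubgroup (L.X j) := (L.d i j).hom.range ⊔ ((K.d j k).hom.ker.map (f.f j).hom)
    have hy' : y ∉ H := by
      intro hmem
      obtain ⟨_, ⟨w, rfl⟩, _, ⟨x, hx, rfl⟩, h⟩ := AddSubgroup.mem_sup.1 hmem
      refine hne ⟨x, hx, -w, ?_⟩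
      rw [map_neg, ← h]
      change _ = f.f j x - (L.d i j w + f.f j x)
      abel
    obtain ⟨ψ, hψ, hψ'⟩ := exists_char_separating H hy'
    obtain ⟨h, hh⟩ := exists_char_factor (K.d j k).hom (ψ.comp (f.f j).hom)
      (fun a ha => hψ _ (AddSubgroup.mem_sup_right ⟨a, ha, rfl⟩))
    obtain ⟨h', rfl⟩ := hI i j k hij hjk ψ
      (AddMonoidHom.ext fun a => hψ _ (AddSubgroup.mem_sup_left ⟨a, rfl⟩)) ⟨h, hh.symm⟩
    refine hψ' ?_
    change h' (L.d j k y) = 0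
    rw [hy, map_zero]

end QuasiIso

/-! ### The dual of a complex -/

section DualComplex

variable {S T : Type u} [Ring S] [Ring T] (τ : T →+* Sᵐᵒᵖ)

/-- The complex of character modules. -/
def dualCplx (F : Cplx S) : Cplx T where
  X i := dualObj τ (F.X (-i))
  d i j := dualMap τ (F.d (-j) (-i))
  shape i j h := by
    rw [F.shape, dualMap_zero]
    simp only [ComplexShape.up_Rel] at h ⊢
    lia
  d_comp_d' i j k _ _ := by rw [← dualMap_comp, F.d_comp_d, dualMap_zero]

/-- The transpose of a morphism of complexes. -/
def dualCplxMap {F G : Cplx S} (f : F ⟶ G) : dualCplx τ G ⟶ dualCplx τ F where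
  f i := dualMap τ (f.f (-i))
  comm' i j _ := by
    change dualMap τ _ ≫ dualMap τ _ = dualMap τ _ ≫ dualMap τ _
    rw [← dualMap_comp, ← dualMap_comp, f.comm]

/-- Since ℚ/ℤ is injective, the cohomology of the dual is the dual of the homology; the proof is
this fact for elements. -/
lemma dualCplxMap_quasiIso {F G : Cplx S} (f : F ⟶ G) [QuasiIso f] :
    QuasiIso (dualCplxMap τ f) := by
  have hf := (quasiIso_iff_elements f).1 inferInstance
  have comm (j k : ℤ) (x : F.X j) : f.f k (F.d j k x) = G.d j k (f.f j x) :=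
    (ConcreteCategory.congr_hom (f.comm j k) x).symm
  rw [quasiIso_iff_elements]
  intro i j k hij hjk
  obtain ⟨h1, h2⟩ := hf (-k) (-j) (-i) (by lia) (by lia)
  have dd (K : Cplx S) (y : K.X (-k)) : K.d (-j) (-i) (K.d (-k) (-j) y) = 0 :=
    ConcreteCategory.congr_hom (K.d_comp_d _ _ _) y
  constructor
  · rintro ψ hψ ⟨χ, hχ⟩
    -- To factor through the differential, ψ must vanish on cycles of G. A cycle is homologous to
    -- the image of a cycle of F, where ψ vanishes because its pullback is χ composed with the
    -- differential.
    obtain ⟨θ, hθ⟩ := exists_char_factor (G.d (-j) (-i)).hom.toAddMonoidHom (ev τ ψ) (by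
      intro y hy
      obtain ⟨x, hx, w, hw⟩ := h2 y hy
      have e1 : ev τ ψ (f.f (-j) x) = 0 := by
        have : ev τ χ (F.d (-j) (-i) x) = ev τ ψ (f.f (-j) x) :=
          DFunLike.congr_fun (congrArg (ev τ) hχ) x
        rw [← this, hx, map_zero]
      have e2 : ev τ ψ (G.d (-k) (-j) w) = 0 := DFunLike.congr_fun (congrArg (ev τ) hψ) w
      rw [hw, map_sub, e1, zero_sub, neg_eq_zero] at e2
      exact e2)
    exact ⟨(ev τ).symm θ, hθ⟩
  · intro φ hφ
    let H : AddSubgroup (G.X (-j)) := (G.d (-j) (-i)).hom.toAddMonoidHom.ker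
    have hφ' (w) : ev τ φ (F.d (-k) (-j) w) = 0 := DFunLike.congr_fun (congrArg (ev τ) hφ) w
    -- The restriction of φ to cycles factors through cycles → G/boundaries: a cycle in the kernel
    -- becomes a boundary in G, so is one in F, where φ vanishes. Off the cycles the two characters
    -- differ by a multiple of the differential, found below.
    have fac := exists_char_factor
      (((QuotientAddGroup.mk' (G.d (-k) (-j)).hom.toAddMonoidHom.range).comp
        (f.f (-j)).hom.toAddMonoidHom).comp (F.d (-j) (-i)).hom.toAddMonoidHom.ker.subtype)
      ((ev τ φ).comp (F.d (-j) (-i)).hom.toAddMonoidHom.ker.subtype) (by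
        rintro ⟨x, hx⟩ hx'
        obtain ⟨y, hy⟩ := (QuotientAddGroup.eq_zero_iff _).1 hx'
        obtain ⟨x', rfl⟩ := h1 x hx ⟨y, hy⟩
        exact hφ' x')
    obtain ⟨ψ, hψ⟩ := fac
    let ψ' : G.X (-j) →+ QZ := ψ.comp (QuotientAddGroup.mk' _)
    have hψ1 (w) : ψ' (G.d (-k) (-j) w) = 0 := by
      have : (QuotientAddGroup.mk' (G.d (-k) (-j)).hom.toAddMonoidHom.range)
        (G.d (-k) (-j) w) = 0 := (QuotientAddGroup.eq_zero_iff _).2 ⟨w, rfl⟩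
      exact (congrArg ψ this).trans (map_zero ψ)
    have hψ2 (x) (hx : F.d (-j) (-i) x = 0) : ψ' (f.f (-j) x) = ev τ φ x :=
      DFunLike.congr_fun hψ ⟨x, hx⟩
    obtain ⟨θ, hθ⟩ := exists_char_factor (F.d (-j) (-i)).hom.toAddMonoidHom
      (ψ'.comp (f.f (-j)).hom.toAddMonoidHom - ev τ φ) (fun x hx => by
        simpa [sub_eq_zero] using hψ2 x hx)
    exact ⟨(ev τ).symm ψ', ev_ext hψ1, (ev τ).symm θ, (ev τ).injective hθ⟩

end DualComplex

/-! ### Characters of the total tensor product -/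

section TotalTensor

open CochainComplex.HomComplex

variable {R : Type u} [Ring R]

lemma tR_id_apply (X : ModuleCat.{u} Rᵐᵒᵖ) (M : ModuleCat.{u} R) (t : BalancedTensor R X M) :
    tR X (𝟙 M) t = t :=
  (ConcreteCategory.congr_hom (((tensor R).obj X).map_id M) t :)

lemma tL_id_apply (X : ModuleCat.{u} Rᵐᵒᵖ) (M : ModuleCat.{u} R) (t : BalancedTensor R X M) :
    tL (𝟙 X) M t = t := DFunLike.congr_fun (tensor_hom_ext fun _ _ => rfl :
      tL (𝟙 X) M = AddMonoidHom.id _) t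

/-- The total tensor product of complexes. -/
abbrev totalTensor (X : Cplx Rᵐᵒᵖ) (F : Cplx R) : CochainComplex AddCommGrpCat.{u} ℤ :=
  HomologicalComplex.mapBifunctor X F (tensor R) (ComplexShape.up ℤ)

/-- The inclusion of a summand of the total tensor product. -/
abbrev ιT (X : Cplx Rᵐᵒᵖ) (F : Cplx R) (a b n : ℤ) (h : a + b = n) :
    BalancedTensor R (X.X a) (F.X b) →+ (totalTensor X F).X n :=
  (HomologicalComplex.ιMapBifunctor X F (tensor R) (ComplexShape.up ℤ) a b n h).hom

variable {X Y : Cplx Rᵐᵒᵖ} {F : Cplx R}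

lemma totalTensor_d_ιT {a b n a' b' n' : ℤ} (h : a + b = n) (ha : a + 1 = a') (hb : b + 1 = b')
    (hn : n + 1 = n') (t : BalancedTensor R (X.X a) (F.X b)) :
    (totalTensor X F).d n n' (ιT X F a b n h t) =
      ιT X F a' b n' (by lia) (tL (X.d a a') _ t) +
        a.negOnePow • ιT X F a b' n' (by lia) (tR _ (F.d b b') t) := by
  have h1 := HomologicalComplex.mapBifunctor.ι_D₁ X F (tensor R) (ComplexShape.up ℤ) n n' a b h
  have h2 := HomologicalComplex.mapBifunctor.ι_D₂ X F (tensor R) (ComplexShape.up ℤ) n n' a b h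
  rw [HomologicalComplex.mapBifunctor.d₁_eq X F (tensor R) (ComplexShape.up ℤ) (i₁ := a)
    (i₁' := a') (by simpa using ha) b n' (show a' + b = n' by lia)] at h1
  rw [HomologicalComplex.mapBifunctor.d₂_eq X F (tensor R) (ComplexShape.up ℤ) a (i₂ := b)
    (i₂' := b') (by simpa using hb) n' (show a + b' = n' by lia)] at h2
  have e1 : ComplexShape.ε₁ (ComplexShape.up ℤ) (ComplexShape.up ℤ) (ComplexShape.up ℤ) (a, b) = 1 :=
    rfl
  have e2 : ComplexShape.ε₂ (ComplexShape.up ℤ) (ComplexShape.up ℤ) (ComplexShape.up ℤ) (a, b) =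
    a.negOnePow := rfl
  rw [e1, one_smul] at h1
  rw [e2] at h2
  refine congrArg₂ (· + ·) (ConcreteCategory.congr_hom h1 t) ?_
  refine (ConcreteCategory.congr_hom h2 t).trans ?_
  rfl

lemma tensorMap_ιT (α : X ⟶ Y) {a b n : ℤ} (h : a + b = n)
    (t : BalancedTensor R (X.X a) (F.X b)) :
    (tensorMap α F).f n (ιT X F a b n h t) = ιT Y F a b n h (tL (α.f a) _ t) := by
  have := ConcreteCategory.congr_hom (HomologicalComplex.ι_mapBifunctorMap α (𝟙 F) (tensor R)
    (ComplexShape.up ℤ) a b n h) t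
  refine this.trans ?_
  exact congrArg (ιT Y F a b n h) (tR_id_apply _ _ _)

lemma totalTensor_char_ext {n : ℤ} {φ ψ : (totalTensor X F).X n →+ QZ}
    (H : ∀ (a b : ℤ) (h : a + b = n) (x : X.X a) (m : F.X b),
      φ (ιT X F a b n h (tm x m)) = ψ (ιT X F a b n h (tm x m))) : φ = ψ := by
  -- The universal property of the total complex concerns groups in universe u, so ℚ/ℤ has to be
  -- lifted there.
  let e : QZ ≃+ ULift.{u} QZ := AddEquiv.ulift.symm
  have : AddCommGrpCat.ofHom (e.toAddMonoidHom.comp φ) =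
      AddCommGrpCat.ofHom (e.toAddMonoidHom.comp ψ) := by
    refine HomologicalComplex.mapBifunctor.hom_ext fun a b h => ?_
    refine AddCommGrpCat.hom_ext (tensor_hom_ext fun x m => ?_)
    exact congrArg e (H a b h x m)
  ext t
  exact e.injective (ConcreteCategory.congr_hom this t)

lemma exists_totalTensor_char {n : ℤ}
    (γ : ∀ (a b : ℤ) (_ : a + b = n), BalancedTensor R (X.X a) (F.X b) →+ QZ) :
    ∃ φ : (totalTensor X F).X n →+ QZ, ∀ a b h t, φ (ιT X F a b n h t) = γ a b h t := by
  let e : QZ ≃+ ULift.{u} QZ := AddEquiv.ulift.symm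
  let f : (totalTensor X F).X n ⟶ AddCommGrpCat.of (ULift.{u} QZ) :=
    HomologicalComplex.mapBifunctorDesc (fun a b h =>
      AddCommGrpCat.ofHom (e.toAddMonoidHom.comp (γ a b h)))
  refine ⟨e.symm.toAddMonoidHom.comp f.hom, fun a b h t => ?_⟩
  have := ConcreteCategory.congr_hom (HomologicalComplex.ι_mapBifunctorDesc
      (K₁ := X) (K₂ := F) (F := tensor R) (c := ComplexShape.up ℤ) (j := n)
      (A := AddCommGrpCat.of (ULift.{u} QZ)) (fun a b h =>
      AddCommGrpCat.ofHom (e.toAddMonoidHom.comp (γ a b h))) a b h) t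
  exact congrArg e.symm this

/-- A sign with `σ (p + 1) = (-1)^p σ p`. -/
def triSign (p : ℤ) : ℤˣ := (p * (p - 1) / 2).negOnePow

lemma triSign_succ (p : ℤ) : triSign (p + 1) = p.negOnePow * triSign p := by
  rw [triSign, triSign, ← Int.negOnePow_add]
  congr 1
  rw [show (p + 1) * (p + 1 - 1) = p * (p - 1) + p * 2 by ring,
    Int.add_mul_ediv_right _ _ (by norm_num), add_comm]

lemma triSign_mul_self (p : ℤ) : triSign p * triSign p = 1 := Int.units_mul_self _

/-! #### Characters of `X ⊗ P` as cochains from `P` to the dual of `X` -/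

/-- The dual complex of a complex of right modules. -/
abbrev dualR (X : Cplx Rᵐᵒᵖ) : Cplx R :=
  dualCplx ((RingEquiv.opOp R : R ≃+* Rᵐᵒᵖᵐᵒᵖ) : R →+* Rᵐᵒᵖᵐᵒᵖ) X

/-- The dual complex of a complex of left modules. -/
abbrev dualL (F : Cplx R) : Cplx Rᵐᵒᵖ := dualCplx (RingHom.id Rᵐᵒᵖ) F

lemma evR_zsmul {X : ModuleCat.{u} Rᵐᵒᵖ} (k : ℤˣ) (φ : DR X) (x : X) :
    evR (k • φ) x = k • evR φ x := by
  rcases Int.units_eq_one_or k with rfl | rfl <;> simp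

lemma evL_zsmul {M : ModuleCat.{u} R} (k : ℤˣ) (φ : DL M) (m : M) :
    evL (k • φ) m = k • evL φ m := by
  rcases Int.units_eq_one_or k with rfl | rfl <;> simp

/-- The cochain from `P` to the dual of `X` given by a character of `X ⊗ P`. -/
def cochainR {n m : ℤ} (h : n + m = 0) (φ : (totalTensor X F).X n →+ QZ) :
    Cochain F (dualR X) m :=
  Cochain.mk fun p q hpq => triSign p • curryR (φ.comp (ιT X F (-q) p n (by lia)))

lemma cochainR_apply {n m : ℤ} (h : n + m = 0) (φ : (totalTensor X F).X n →+ QZ) (p q : ℤ)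
    (hpq : p + m = q) (y : F.X p) (x : X.X (-q)) :
    evR ((cochainR h φ).v p q hpq y) x =
      triSign p • φ (ιT X F (-q) p n (by lia) (tm x y)) := by
  refine Eq.trans ?_ (evR_zsmul (triSign p)
    (curryR (φ.comp (ιT X F (-q) p n (by lia))) y) x)
  change evR ((triSign p • curryR (φ.comp (ιT X F (-q) p n (by lia)))) y) x = _
  rcases Int.units_eq_one_or (triSign p) with hp | hp
  · rw [hp, one_smul, one_smul]
  · rw [hp, Units.neg_smul, Units.neg_smul, one_smul, one_smul]
    rfl

/-- The sign `triSign p` is chosen for this: `triSign (p + 1)` contributes (-1)^p, which together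
with the sign (-1)^(m+1) in δ gives the Koszul sign (-1)^q of the total differential. Characters and
cochains thus form the same complex. -/
lemma δ_cochainR {n m n' m' : ℤ} (h : n + m = 0) (h' : n' + m' = 0) (hm : m + 1 = m')
    (φ : (totalTensor X F).X n →+ QZ) :
    δ m m' (cochainR h φ) = cochainR h' (φ.comp ((totalTensor X F).d n' n).hom) := by
  ext p q hpq y
  refine ev_ext fun x => ?_
  rw [δ_v m m' hm _ p q hpq (q - 1) (p + 1) rfl rfl]
  have e1 := cochainR_apply h φ p (q - 1) (by lia) y (X.d (-q) (-(q - 1)) x)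
  have e2 := cochainR_apply h φ (p + 1) q (by lia) (F.d p (p + 1) y) x
  have e3 := cochainR_apply h' (φ.comp ((totalTensor X F).d n' n).hom) p q hpq y x
  refine Eq.trans (b := evR ((cochainR h φ).v p (q - 1) (by lia) y) (X.d (-q) (-(q - 1)) x) +
    m'.negOnePow • evR ((cochainR h φ).v (p + 1) q (by lia) (F.d p (p + 1) y)) x) ?_ ?_
  · rcases Int.units_eq_one_or m'.negOnePow with hp | hp
    · simp [hp]; rfl
    · simp [hp]; rfl
  · refine Eq.trans ?_ e3.symm
    rw [e1, e2]
    have e4 : (totalTensor X F).d n' n (ιT X F (-q) p n' (by lia) (tm x y)) = _ :=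
      totalTensor_d_ιT (X := X) (F := F) (a := -q) (b := p) (n := n')
      (a' := -(q - 1)) (b' := p + 1) (n' := n) (by lia) (by lia) rfl (by lia) (tm x y)
    change _ = triSign p • φ ((totalTensor X F).d n' n (ιT X F (-q) p n' (by lia) (tm x y)))
    rw [e4, map_add, smul_add, tL_tm, tR_tm]
    congr 1
    rw [triSign_succ, smul_smul, ← mul_assoc, ← Int.negOnePow_add, mul_comm, ← smul_smul,
      show m' + p = q by lia, Int.negOnePow_neg]
    congr 1
    rcases Int.units_eq_one_or q.negOnePow with hp | hp <;> simp [hp]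

lemma cochainR_surjective {n m : ℤ} (h : n + m = 0) (z : Cochain F (dualR X) m) :
    ∃ φ : (totalTensor X F).X n →+ QZ, cochainR h φ = z := by
  let γ (q p : ℤ) (hq : -q + p = n) : BalancedTensor R (X.X (-q)) (F.X p) →+ QZ :=
    triSign p • uncurryR (z.v p q (by lia))
  -- The summands are indexed by the degree a of X, while cochains see X in degrees -q. Taking q =
  -- -a lands in degree -(-a), whence the transport, which `key` removes.
  obtain ⟨φ, hφ⟩ := exists_totalTensor_char (X := X) (F := F) (n := n) fun a p hap =>
    (γ (-a) p (by lia)).comp (tL (X.XIsoOfEq (neg_neg a).symm).hom (F.X p))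
  have key (q q' p : ℤ) (hq : -q + p = n) (hq' : -q' + p = n) (e : -q' = -q) (t) :
      γ q p hq (tL (X.XIsoOfEq e).hom (F.X p) t) = γ q' p hq' t := by
    obtain rfl : q' = q := by lia
    exact congrArg (γ q' p hq) (tL_id_apply _ _ t)
  refine ⟨φ, ?_⟩
  ext p q hpq y
  refine ev_ext fun x => ?_
  refine (cochainR_apply h φ p q hpq y x).trans ?_
  have h1 := hφ (-q) p (by lia) (tm x y)
  rw [h1, AddMonoidHom.comp_apply, key (- -q) q p (by lia) (by lia) (by lia)]
  have : γ q p (by lia) (tm x y) = triSign p • evR (z.v p q hpq y) x := by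
    exact congrArg (triSign p • ·) (uncurryR_tm (z.v p q hpq : F.X p ⟶ DR (X.X (-q))) x y)
  rw [this, smul_smul, triSign_mul_self, one_smul]

lemma cochainR_injective {n m : ℤ} (h : n + m = 0) {φ ψ : (totalTensor X F).X n →+ QZ}
    (H : cochainR h φ = cochainR h ψ) : φ = ψ := by
  refine totalTensor_char_ext fun a b hab x y => ?_
  obtain ⟨q, rfl⟩ : ∃ q, a = -q := ⟨-a, by lia⟩
  have e1 := cochainR_apply h φ b q (by lia) y x
  rw [H, cochainR_apply h ψ b q (by lia) y x] at e1
  exact (MulAction.injective (triSign b) e1).symm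

lemma cochainR_comp {n m : ℤ} (h : n + m = 0) (α : X ⟶ Y) (ψ : (totalTensor Y F).X n →+ QZ) :
    (cochainR h ψ).comp (Cochain.ofHom (dualCplxMap _ α)) (add_zero m) =
      cochainR h (ψ.comp ((tensorMap α F).f n).hom) := by
  ext p q hpq y
  refine ev_ext fun x => ?_
  refine Eq.trans ?_ (cochainR_apply h _ p q hpq y x).symm
  rw [Cochain.comp_v _ _ (add_zero m) p q q hpq (add_zero q), Cochain.ofHom_v]
  change evR ((cochainR h ψ).v p q hpq y) (α.f (-q) x) = _
  rw [cochainR_apply]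
  congr 1
  change _ = ψ ((tensorMap α F).f n (ιT X F (-q) p n (by lia) (tm x y)))
  rw [tensorMap_ιT, tL_tm]

lemma cochainR_sub {n m : ℤ} (h : n + m = 0) (φ ψ : (totalTensor X F).X n →+ QZ) :
    cochainR h (φ - ψ) = cochainR h φ - cochainR h ψ := by
  ext p q hpq y
  refine ev_ext fun x => ?_
  refine (cochainR_apply h _ p q hpq y x).trans ?_
  refine Eq.trans ?_ (congrArg₂ (· - ·) (cochainR_apply h φ p q hpq y x)
    (cochainR_apply h ψ p q hpq y x)).symm
  rw [AddMonoidHom.sub_apply, smul_sub]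

lemma cochainR_eq_zero_iff {n m : ℤ} (h : n + m = 0) (φ : (totalTensor X F).X n →+ QZ) :
    cochainR h φ = 0 ↔ φ = 0 := by
  have h0 : cochainR h (0 : (totalTensor X F).X n →+ QZ) = 0 := by
    rw [← sub_self (0 : (totalTensor X F).X n →+ QZ), cochainR_sub, sub_self]
  rw [← h0]
  exact ⟨fun H => cochainR_injective h H, fun H => by rw [H]⟩

lemma exists_of_homMap_quasiIso {P X Y : Cplx R} (α : X ⟶ Y) (h : QuasiIso (homMap P α))
    {i j k : ℤ} (hij : i + 1 = j) (hjk : j + 1 = k) :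
    (∀ x : Cochain P X j, δ j k x = 0 →
      (∃ y : Cochain P Y i, δ i j y = x.comp (Cochain.ofHom α) (add_zero j)) →
        ∃ x' : Cochain P X i, δ i j x' = x) ∧
    (∀ y : Cochain P Y j, δ j k y = 0 → ∃ x : Cochain P X j, δ j k x = 0 ∧
      ∃ w : Cochain P Y i, δ i j w = x.comp (Cochain.ofHom α) (add_zero j) - y) :=
  (quasiIso_iff_ab _).1 h i j k hij hjk

/-- If `Hom(P, -)` preserves quasi-isomorphisms, then so does `- ⊗ P`. -/
lemma tensorMap_quasiIso (P : Cplx R)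
    (hP : ∀ ⦃X Y : Cplx R⦄ (α : X ⟶ Y), QuasiIso α → QuasiIso (homMap P α))
    (α : X ⟶ Y) [QuasiIso α] : QuasiIso (tensorMap α P) := by
  -- The dual of α is a quasi-isomorphism, so Hom(P, dual Y) → Hom(P, dual X) is one. Under the
  -- correspondence of characters and cochains its surjectivity and injectivity on homology are the
  -- two criteria of `quasiIso_of_char`.
  have H {i j k : ℤ} (hij : i + 1 = j) (hjk : j + 1 = k) :=
    exists_of_homMap_quasiIso (P := P) (X := dualR Y) (Y := dualR X) (dualCplxMap _ α)
      (hP (X := dualR Y) (Y := dualR X) (dualCplxMap _ α) (dualCplxMap_quasiIso _ α)) hij hjk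
  refine quasiIso_of_char _ ?_ ?_
  · intro i j k hij hjk φ hφ
    have hi : i + -i = 0 := by lia
    have hj : j + -j = 0 := by lia
    have hk : k + -k = 0 := by lia
    have hji : -j + 1 = -i := by lia
    have hkj : -k + 1 = -j := by lia
    have h0 : δ (-j) (-i) (cochainR hj φ) = 0 :=
      (δ_cochainR hj hi hji φ).trans ((cochainR_eq_zero_iff hi _).2 hφ)
    obtain ⟨x, hx, w, hw⟩ := (H hkj hji).2 (cochainR hj φ) h0
    obtain ⟨ψ, rfl⟩ := cochainR_surjective hj x
    obtain ⟨η, rfl⟩ := cochainR_surjective hk w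
    rw [δ_cochainR hj hi hji, cochainR_eq_zero_iff] at hx
    rw [δ_cochainR hk hj hkj, cochainR_comp, ← cochainR_sub] at hw
    exact ⟨ψ, hx, η, (cochainR_injective hj hw).symm⟩
  · rintro i j k hij hjk ψ hψ ⟨η, hη⟩
    have hi : i + -i = 0 := by lia
    have hj : j + -j = 0 := by lia
    have hk : k + -k = 0 := by lia
    have hji : -j + 1 = -i := by lia
    have hkj : -k + 1 = -j := by lia
    have h0 : δ (-j) (-i) (cochainR hj ψ) = 0 :=
      (δ_cochainR hj hi hji ψ).trans ((cochainR_eq_zero_iff hi _).2 hψ)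
    have h1 : δ (-k) (-j) (cochainR hk η) =
        (cochainR hj ψ).comp (Cochain.ofHom (dualCplxMap _ α)) (add_zero (-j)) := by
      rw [δ_cochainR hk hj hkj, cochainR_comp]
      exact congrArg (cochainR hj) hη.symm
    obtain ⟨w, hw⟩ := (H hkj hji).1 (cochainR hj ψ) h0 ⟨_, h1⟩
    obtain ⟨θ, rfl⟩ := cochainR_surjective hk w
    rw [δ_cochainR hk hj hkj] at hw
    exact ⟨θ, (cochainR_injective hj hw).symm⟩

lemma IsSemiProjective.isSemiFlat_of_flat {P : Cplx R} (hP : IsSemiProjective P)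
    (h : ∀ i, IsFlat R (P.X i)) : IsSemiFlat P :=
  ⟨h, fun _ _ α _ => tensorMap_quasiIso P hP.2 α⟩

end TotalTensor

/-! ### K-injectivity of duals of semi-flat complexes -/

section KInjective

open CochainComplex.HomComplex

variable {R : Type u} [Ring R] {A : Cplx Rᵐᵒᵖ} {F : Cplx R}

/-- The cochain from `A` to the dual of `F` given by a character of `A ⊗ F`. -/
def cochainL {n m : ℤ} (h : n + m = 0) (φ : (totalTensor A F).X n →+ QZ) :
    Cochain A (dualL F) m :=
  Cochain.mk fun a q haq => triSign (-q) • curryL (φ.comp (ιT A F a (-q) n (by lia)))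

lemma cochainL_apply {n m : ℤ} (h : n + m = 0) (φ : (totalTensor A F).X n →+ QZ) (a q : ℤ)
    (haq : a + m = q) (x : A.X a) (y : F.X (-q)) :
    evL ((cochainL h φ).v a q haq x) y =
      triSign (-q) • φ (ιT A F a (-q) n (by lia) (tm x y)) := by
  refine Eq.trans ?_ (evL_zsmul (triSign (-q))
    (curryL (φ.comp (ιT A F a (-q) n (by lia))) x) y)
  change evL ((triSign (-q) • curryL (φ.comp (ιT A F a (-q) n (by lia)))) x) y = _
  rcases Int.units_eq_one_or (triSign (-q)) with hp | hp
  · rw [hp, one_smul, one_smul]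
  · rw [hp, Units.neg_smul, Units.neg_smul, one_smul, one_smul]
    rfl

/-- Unlike in `δ_cochainR`, a global sign remains; being a unit depending only on the degree, it
affects neither cocycles nor the homotopy built from degree -1 to 0. -/
lemma δ_cochainL_v {n m n' m' : ℤ} (h : n + m = 0) (h' : n' + m' = 0) (hm : m + 1 = m')
    (φ : (totalTensor A F).X n →+ QZ) (a q : ℤ) (haq : a + m' = q) (x : A.X a) (y : F.X (-q)) :
    evL ((δ m m' (cochainL h φ)).v a q haq x) y =
      m'.negOnePow • evL ((cochainL h' (φ.comp ((totalTensor A F).d n' n).hom)).v a q haq x) y := by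
  rw [δ_v m m' hm _ a q haq (q - 1) (a + 1) rfl rfl]
  have e1 := cochainL_apply h φ a (q - 1) (by lia) x (F.d (-q) (-(q - 1)) y)
  have e2 := cochainL_apply h φ (a + 1) q (by lia) (A.d a (a + 1) x) y
  have e3 := cochainL_apply h' (φ.comp ((totalTensor A F).d n' n).hom) a q haq x y
  refine Eq.trans (b := evL ((cochainL h φ).v a (q - 1) (by lia) x) (F.d (-q) (-(q - 1)) y) +
    m'.negOnePow • evL ((cochainL h φ).v (a + 1) q (by lia) (A.d a (a + 1) x)) y) ?_ ?_
  · rcases Int.units_eq_one_or m'.negOnePow with hp | hp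
    · simp [hp]; rfl
    · simp [hp]; rfl
  · refine Eq.trans ?_ (congrArg (m'.negOnePow • ·) e3).symm
    rw [e1, e2]
    have e4 : (totalTensor A F).d n' n (ιT A F a (-q) n' (by lia) (tm x y)) = _ :=
      totalTensor_d_ιT (X := A) (F := F) (a := a) (b := -q) (n := n')
      (a' := a + 1) (b' := -(q - 1)) (n' := n) (by lia) rfl (by lia) (by lia) (tm x y)
    change _ = m'.negOnePow • triSign (-q) •
      φ ((totalTensor A F).d n' n (ιT A F a (-q) n' (by lia) (tm x y)))
    rw [e4, map_add, smul_add, smul_add, tL_tm, tR_tm, add_comm]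
    congr 1
    have e5 : triSign (-(q - 1)) = (-q).negOnePow * triSign (-q) := by
      rw [← triSign_succ]; congr 1; ring
    have e6 (u : (totalTensor A F).X n) : φ (a.negOnePow • u) = a.negOnePow • φ u := by
      rcases Int.units_eq_one_or a.negOnePow with hp | hp <;> simp [hp]
    rw [e5, e6, smul_smul, smul_smul]
    congr 1
    rw [← haq, Int.negOnePow_neg, Int.negOnePow_add, mul_comm a.negOnePow, mul_assoc, mul_assoc,
      mul_comm a.negOnePow]

lemma cochainL_surjective {n m : ℤ} (h : n + m = 0) (z : Cochain A (dualL F) m) :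
    ∃ φ : (totalTensor A F).X n →+ QZ, cochainL h φ = z := by
  let γ (a q : ℤ) (hq : a + -q = n) : BalancedTensor R (A.X a) (F.X (-q)) →+ QZ :=
    triSign (-q) • uncurryL (z.v a q (by lia))
  obtain ⟨φ, hφ⟩ := exists_totalTensor_char (X := A) (F := F) (n := n) fun a b hab =>
    (γ a (-b) (by lia)).comp (tR (A.X a) (F.XIsoOfEq (neg_neg b).symm).hom)
  have key (q q' a : ℤ) (hq : a + -q = n) (hq' : a + -q' = n) (e : -q' = -q) (t) :
      γ a q hq (tR (A.X a) (F.XIsoOfEq e).hom t) = γ a q' hq' t := by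
    obtain rfl : q' = q := by lia
    exact congrArg (γ a q' hq) (tR_id_apply _ _ t)
  refine ⟨φ, ?_⟩
  ext a q haq x
  refine ev_ext fun y => ?_
  refine (cochainL_apply h φ a q haq x y).trans ?_
  have h1 := hφ a (-q) (by lia) (tm x y)
  rw [h1, AddMonoidHom.comp_apply, key (- -q) q a (by lia) (by lia) (by lia)]
  have : γ a q (by lia) (tm x y) = triSign (-q) • evL (z.v a q haq x) y := by
    exact congrArg (triSign (-q) • ·) (uncurryL_tm (z.v a q haq : A.X a ⟶ DL (F.X (-q))) x y)
  rw [this, smul_smul, triSign_mul_self, one_smul]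

lemma eq_zero_of_cochainL_eval {n m : ℤ} (h : n + m = 0) {φ : (totalTensor A F).X n →+ QZ}
    (H : ∀ a q haq x y, evL ((cochainL h φ).v a q haq x) y = 0) : φ = 0 := by
  refine totalTensor_char_ext fun a b hab x y => ?_
  obtain ⟨q, rfl⟩ : ∃ q, b = -q := ⟨-b, by lia⟩
  have e1 := cochainL_apply h φ a q (by lia) x y
  rw [H, ← smul_zero (triSign (-q))] at e1
  exact (MulAction.injective (triSign (-q)) e1).symm

/-- Converts preservation of quasi-isomorphisms into preservation of acyclicity: a functor that
kills zero maps sends this one to a zero map that is a quasi-isomorphism. -/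
lemma quasiIso_zero_of_acyclic {S : Type u} [Ring S] {K : Cplx S} (hK : K.Acyclic) :
    QuasiIso (0 : K ⟶ K) := by
  rw [quasiIso_iff_elements]
  intro i j k hij hjk
  have h := (exactAt_iff_exact K hij hjk).1 (hK j)
  refine ⟨fun x hx _ => (h x).1 hx, fun y hy => ⟨0, by simp, ?_⟩⟩
  obtain ⟨w, rfl⟩ := (h y).1 hy
  exact ⟨-w, by simp⟩

lemma IsSemiFlat.totalTensor_exact (hF : IsSemiFlat F) (hA : A.Acyclic) {i j k : ℤ}
    (hij : i + 1 = j) (hjk : j + 1 = k) (x : (totalTensor A F).X j)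
    (hx : (totalTensor A F).d j k x = 0) : ∃ y, (totalTensor A F).d i j y = x := by
  have h := (quasiIso_iff_ab _).1 (hF.2 0 (quasiIso_zero_of_acyclic hA))
  refine (h i j k hij hjk).1 x hx ⟨0, ?_⟩
  have : (tensorMap (0 : A ⟶ A) F).f j = 0 := by
    refine HomologicalComplex.mapBifunctor.hom_ext fun a b h => ?_
    refine AddCommGrpCat.hom_ext (tensor_hom_ext fun x m => ?_)
    refine (tensorMap_ιT (0 : A ⟶ A) h (tm x m)).trans ?_
    rw [HomologicalComplex.zero_f, tL_zero_apply]
    exact map_zero _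
  rw [this, map_zero]
  rfl

/-- The dual of a semi-flat complex is K-injective. -/
lemma IsSemiFlat.isKInjective_dual (hF : IsSemiFlat F) : (dualL F).IsKInjective where
  nonempty_homotopy_zero {A} f hA := by
    -- The chain map f is a character φ of A ⊗ F in degree 0 which vanishes on boundaries. These are
    -- all the cycles, since A ⊗ F is exact, so φ factors through the differential, and the factor η
    -- is a null-homotopy of f.
    obtain ⟨φ, hφ⟩ := cochainL_surjective (add_zero 0) (Cochain.ofHom f : Cochain A (dualL F) 0)
    have h1 : φ.comp ((totalTensor A F).d (-1) 0).hom = 0 := by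
      refine eq_zero_of_cochainL_eval (n := -1) (m := 1) (by lia) fun a q haq x y => ?_
      have := δ_cochainL_v (n' := -1) (m' := 1) (add_zero 0) (by lia) (by lia) φ a q haq x y
      rw [hφ, δ_ofHom] at this
      have h2 : (0 : QZ) = (1 : ℤ).negOnePow • _ := this
      rw [← smul_zero (1 : ℤ).negOnePow] at h2
      exact (MulAction.injective _ h2).symm
    obtain ⟨η, hη⟩ := exists_char_factor ((totalTensor A F).d 0 1).hom φ (by
      intro x hx
      obtain ⟨y, rfl⟩ := hF.totalTensor_exact hA (i := -1) (by lia) (by lia) x hx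
      exact DFunLike.congr_fun h1 y)
    refine ⟨(Cochain.equivHomotopy _ _).symm ⟨cochainL (n := 1) (m := -1) (by lia) η, ?_⟩⟩
    rw [Cochain.ofHom_zero, add_zero, ← hφ]
    refine Cochain.ext _ _ fun a q haq => ModuleCat.hom_ext (LinearMap.ext fun x => ev_ext fun y => ?_)
    refine Eq.trans ?_ (δ_cochainL_v (n' := 0) (m' := 0) (by lia) (add_zero 0) (by lia)
      η a q haq x y).symm
    rw [hη, Int.negOnePow_zero, one_smul]

/-- A character of A ⊗ P is a map from P to the dual of A; it lifts along the surjection of duals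
induced by A → B, and the lift is an extension to B ⊗ P. -/
lemma isFlat_of_projective (P : ModuleCat.{u} R) [Projective P] : IsFlat R P := by
  intro A B f hf
  refine injective_of_char (tL f P) fun φ => ?_
  have : Epi (dualMap ((RingEquiv.opOp R : R ≃+* Rᵐᵒᵖᵐᵒᵖ) : R →+* Rᵐᵒᵖᵐᵒᵖ) f) :=
    (ModuleCat.epi_iff_surjective _).2 (dualMap_surjective _ hf)
  let l : P ⟶ DR B := Projective.factorThru (curryR φ) (dualMap _ f)
  refine ⟨uncurryR l, tensor_hom_ext fun x m => ?_⟩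
  have := ConcreteCategory.congr_hom (Projective.factorThru_comp (curryR φ) (dualMap _ f)) m
  exact (DFunLike.congr_fun (congrArg evR this) x :)

lemma IsSemiProjective.isSemiFlat {P : Cplx R} (hP : IsSemiProjective P) : IsSemiFlat P :=
  hP.isSemiFlat_of_flat fun i =>
    have := hP.1 i
    have := (IsProjective.iff_projective (P.X i)).1 this
    isFlat_of_projective _

/-- A quasi-isomorphism between semi-flat complexes stays one after tensoring with a module. -/
lemma IsSemiFlat.quasiIso_tC {P F : Cplx R} (hP : IsSemiFlat P) (hF : IsSemiFlat F) (f : P ⟶ F)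
    [QuasiIso f] (X : ModuleCat.{u} Rᵐᵒᵖ) :
    QuasiIso ((((tensor R).obj X).mapHomologicalComplex (ComplexShape.up ℤ)).map f) := by
  have := hP.isKInjective_dual
  have := hF.isKInjective_dual
  have hf : QuasiIso (dualCplxMap (RingHom.id Rᵐᵒᵖ) f) := dualCplxMap_quasiIso _ f
  -- A quasi-isomorphism between K-injective complexes is a homotopy equivalence, so it survives
  -- Hom(X, -); and Hom(X, dual F) is the complex of characters of X ⊗ F.
  obtain ⟨e, he⟩ := (CochainComplex.IsKInjective.quasiIso_iff (K := dualL F) (L := dualL P) _).1 hf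
  let G := preadditiveCoyoneda.obj (Opposite.op X)
  have hq : QuasiIso ((G.mapHomologicalComplex (ComplexShape.up ℤ)).map
      (dualCplxMap (RingHom.id Rᵐᵒᵖ) f)) := by
    rw [← he]
    exact (G.mapHomotopyEquiv e).quasiIso_hom
  have H (i j k : ℤ) (hij : i + 1 = j) (hjk : j + 1 = k) :
      (∀ x : X ⟶ DL (F.X (-j)), x ≫ dualMap _ (F.d (-k) (-j)) = 0 →
        (∃ y : X ⟶ DL (P.X (-i)), y ≫ dualMap _ (P.d (-j) (-i)) = x ≫ dualMap _ (f.f (-j))) →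
        ∃ x' : X ⟶ DL (F.X (-i)), x' ≫ dualMap _ (F.d (-j) (-i)) = x) ∧
      (∀ y : X ⟶ DL (P.X (-j)), y ≫ dualMap _ (P.d (-k) (-j)) = 0 →
        ∃ x : X ⟶ DL (F.X (-j)), x ≫ dualMap _ (F.d (-k) (-j)) = 0 ∧
        ∃ w : X ⟶ DL (P.X (-i)), w ≫ dualMap _ (P.d (-j) (-i)) = x ≫ dualMap _ (f.f (-j)) - y) :=
    (quasiIso_iff_ab _).1 hq i j k hij hjk
  have curry_comp {M N : ModuleCat.{u} R} (d : M ⟶ N) (φ : BalancedTensor R X N →+ QZ) :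
      curryL φ ≫ dualMap _ d = curryL (φ.comp (tR X d)) := rfl
  have curry_inj {M : ModuleCat.{u} R} {φ ψ : BalancedTensor R X M →+ QZ}
      (h : curryL φ = curryL ψ) : φ = ψ := tensor_hom_ext fun x m =>
    DFunLike.congr_fun (congrArg evL (ConcreteCategory.congr_hom h x)) m
  have curry_surj {M : ModuleCat.{u} R} (l : X ⟶ DL M) : ∃ φ, curryL φ = l := ⟨uncurryL l, rfl⟩
  refine quasiIso_of_char _ ?_ ?_
  · intro i j k hij hjk φ hφ
    obtain ⟨i, rfl⟩ : ∃ i', i = -i' := ⟨-i, by lia⟩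
    obtain ⟨j, rfl⟩ : ∃ j', j = -j' := ⟨-j, by lia⟩
    obtain ⟨k, rfl⟩ : ∃ k', k = -k' := ⟨-k, by lia⟩
    obtain ⟨x, hx, w, hw⟩ := (H k j i (by lia) (by lia)).2 (curryL φ)
      (congrArg curryL hφ)
    obtain ⟨ψ, rfl⟩ := curry_surj x
    obtain ⟨η, rfl⟩ := curry_surj w
    exact ⟨ψ, curry_inj hx, η, (curry_inj hw).symm⟩
  · rintro i j k hij hjk ψ hψ ⟨η, hη⟩
    obtain ⟨i, rfl⟩ : ∃ i', i = -i' := ⟨-i, by lia⟩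
    obtain ⟨j, rfl⟩ : ∃ j', j = -j' := ⟨-j, by lia⟩
    obtain ⟨k, rfl⟩ : ∃ k', k = -k' := ⟨-k, by lia⟩
    obtain ⟨w, hw⟩ := (H k j i (by lia) (by lia)).1 (curryL ψ) (congrArg curryL hψ)
      ⟨curryL η, (congrArg curryL hη).symm⟩
    obtain ⟨θ, rfl⟩ := curry_surj w
    exact ⟨θ, (curry_inj hw).symm⟩

end KInjective

/-! ### Exactness of mapping cones under additive functors -/

section MappingCone

open CochainComplex CochainComplex.HomComplex

variable {R : Type u} [Ring R]

instance (X : ModuleCat.{u} Rᵐᵒᵖ) : ((tensor R).obj X).Additive where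
  map_add {_ _ f g} := AddCommGrpCat.hom_ext (tensor_hom_ext fun x m => tm_add_right x (f m) (g m))

/-- The usual chase for the cone of a quasi-isomorphism, using only the biproduct and differential
identities of the cone, all of which survive an additive functor. The boundary relation is required
only for the pairs (x, y) that occur. -/
lemma exact_of_cone {F₁ F₂ F₃ G₀ G₁ G₂ C₀ C₁ C₂ : Type*} [AddCommGroup F₁] [AddCommGroup F₂]
    [AddCommGroup F₃] [AddCommGroup G₀] [AddCommGroup G₁] [AddCommGroup G₂] [AddCommGroup C₀]
    [AddCommGroup C₁] [AddCommGroup C₂] {dF₁ : F₁ →+ F₂} {dF₂ : F₂ →+ F₃} {dG₀ : G₀ →+ G₁}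
    {dG₁ : G₁ →+ G₂} {φ₁ : F₁ →+ G₁} {φ₂ : F₂ →+ G₂} {fst₁ : C₁ →+ F₂} {snd₁ : C₁ →+ G₁}
    {fst₂ : C₂ →+ F₃} {snd₂ : C₂ →+ G₂} {inl₀ : F₁ →+ C₀} {inr₀ : G₀ →+ C₀}
    {inl₁ : F₂ →+ C₁} {inr₁ : G₁ →+ C₁} {dC₀ : C₀ →+ C₁} {dC₁ : C₁ →+ C₂}
    (hφ : ∀ x, φ₂ (dF₁ x) = dG₁ (φ₁ x)) (hdd : ∀ x, dC₁ (dC₀ x) = 0)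
    (hfst : ∀ t, fst₂ (dC₁ t) = -dF₂ (fst₁ t))
    (hsnd : ∀ t, snd₂ (dC₁ t) = φ₂ (fst₁ t) + dG₁ (snd₁ t))
    (hinl : ∀ x, dC₀ (inl₀ x) = inr₁ (φ₁ x) - inl₁ (dF₁ x))
    (hinr : ∀ y, dC₀ (inr₀ y) = inr₁ (dG₀ y))
    (hid : ∀ t, inl₁ (fst₁ t) + inr₁ (snd₁ t) = t)
    (h1 : ∀ x, dF₂ x = 0 → (∃ y, dG₁ y = φ₂ x) → ∃ x', dF₁ x' = x)
    (h2 : ∀ y, dG₁ y = 0 → ∃ x, dF₁ x = 0 ∧ ∃ w, dG₀ w = φ₁ x - y) :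
    Function.Exact dC₀ dC₁ := by
  intro t
  constructor
  · intro ht
    have e1 := hfst t
    have e2 := hsnd t
    rw [ht, map_zero] at e1 e2
    -- For a cycle t = (x, y), x is a cycle with φ(x) = -dy, so x = dx'. Then φ(x') + y is a cycle,
    -- equal to φ(x'') - dw for a cycle x'', and t is the boundary of (x'' - x', -w).
    obtain ⟨x', hx'⟩ := h1 _ (neg_eq_zero.1 e1.symm) ⟨-snd₁ t, by
      rw [map_neg]; exact (eq_neg_of_add_eq_zero_left e2.symm).symm⟩
    obtain ⟨x'', hx'', w, hw⟩ := h2 (φ₁ x' + snd₁ t) (by rw [map_add, ← hφ, hx', ← e2])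
    refine ⟨inl₀ (x'' - x') + inr₀ (-w), ?_⟩
    rw [map_add, hinl, hinr, map_sub dF₁, hx'', hx', map_neg dG₀, hw, map_sub φ₁]
    conv_rhs => rw [← hid t]
    simp only [map_sub, map_neg, map_add, map_zero]
    abel
  · rintro ⟨s, rfl⟩
    exact hdd s

lemma mappingCone_exact (Φ : ModuleCat.{u} R ⥤ AddCommGrpCat.{u}) [Φ.Additive] {F G : Cplx R}
    (φ : F ⟶ G) (hφ : QuasiIso ((Φ.mapHomologicalComplex (ComplexShape.up ℤ)).map φ))
    {i j k : ℤ} (hij : i + 1 = j) (hjk : j + 1 = k) :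
    Function.Exact (Φ.map ((mappingCone φ).d i j)) (Φ.map ((mappingCone φ).d j k)) := by
  obtain ⟨h1, -⟩ := (quasiIso_iff_ab _).1 hφ j k (k + 1) hjk rfl
  obtain ⟨-, h2⟩ := (quasiIso_iff_ab _).1 hφ i j k hij hjk
  have comp {A B C D : ModuleCat.{u} R} {f : A ⟶ B} {g : B ⟶ D} {f' : A ⟶ C} {g' : C ⟶ D}
      (h : f ≫ g = f' ≫ g') (x : Φ.obj A) : Φ.map g (Φ.map f x) = Φ.map g' (Φ.map f' x) := by
    have := congrArg (fun f => Φ.map f) h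
    simp only [Φ.map_comp] at this
    exact ConcreteCategory.congr_hom this x
  have map {A B : ModuleCat.{u} R} {f g : A ⟶ B} (h : f = g) (x : Φ.obj A) :
    Φ.map f x = Φ.map g x := by rw [h]
  have map_comp {A B C : ModuleCat.{u} R} (f : A ⟶ B) (g : B ⟶ C) (x : Φ.obj A) :
      Φ.map (f ≫ g) x = Φ.map g (Φ.map f x) := by rw [Φ.map_comp]; rfl
  have map_add' {A B : ModuleCat.{u} R} (f g : A ⟶ B) (x : Φ.obj A) :
      Φ.map (f + g) x = Φ.map f x + Φ.map g x := by rw [Φ.map_add]; rfl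
  have map_sub' {A B : ModuleCat.{u} R} (f g : A ⟶ B) (x : Φ.obj A) :
      Φ.map (f - g) x = Φ.map f x - Φ.map g x := by rw [Φ.map_sub]; rfl
  have map_neg' {A B : ModuleCat.{u} R} (f : A ⟶ B) (x : Φ.obj A) :
      Φ.map (-f) x = -Φ.map f x := by rw [Φ.map_neg]; rfl
  have map_zero' {A B : ModuleCat.{u} R} (x : Φ.obj A) :
      Φ.map (0 : A ⟶ B) x = 0 := by rw [Φ.map_zero]; rfl
  refine exact_of_cone (dF₁ := (Φ.map (F.d j k)).hom) (dF₂ := (Φ.map (F.d k (k + 1))).hom)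
    (dG₀ := (Φ.map (G.d i j)).hom) (dG₁ := (Φ.map (G.d j k)).hom) (φ₁ := (Φ.map (φ.f j)).hom)
    (φ₂ := (Φ.map (φ.f k)).hom) (fst₁ := (Φ.map ((mappingCone.fst φ).1.v j k hjk)).hom)
    (snd₁ := (Φ.map ((mappingCone.snd φ).v j j (add_zero j))).hom)
    (fst₂ := (Φ.map ((mappingCone.fst φ).1.v k (k + 1) rfl)).hom)
    (snd₂ := (Φ.map ((mappingCone.snd φ).v k k (add_zero k))).hom)
    (inl₀ := (Φ.map ((mappingCone.inl φ).v j i (by lia))).hom)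
    (inr₀ := (Φ.map ((mappingCone.inr φ).f i)).hom)
    (inl₁ := (Φ.map ((mappingCone.inl φ).v k j (by lia))).hom)
    (inr₁ := (Φ.map ((mappingCone.inr φ).f j)).hom)
    (dC₀ := (Φ.map ((mappingCone φ).d i j)).hom) (dC₁ := (Φ.map ((mappingCone φ).d j k)).hom)
    ?_ ?_ ?_ ?_ ?_ ?_ ?_ h1 h2
  · exact fun x => comp (φ.comm j k).symm x
  · exact fun x => (map_comp _ _ x).symm.trans
      ((map (HomologicalComplex.d_comp_d _ _ _ _) x).trans (map_zero' x))
  · exact fun t => (map_comp _ _ t).symm.trans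
      ((map (mappingCone.d_fst_v φ j k (k + 1) hjk rfl) t).trans
        ((map_comp _ _ t).trans (map_neg' _ _)))
  · exact fun t => (map_comp _ _ t).symm.trans
      ((map (mappingCone.d_snd_v φ j k hjk) t).trans
        ((map_add' _ _ t).trans (congrArg₂ (· + ·) (map_comp _ _ t) (map_comp _ _ t))))
  · exact fun x => (map_comp _ _ x).symm.trans
      ((map (mappingCone.inl_v_d φ j i k (by lia) (by lia)) x).trans
        ((map_sub' _ _ x).trans (congrArg₂ (· - ·) (map_comp _ _ x) (map_comp _ _ x))))
  · exact fun y => comp (mappingCone.inr_f_d φ i j) y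
  · exact fun t => (congrArg₂ (· + ·) (map_comp _ _ t).symm (map_comp _ _ t).symm).trans
      ((map_add' _ _ t).symm.trans ((map (mappingCone.id_X φ j k hjk) t).trans
        (by rw [Φ.map_id]; rfl)))

lemma mappingCone_acyclic {F G : Cplx R} (φ : F ⟶ G) [QuasiIso φ] :
    (mappingCone φ).Acyclic := fun j => by
  rw [exactAt_iff_exact _ (sub_add_cancel j 1) rfl]
  exact mappingCone_exact (forget₂ (ModuleCat.{u} R) AddCommGrpCat.{u}) φ inferInstance
    (sub_add_cancel j 1) rfl

end MappingCone

/-! ### Semi-projective and K-projective complexes -/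

section KProjective

open CochainComplex CochainComplex.HomComplex

variable {R : Type u} [Ring R]

lemma IsSemiProjective.isKProjective {P : Cplx R} (hP : IsSemiProjective P) :
    P.IsKProjective where
  nonempty_homotopy_zero {L} f hL := by
    have h := exists_of_homMap_quasiIso (P := P) (0 : L ⟶ L)
      (hP.2 _ (quasiIso_zero_of_acyclic hL)) (i := -1) (j := 0) (k := 1) (by lia) (by lia)
    obtain ⟨x, hx⟩ := h.1 (Cochain.ofHom f) (by simp) ⟨0, by simp⟩
    exact ⟨(Cochain.equivHomotopy _ _).symm ⟨x, by simp [hx]⟩⟩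

/-- A cocycle of degree j is a chain map P → L⟦j⟧ into an acyclic complex; it is null-homotopic, and
so a coboundary. -/
lemma exists_δ_eq_of_isKProjective {P L : Cplx R} [P.IsKProjective] (hL : L.Acyclic)
    {i j k : ℤ} (hij : i + 1 = j) (hjk : j + 1 = k) (z : Cochain P L j) (hz : δ j k z = 0) :
    ∃ w : Cochain P L i, δ i j w = z := by
  let c : Cocycle P L j := Cocycle.mk z k hjk hz
  have hL' : (L⟦j⟧).Acyclic := by
    rw [← HomotopyCategory.quotient_obj_mem_subcategoryAcyclic_iff_acyclic] at hL ⊢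
    exact ObjectProperty.prop_of_iso _
      (((HomotopyCategory.quotient _ (.up ℤ)).commShiftIso j).symm.app L)
      ((HomotopyCategory.subcategoryAcyclic _).le_shift j _ hL)
  have h0 := HomotopyCategory.eq_of_homotopy _ _
    (CochainComplex.IsKProjective.homotopyZero (Cocycle.equivHomShift.symm c) hL')
  have h1 : c ∈ coboundaries P L j := by
    rw [← CohomologyClass.toHom_mk_eq_zero_iff, CohomologyClass.toHom_mk, h0]
    simp
  exact (mem_coboundaries_iff c i hij).1 h1

/-- A K-projective complex of projective modules is semi-projective. -/
lemma isSemiProjective_of_isKProjective {P : Cplx R} (h : ∀ i, Module.Projective R (P.X i))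
    [P.IsKProjective] : IsSemiProjective P := by
  refine ⟨h, fun X Y α _ => (quasiIso_iff_ab _).2 fun i j k hij hjk => ?_⟩
  change (∀ x : Cochain P X j, δ j k x = 0 →
      (∃ y : Cochain P Y i, δ i j y = x.comp (Cochain.ofHom α) (add_zero j)) →
        ∃ x' : Cochain P X i, δ i j x' = x) ∧
    (∀ y : Cochain P Y j, δ j k y = 0 → ∃ x : Cochain P X j, δ j k x = 0 ∧
      ∃ w : Cochain P Y i, δ i j w = x.comp (Cochain.ofHom α) (add_zero j) - y)
  have hcone := mappingCone_acyclic α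
  -- Cochains into the cone are pairs, so exactness of Hom(P, cone α) contains both clauses:
  -- injectivity comes from the cocycle (x, -y), surjectivity from (0, y).
  have lift_surj {n n' : ℤ} (hn : n + 1 = n') (c : Cochain P (mappingCone α) n) :
      ∃ (x : Cochain P X n') (y : Cochain P Y n), mappingCone.liftCochain α x y hn = c :=
    ⟨c.comp (mappingCone.fst α).1 hn, c.comp (mappingCone.snd α) (add_zero n), by
      rw [mappingCone.ext_cochain_to_iff α n n' hn]
      simp⟩
  constructor
  · rintro x hx ⟨y, hy⟩
    obtain ⟨c, hc⟩ := exists_δ_eq_of_isKProjective hcone (i := i - 1) (j := i) (k := j)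
      (by lia) hij (mappingCone.liftCochain α x (-y) hij) (by
        rw [mappingCone.δ_liftCochain α x (-y) hij k hjk, hx, δ_neg, hy]
        simp)
    obtain ⟨a, b, rfl⟩ := lift_surj (n := i - 1) (n' := i) (by lia) c
    rw [mappingCone.δ_liftCochain α a b _ j hij] at hc
    have := congrArg (fun c => Cochain.comp c (mappingCone.fst α).1 hij) hc
    refine ⟨-a, ?_⟩
    simpa using this
  · intro y hy
    obtain ⟨c, hc⟩ := exists_δ_eq_of_isKProjective hcone hij hjk
      (mappingCone.liftCochain α 0 y hjk) (by
        rw [mappingCone.δ_liftCochain α 0 y hjk (k + 1) rfl, hy]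
        simp)
    obtain ⟨x, w, rfl⟩ := lift_surj hij c
    rw [mappingCone.δ_liftCochain α x w _ k hjk] at hc
    have e1 := congrArg (fun c => Cochain.comp c (mappingCone.fst α).1 hjk) hc
    have e2 := congrArg (fun c => Cochain.comp c (mappingCone.snd α) (add_zero j)) hc
    refine ⟨x, by simpa using e1, -w, ?_⟩
    have e3 : δ i j w + x.comp (Cochain.ofHom α) (add_zero j) = y := by simpa using e2
    rw [δ_neg, ← e3]
    abel

end KProjective

/-! ### Isomorphisms in the derived category -/

section Derived

variable {R : Type u} [Ring R]

lemma DerivedIso.symm {F M : Cplx R} (h : DerivedIso F M) : DerivedIso M F :=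
  h.map Iso.symm

lemma DerivedIso.trans {F M N : Cplx R} (h : DerivedIso F M) (h' : DerivedIso M N) :
    DerivedIso F N := by
  obtain ⟨e⟩ := h
  obtain ⟨e'⟩ := h'
  exact ⟨e ≪≫ e'⟩

lemma DerivedIso.of_quasiIso {F M : Cplx R} (f : F ⟶ M) [QuasiIso f] : DerivedIso F M := by
  let := HasDerivedCategory.standard (ModuleCat.{u} R)
  exact ⟨asIso (DerivedCategory.Q.map f)⟩

lemma DerivedIso.isZero_homology {F M : Cplx R} (h : DerivedIso F M) (i : ℤ)
    (hM : IsZero (M.homology i)) : IsZero (F.homology i) := by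
  let := HasDerivedCategory.standard (ModuleCat.{u} R)
  obtain ⟨e⟩ := h
  have e' := ((DerivedCategory.homologyFunctorFactors (ModuleCat.{u} R) i).symm.app F) ≪≫
    (DerivedCategory.homologyFunctor _ i).mapIso e ≪≫
    ((DerivedCategory.homologyFunctorFactors (ModuleCat.{u} R) i).app M)
  exact hM.of_iso e'

/-- Out of a K-projective complex every morphism of the derived category is represented by a chain
map, and one representing an isomorphism is a quasi-isomorphism. -/
lemma DerivedIso.exists_quasiIso {P F : Cplx R} [P.IsKProjective] (h : DerivedIso P F) :
    ∃ f : P ⟶ F, QuasiIso f := by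
  let := HasDerivedCategory.standard (ModuleCat.{u} R)
  obtain ⟨e⟩ := h
  let E := DerivedCategory.quotientCompQhIso (ModuleCat.{u} R)
  obtain ⟨g, hg⟩ := (CochainComplex.IsKProjective.Qh_map_bijective P _).surjective
    (E.hom.app P ≫ e.hom ≫ E.inv.app F)
  obtain ⟨f, rfl⟩ := (HomotopyCategory.quotient _ _).map_surjective g
  refine ⟨f, ?_⟩
  rw [← DerivedCategory.isIso_Q_map_iff_quasiIso]
  have : DerivedCategory.Q.map f = e.hom := by
    have h1 := E.hom.naturality f
    have h2 : (HomotopyCategory.quotient _ _ ⋙ DerivedCategory.Qh).map f = _ := hg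
    rw [h2] at h1
    simp only [Category.assoc, Iso.inv_hom_id_app, Category.comp_id] at h1
    exact ((cancel_epi _).1 h1).symm
  rw [this]
  infer_instance

end Derived

/-! ### Existence of semi-projective resolutions -/

section Resolutions

open CochainComplex CochainComplex.HomComplex HomologicalComplex
open scoped ZeroObject

variable {R : Type u} [Ring R]

/-- The linear map `R → M` determined by an element. -/
def elt {M : ModuleCat.{u} R} (m : M) : ModuleCat.of R R ⟶ M :=
  ModuleCat.ofHom (LinearMap.toSpanSingleton R M m)

lemma elt_one {M : ModuleCat.{u} R} (m : M) : elt m (1 : R) = m := one_smul R m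

lemma elt_ext {M : ModuleCat.{u} R} {f g : ModuleCat.of R R ⟶ M} (h : f (1 : R) = g (1 : R)) :
    f = g :=
  ModuleCat.hom_ext (LinearMap.ext_ring h)

lemma elt_comp {M N : ModuleCat.{u} R} (m : M) (f : M ⟶ N) : elt m ≫ f = elt (f m) :=
  elt_ext (by
    refine (congrArg f (elt_one m)).trans (elt_one _).symm)

variable (R) in
/-- The complex `R` concentrated in degree `n`. -/
abbrev sphere (n : ℤ) : Cplx R := (single (ModuleCat.{u} R) (ComplexShape.up ℤ) n).obj (.of R R)

lemma up_rel (n : ℤ) : (ComplexShape.up ℤ).Rel (n - 1) n := sub_add_cancel n 1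

variable (R) in
/-- The contractible complex `R = R` in degrees `n - 1` and `n`. -/
abbrev disk (n : ℤ) : Cplx R := double (𝟙 (ModuleCat.of R R)) (up_rel n)

variable (R) in
/-- The inclusion of the sphere in the disk. -/
def sphereToDisk (n : ℤ) : sphere R n ⟶ disk R n :=
  mkHomFromSingle (doubleXIso₁ (𝟙 (ModuleCat.of R R)) (up_rel n) (by lia)).inv
    (fun k hk => by
      rw [double_d_eq_zero₀ _ _ _ _ (by lia), comp_zero])

variable {K L : Cplx R}

/-- The morphism from the sphere given by a cycle. -/
def sphereHom {n : ℤ} (z : K.X n) (hz : K.d n (n + 1) z = 0) : sphere R n ⟶ K :=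
  mkHomFromSingle (elt z) (fun k hk => by
    obtain rfl : n + 1 = k := hk
    rw [elt_comp, hz]
    exact elt_ext ((elt_one _).trans rfl))

/-- The value of a morphism from the sphere. -/
def sphereVal {n : ℤ} (f : sphere R n ⟶ K) : K.X n :=
  f.f n ((singleObjXSelf (ComplexShape.up ℤ) n (ModuleCat.of R R)).inv (1 : R))

lemma d_sphereVal {n : ℤ} (f : sphere R n ⟶ K) (k : ℤ) : K.d n k (sphereVal f) = 0 := by
  have := ConcreteCategory.congr_hom (f.comm n k)
    ((singleObjXSelf (ComplexShape.up ℤ) n (ModuleCat.of R R)).inv (1 : R))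
  refine this.trans ?_
  rw [single_obj_d, zero_comp]
  rfl

lemma sphereVal_comp {n : ℤ} (f : sphere R n ⟶ K) (g : K ⟶ L) :
    sphereVal (f ≫ g) = g.f n (sphereVal f) := rfl

lemma sphere_hom_ext {n : ℤ} {f g : sphere R n ⟶ K} (h : sphereVal f = sphereVal g) : f = g := by
  refine from_single_hom_ext ?_
  rw [← cancel_epi (singleObjXSelf (ComplexShape.up ℤ) n (ModuleCat.of R R)).inv]
  exact elt_ext h

lemma sphereVal_sphereHom {n : ℤ} (z : K.X n) (hz : K.d n (n + 1) z = 0) :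
    sphereVal (sphereHom z hz) = z := by
  have h : (singleObjXSelf (ComplexShape.up ℤ) n (ModuleCat.of R R)).inv ≫
      (sphereHom z hz).f n = elt z := by
    rw [sphereHom, mkHomFromSingle_f, Iso.inv_hom_id_assoc]
  exact (ConcreteCategory.congr_hom h (1 : R)).trans (elt_one z)

/-- The morphism from the disk given by an element. -/
def diskHom {n : ℤ} (m : K.X (n - 1)) : disk R n ⟶ K :=
  mkHomFromDouble (up_rel n) (by lia) (elt m) (elt (K.d (n - 1) n m))
    (by rw [elt_comp, Category.id_comp]) (fun k hk => by
      rw [← elt_comp, Category.assoc, d_comp_d, comp_zero])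

/-- The value of a morphism from the disk. -/
def diskVal {n : ℤ} (f : disk R n ⟶ K) : K.X (n - 1) :=
  f.f (n - 1) ((doubleXIso₀ (𝟙 (ModuleCat.of R R)) (up_rel n)).inv (1 : R))

lemma diskVal_comp {n : ℤ} (f : disk R n ⟶ K) (g : K ⟶ L) :
    diskVal (f ≫ g) = g.f (n - 1) (diskVal f) := rfl

lemma disk_hom_ext {n : ℤ} {f g : disk R n ⟶ K} (h : diskVal f = diskVal g) : f = g := by
  have h0 : f.f (n - 1) = g.f (n - 1) := by
    rw [← cancel_epi (doubleXIso₀ (𝟙 (ModuleCat.of R R)) (up_rel n)).inv]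
    exact elt_ext h
  refine from_double_hom_ext h0 ?_
  have hd : Epi ((disk R n).d (n - 1) n) := by
    rw [double_d _ _ (by lia)]
    infer_instance
  rw [← cancel_epi ((disk R n).d (n - 1) n), ← f.comm, ← g.comm, h0]

lemma diskVal_diskHom {n : ℤ} (m : K.X (n - 1)) : diskVal (diskHom m) = m := by
  have h : (doubleXIso₀ (𝟙 (ModuleCat.of R R)) (up_rel n)).inv ≫
      (diskHom m).f (n - 1) = elt m := by
    rw [diskHom, mkHomFromDouble_f₀, Iso.inv_hom_id_assoc]
  exact (ConcreteCategory.congr_hom h (1 : R)).trans (elt_one m)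

lemma sphereVal_sphereToDisk_comp {n : ℤ} (f : disk R n ⟶ K) :
    sphereVal (sphereToDisk R n ≫ f) = K.d (n - 1) n (diskVal f) := by
  have h1 : (singleObjXSelf (ComplexShape.up ℤ) n (ModuleCat.of R R)).inv ≫
      (sphereToDisk R n ≫ f).f n =
      (doubleXIso₀ (𝟙 (ModuleCat.of R R)) (up_rel n)).inv ≫ f.f (n - 1) ≫ K.d (n - 1) n := by
    rw [f.comm, comp_f, sphereToDisk, mkHomFromSingle_f, Category.assoc, Iso.inv_hom_id_assoc,
      double_d _ _ (by lia)]
    simp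
  exact ConcreteCategory.congr_hom h1 (1 : R)

variable (R) in
/-- The inclusions of spheres in disks. -/
def sphereDisk : MorphismProperty (Cplx R) := MorphismProperty.ofHoms (sphereToDisk R)

/-- A square from the sphere inclusion to f is a cycle z together with a primitive m of f(z); a
diagonal is a primitive of z over m. -/
lemma exists_lift_of_rlp {f : K ⟶ L} (hf : (sphereDisk R).rlp f) {i j k : ℤ} (hij : i + 1 = j)
    (hjk : j + 1 = k) (z : K.X j) (hz : K.d j k z = 0) (m : L.X i) (hm : L.d i j m = f.f j z) :
    ∃ p : K.X i, K.d i j p = z ∧ f.f i p = m := by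
  obtain rfl : i = j - 1 := by lia
  subst hjk
  have sq : CommSq (sphereHom z hz) (sphereToDisk R j) f (diskHom m) := ⟨sphere_hom_ext (by
    rw [sphereVal_comp, sphereVal_sphereHom, sphereVal_sphereToDisk_comp, diskVal_diskHom, hm])⟩
  have := hf _ ⟨j⟩
  refine ⟨diskVal sq.lift, ?_, ?_⟩
  · rw [← sphereVal_sphereToDisk_comp, sq.fac_left, sphereVal_sphereHom]
  · rw [← diskVal_comp, sq.fac_right, diskVal_diskHom]

lemma quasiIso_of_rlp {f : K ⟶ L} (hf : (sphereDisk R).rlp f) : QuasiIso f := by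
  rw [quasiIso_iff_elements]
  intro i j k hij hjk
  refine ⟨fun x hx ⟨y, hy⟩ => ?_, fun y hy => ?_⟩
  · obtain ⟨p, hp, -⟩ := exists_lift_of_rlp hf hij hjk x hx y hy
    exact ⟨p, hp⟩
  · obtain ⟨p, hp, hp'⟩ := exists_lift_of_rlp hf hjk rfl 0 (map_zero _) y (by rw [hy, map_zero])
    exact ⟨p, hp, 0, by rw [hp', map_zero, sub_self]⟩

/-- Choose any primitive p of the given cycle. Its image differs from the prescribed primitive by a
cycle, hence a boundary; lifting that boundary along the surjection corrects p. -/
lemma rlp_of_acyclic {f : K ⟶ L} (hf : ∀ i, Function.Surjective (f.f i)) (hK : K.Acyclic)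
    (hL : L.Acyclic) : (sphereDisk R).rlp f := by
  rintro _ _ _ ⟨n⟩
  refine ⟨fun {a b} sq => ?_⟩
  have comm (j k : ℤ) (x : K.X j) : f.f k (K.d j k x) = L.d j k (f.f j x) :=
    (ConcreteCategory.congr_hom (f.comm j k) x).symm
  obtain ⟨p, hp⟩ := ((exactAt_iff_exact K (sub_add_cancel n 1) rfl).1 (hK n) _).1
    (d_sphereVal a (n + 1))
  have h1 : L.d (n - 1) n (diskVal b) = f.f n (sphereVal a) := by
    rw [← sphereVal_comp, sq.w, sphereVal_sphereToDisk_comp]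
  obtain ⟨w, hw⟩ := ((exactAt_iff_exact L (sub_add_cancel (n - 1) 1) (sub_add_cancel n 1)).1
    (hL (n - 1)) (f.f (n - 1) p - diskVal b)).1 (by rw [map_sub, ← comm, hp, h1, sub_self])
  obtain ⟨w, rfl⟩ := hf _ w
  have dd : K.d (n - 1) n (K.d (n - 1 - 1) (n - 1) w) = 0 :=
    ConcreteCategory.congr_hom (K.d_comp_d _ _ _) w
  refine ⟨⟨⟨diskHom (p - K.d (n - 1 - 1) (n - 1) w), sphere_hom_ext ?_, disk_hom_ext ?_⟩⟩⟩
  · rw [sphereVal_sphereToDisk_comp, diskVal_diskHom, map_sub, hp, dd, sub_zero]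
  · rw [diskVal_comp, diskVal_diskHom, map_sub, comm, hw, sub_sub_cancel]

/-! ### The small object argument for spheres in disks -/

section SmallObject

attribute [local instance] Cardinal.fact_isRegular_aleph0 Cardinal.orderBotAleph0OrdToType

/-- Maps out of the sphere are n-cycles, and these commute with filtered colimits, which are
computed degreewise on underlying sets. -/
instance (n : ℤ) : IsFinitelyPresentable.{u} (sphere R n) := by
  have := Cardinal.fact_isRegular_aleph0.{u}
  refine ⟨fun J _ hJ => ⟨fun {F} => ⟨fun {c} hc => ⟨?_⟩⟩⟩⟩
  have := isFiltered_of_isCardinalFiltered J Cardinal.aleph0.{u}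
  have hE (i : ℤ) : IsColimit ((eval (ModuleCat.{u} R) (ComplexShape.up ℤ) i ⋙
      forget (ModuleCat.{u} R)).mapCocone c) := isColimitOfPreserves _ hc
  have comm (j k : ℤ) (A : J) (x : (F.obj A).X j) : (c.ι.app A).f k ((F.obj A).d j k x) =
      c.pt.d j k ((c.ι.app A).f j x) :=
    (ConcreteCategory.congr_hom ((c.ι.app A).comm j k) x).symm
  refine Types.FilteredColimit.isColimitOf' _ _ (fun f => ?_) (fun A f g hfg => ?_)
  · change sphere R n ⟶ c.pt at f
    obtain ⟨A, x, hx⟩ := Types.jointly_surjective_of_isColimit (hE n) (sphereVal f)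
    change (F.obj A).X n at x
    change (c.ι.app A).f n x = sphereVal f at hx
    obtain ⟨B, a, hB⟩ := (Types.FilteredColimit.isColimit_eq_iff' (hE (n + 1))
      (show (F.obj A).X (n + 1) from (F.obj A).d n (n + 1) x) (0 : (F.obj A).X (n + 1))).1 (by
        change (c.ι.app A).f (n + 1) ((F.obj A).d n (n + 1) x) = (c.ι.app A).f (n + 1) 0
        rw [comm, hx, d_sphereVal, map_zero])
    change (F.map a).f (n + 1) ((F.obj A).d n (n + 1) x) = (F.map a).f (n + 1) 0 at hB
    refine ⟨B, sphereHom ((F.map a).f n x) ?_, sphere_hom_ext ?_⟩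
    · rw [← ConcreteCategory.comp_apply, (F.map a).comm, ConcreteCategory.comp_apply, hB, map_zero]
    · refine Eq.trans ?_ (sphereVal_comp _ (c.ι.app B)).symm
      rw [sphereVal_sphereHom, ← hx, ← c.w a]
      rfl
  · change sphere R n ⟶ F.obj A at f g
    have hfg' : f ≫ c.ι.app A = g ≫ c.ι.app A := hfg
    obtain ⟨B, a, hB⟩ := (Types.FilteredColimit.isColimit_eq_iff' (hE n)
      (show (F.obj A).X n from sphereVal f) (show (F.obj A).X n from sphereVal g)).1
      (congrArg sphereVal hfg')
    exact ⟨B, a, sphere_hom_ext hB⟩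

instance : (sphereDisk R).IsCardinalForSmallObjectArgument Cardinal.aleph0.{u} where
  isSmall := MorphismProperty.isSmall_ofHoms ..
  preservesColimit {A B X Y} i hi f hf := by
    have : IsFinitelyPresentable.{u} A := by
      obtain ⟨n⟩ := hi
      infer_instance
    infer_instance

instance : MorphismProperty.HasSmallObjectArgument.{u} (sphereDisk R) :=
  ⟨.aleph0, inferInstance, inferInstance, inferInstance⟩

end SmallObject

variable {P : Cplx R}

lemma exists_lift_of_llp (hP : (sphereDisk R).rlp.llp (0 : 0 ⟶ P)) {f : K ⟶ L}
    (hf : (sphereDisk R).rlp f) (g : P ⟶ L) : ∃ l : P ⟶ K, l ≫ f = g := by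
  have sq : CommSq (0 : 0 ⟶ K) (0 : 0 ⟶ P) f g := ⟨by simp⟩
  have := hP f hf
  exact ⟨sq.lift, sq.fac_right⟩

/-- The cocone of the identity of an acyclic L is acyclic and surjects onto L. A lift of f to it is
a null-homotopy of f, because up to sign `snd` contracts `fst`. -/
lemma isKProjective_of_llp (hP : (sphereDisk R).rlp.llp (0 : 0 ⟶ P)) : P.IsKProjective where
  nonempty_homotopy_zero {L} f hL := by
    have hc : (mappingCocone (𝟙 L)).Acyclic := by
      have h := mappingCone_acyclic (𝟙 L)
      rw [← HomotopyCategory.quotient_obj_mem_subcategoryAcyclic_iff_acyclic] at h ⊢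
      exact ObjectProperty.prop_of_iso _
        (((HomotopyCategory.quotient _ (.up ℤ)).commShiftIso (-1 : ℤ)).symm.app _)
        ((HomotopyCategory.subcategoryAcyclic _).le_shift (-1 : ℤ) _ h)
    obtain ⟨l, hl⟩ := exists_lift_of_llp hP (rlp_of_acyclic (f := mappingCocone.fst (𝟙 L))
      (fun i x => ⟨(mappingCocone.inl (𝟙 L)).v i i (add_zero i) x,
        ConcreteCategory.congr_hom (mappingCocone.inl_v_fst_f (𝟙 L) i) x⟩) hc hL) f
    have h1 : δ (-1) 0 (mappingCocone.snd (𝟙 L)) = -Cochain.ofHom (mappingCocone.fst (𝟙 L)) := by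
      have := mappingCocone.δ_descCochain (𝟙 L) (M := L) (n := 0) (m := -1) 0
        (Cochain.ofHom (𝟙 L)) (by lia) 1 (by lia)
      have e : mappingCocone.descCochain (𝟙 L) 0 (Cochain.ofHom (𝟙 L)) (by lia) =
          mappingCocone.snd (𝟙 L) := by
        ext p q hpq
        rw [← Category.id_comp ((mappingCocone.descCochain _ _ _ _).v p q hpq),
          ← Category.id_comp ((mappingCocone.snd _).v p q hpq), ← mappingCocone.id_X (𝟙 L) p q hpq]
        simp
      rw [e] at this
      simpa using this
    refine ⟨(Cochain.equivHomotopy _ _).symm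
      ⟨-(Cochain.ofHom l).comp (mappingCocone.snd (𝟙 L)) (zero_add _), ?_⟩⟩
    rw [Cochain.ofHom_zero, add_zero, δ_neg, δ_ofHom_comp, h1, ← hl, Cochain.ofHom_comp]
    simp

/-- For an epimorphism e : A → B, the cones of the identities of A and B placed in degree i are
acyclic, and e induces a surjection between them. A map P_i → B amounts to a chain map from P to the
second cone; lifting it to the first lifts the map along e. -/
lemma projective_of_llp (hP : (sphereDisk R).rlp.llp (0 : 0 ⟶ P)) (i : ℤ) :
    Module.Projective R (P.X i) := by
  rw [IsProjective.iff_projective]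
  refine ⟨fun {A B} (f : P.X i ⟶ B) e he => ?_⟩
  let S := single (ModuleCat.{u} R) (ComplexShape.up ℤ) i
  let φ := mappingCone.map (𝟙 (S.obj A)) (𝟙 (S.obj B)) (S.map e) (S.map e) (by simp)
  have : Epi e := he
  have hφ (j : ℤ) : Function.Surjective (φ.f j) := by
    have hS (k : ℤ) : Function.Surjective ((S.map e).f k) := by
      have : Epi ((HomologicalComplex.eval _ _ k).map (S.map e)) := inferInstance
      exact (ModuleCat.epi_iff_surjective _).1 this
    intro t
    obtain ⟨a, ha⟩ := hS (j + 1) ((mappingCone.fst (𝟙 (S.obj B))).1.v j (j + 1) rfl t)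
    obtain ⟨b, hb⟩ := hS j ((mappingCone.snd (𝟙 (S.obj B))).v j j (add_zero j) t)
    refine ⟨(mappingCone.inl (𝟙 (S.obj A))).v (j + 1) j (by lia) a +
      (mappingCone.inr (𝟙 (S.obj A))).f j b, ?_⟩
    have e1 : (mappingCone.inl (𝟙 (S.obj A))).v (j + 1) j (by lia) ≫ φ.f j =
      (S.map e).f (j + 1) ≫ (mappingCone.inl (𝟙 (S.obj B))).v (j + 1) j (by lia) := by
        simp [φ, mappingCone.map]
    have e2 : (mappingCone.inr (𝟙 (S.obj A))).f j ≫ φ.f j =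
      (S.map e).f j ≫ (mappingCone.inr (𝟙 (S.obj B))).f j := by
        simp [φ, mappingCone.map]
    rw [map_add]
    refine (congrArg₂ (· + ·) ((ConcreteCategory.congr_hom e1 a).trans (congrArg ((mappingCone.inl (𝟙 (S.obj B))).v (j + 1) j (by lia)) ha))
      ((ConcreteCategory.congr_hom e2 b).trans (congrArg ((mappingCone.inr (𝟙 (S.obj B))).f j) hb))).trans
      (ConcreteCategory.congr_hom (mappingCone.id_X (𝟙 (S.obj B)) j (j + 1) rfl) t)
  -- The second component of the chain map to the cone is f itself; the first is then forced to be
  -- -δc.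
  let c : Cochain P (S.obj B) 0 := Cochain.toSingleMk f (add_zero i)
  obtain ⟨l, hl⟩ := exists_lift_of_llp hP (rlp_of_acyclic hφ (mappingCone_acyclic _)
    (mappingCone_acyclic _)) (mappingCone.lift (𝟙 (S.obj B)) (Cocycle.mk (-δ 0 1 c) 2 rfl (by rw [δ_neg, δ_δ, neg_zero])) c
      (by simp))
  have e1 : φ.f i ≫ (mappingCone.snd (𝟙 (S.obj B))).v i i (add_zero i) =
      (mappingCone.snd (𝟙 (S.obj A))).v i i (add_zero i) ≫ (S.map e).f i := by
    simp [φ, mappingCone.map, mappingCone.ext_from_iff _ (i + 1) i rfl]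
  have e2 := congrArg (fun l => l.f i ≫ (mappingCone.snd (𝟙 (S.obj B))).v i i (add_zero i)) hl
  refine ⟨l.f i ≫ (mappingCone.snd (𝟙 (S.obj A))).v i i (add_zero i) ≫
    (singleObjXSelf (ComplexShape.up ℤ) i A).hom, ?_⟩
  simp only [comp_f, Category.assoc, e1] at e2
  rw [mappingCone.lift_f_snd_v] at e2
  have e2 := e2.trans (Cochain.toSingleMk_v f (add_zero i))
  rw [← cancel_mono (singleObjXSelf (ComplexShape.up ℤ) i B).inv]
  refine Eq.trans ?_ e2
  rw [single_map_f_self]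
  simp only [Category.assoc, S]

/-- Factor 0 → M by the small object argument for spheres in disks: the left lifting property makes
the middle object semi-projective, and the right one makes its map to M a quasi-isomorphism. -/
lemma exists_semiProjectiveResolution (M : Cplx R) :
    ∃ (P : Cplx R) (π : P ⟶ M), IsSemiProjectiveResolution π := by
  let F := MorphismProperty.factorizationData (sphereDisk R).rlp.llp (sphereDisk R).rlp
    (0 : 0 ⟶ M)
  have h0 : F.i = 0 := by
    exact (isZero_zero _).eq_of_src _ _
  have hi := F.hi
  rw [h0] at hi
  have := isKProjective_of_llp hi
  exact ⟨F.Z, F.p, isSemiProjective_of_isKProjective (projective_of_llp hi), quasiIso_of_rlp F.hp⟩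

end Resolutions

/-! ### Gluing two complexes at a degree -/

section Splice

variable {R : Type u} [Ring R]

/-- A cokernel of the differential is isomorphic to the module of opcycles. -/
lemma nonempty_opcycles_iso (K : Cplx R) {i j : ℤ} (hij : i + 1 = j) {N : ModuleCat.{u} R}
    {p : K.X j ⟶ N} (h : Function.Exact (K.d i j) p) (hp : Function.Surjective p) :
    Nonempty (K.opcycles j ≅ N) := by
  have w : K.d i j ≫ p = 0 := by ext x; exact (h _).2 ⟨x, rfl⟩
  have hS : (ShortComplex.mk _ _ w).Exact :=
    (ShortComplex.ShortExact.moduleCat_exact_iff_function_exact _).2 h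
  have : Epi (ShortComplex.mk _ _ w).g := (ModuleCat.epi_iff_surjective _).2 hp
  exact ⟨IsColimit.coconePointUniqueUpToIso (K.opcyclesIsCokernel i j (by simp; lia))
    hS.gIsCokernel⟩

lemma nonempty_opcycles_iso_of_iso {K L : Cplx R} {i j i' j' : ℤ} (hij : i + 1 = j)
    (hij' : i' + 1 = j') (e : K.X i ≅ L.X i') (e' : K.X j ≅ L.X j')
    (h : e.hom ≫ L.d i' j' = K.d i j ≫ e'.hom) : Nonempty (K.opcycles j ≅ L.opcycles j') := by
  refine nonempty_opcycles_iso K hij (p := e'.hom ≫ L.pOpcycles j') (fun x => ?_)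
    ((pOpcycles_surjective L j').comp (ConcreteCategory.bijective_of_isIso e'.hom).2)
  refine (pOpcycles_exact L hij' (e'.hom x)).trans ?_
  have h' (y) : L.d i' j' (e.hom y) = e'.hom (K.d i j y) := ConcreteCategory.congr_hom h y
  constructor
  · rintro ⟨y, hy⟩
    obtain ⟨y, rfl⟩ := (ConcreteCategory.bijective_of_isIso e.hom).2 y
    exact ⟨y, (ConcreteCategory.bijective_of_isIso e'.hom).1 ((h' y).symm.trans hy)⟩
  · rintro ⟨y, rfl⟩
    exact ⟨e.hom y, h' y⟩

lemma exact_conj (Φ : ModuleCat.{u} R ⥤ AddCommGrpCat.{u}) {A B C A' B' C' : ModuleCat.{u} R}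
    (a : A ≅ A') (b : B ≅ B') (c : C ≅ C') {f : A' ⟶ B'} {g : B' ⟶ C'}
    (h : Function.Exact (Φ.map f) (Φ.map g)) :
    Function.Exact (Φ.map (a.hom ≫ f ≫ b.inv)) (Φ.map (b.hom ≫ g ≫ c.inv)) := by
  intro x
  have bij {X Y : ModuleCat.{u} R} (e : X ≅ Y) : Function.Bijective (Φ.map e.hom) :=
    ConcreteCategory.bijective_of_isIso (Φ.map e.hom)
  have map_comp {A B C : ModuleCat.{u} R} (f : A ⟶ B) (g : B ⟶ C) (x : Φ.obj A) :
      Φ.map (f ≫ g) x = Φ.map g (Φ.map f x) := by rw [Φ.map_comp]; rfl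
  have inv {X Y : ModuleCat.{u} R} (e : X ≅ Y) (x : Φ.obj X) :
      Φ.map e.inv (Φ.map e.hom x) = x := by rw [← map_comp, e.hom_inv_id, Φ.map_id]; rfl
  have hc : Function.Injective (Φ.map c.inv) := (bij c.symm).1
  rw [map_comp, map_comp, map_eq_zero_iff _ hc, h]
  constructor
  · rintro ⟨y, hy⟩
    obtain ⟨y, rfl⟩ := (bij a).2 y
    exact ⟨y, by rw [map_comp, map_comp, hy, inv]⟩
  · rintro ⟨y, rfl⟩
    refine ⟨Φ.map a.hom y, (bij b.symm).1 ?_⟩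
    rw [map_comp, map_comp]
    exact (inv b _).symm

variable (L U : Cplx R) (n : ℤ) (φ : ∀ i j, L.X i ⟶ U.X j)

/-- The modules of the complex which agrees with `L` in degrees `≤ n` and with `U` in degrees
`> n`. -/
def spliceX (i : ℤ) : ModuleCat.{u} R := if i ≤ n then L.X i else U.X i

variable {n} in
/-- The modules of a splice in degrees `≤ n`. -/
def spliceXIsoLeft {i : ℤ} (h : i ≤ n) : spliceX L U n i ≅ L.X i := eqToIso (if_pos h)

variable {n} in
/-- The modules of a splice in degrees `> n`. -/
def spliceXIsoRight {i : ℤ} (h : ¬ i ≤ n) : spliceX L U n i ≅ U.X i := eqToIso (if_neg h)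

/-- The differential of a splice. -/
def spliceD (i j : ℤ) : spliceX L U n i ⟶ spliceX L U n j :=
  if h : i + 1 = j then
    if hj : j ≤ n then
      (spliceXIsoLeft L U (show i ≤ n by lia)).hom ≫ L.d i j ≫ (spliceXIsoLeft L U hj).inv
    else if hi : i ≤ n then
      (spliceXIsoLeft L U hi).hom ≫ φ i j ≫ (spliceXIsoRight L U hj).inv
    else (spliceXIsoRight L U hi).hom ≫ U.d i j ≫ (spliceXIsoRight L U hj).inv
  else 0

variable {L U n φ} {i j k : ℤ}

lemma spliceD_left (hij : i + 1 = j) (hj : j ≤ n) : spliceD L U n φ i j =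
    (spliceXIsoLeft L U (show i ≤ n by lia)).hom ≫ L.d i j ≫ (spliceXIsoLeft L U hj).inv := by
  rw [spliceD, dif_pos hij, dif_pos hj]

lemma spliceD_mid (hij : i + 1 = j) (hj : ¬ j ≤ n) (hi : i ≤ n) : spliceD L U n φ i j =
    (spliceXIsoLeft L U hi).hom ≫ φ i j ≫ (spliceXIsoRight L U hj).inv := by
  rw [spliceD, dif_pos hij, dif_neg hj, dif_pos hi]

lemma spliceD_right (hij : i + 1 = j) (hi : ¬ i ≤ n) : spliceD L U n φ i j =
    (spliceXIsoRight L U hi).hom ≫ U.d i j ≫ (spliceXIsoRight L U (show ¬ j ≤ n by lia)).inv := by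
  rw [spliceD, dif_pos hij, dif_neg, dif_neg hi]

lemma splice_exact (Φ : ModuleCat.{u} R ⥤ AddCommGrpCat.{u}) (hij : i + 1 = j) (hjk : j + 1 = k)
    (h₁ : j < n → Function.Exact (Φ.map (L.d i j)) (Φ.map (L.d j k)))
    (h₂ : j = n → Function.Exact (Φ.map (L.d i j)) (Φ.map (φ j k)))
    (h₃ : i = n → Function.Exact (Φ.map (φ i j)) (Φ.map (U.d j k)))
    (h₄ : n < i → Function.Exact (Φ.map (U.d i j)) (Φ.map (U.d j k))) :
    Function.Exact (Φ.map (spliceD L U n φ i j)) (Φ.map (spliceD L U n φ j k)) := by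
  rcases lt_trichotomy j n with hj | hj | hj
  · rw [spliceD_left hij hj.le, spliceD_left hjk (by lia)]
    exact exact_conj Φ _ _ _ (h₁ hj)
  · rw [spliceD_left hij hj.le, spliceD_mid hjk (by lia) hj.le]
    exact exact_conj Φ _ _ _ (h₂ hj)
  · by_cases hi : i = n
    · rw [spliceD_mid hij (by lia) hi.le, spliceD_right hjk (by lia)]
      exact exact_conj Φ _ _ _ (h₃ hi)
    · rw [spliceD_right hij (by lia), spliceD_right hjk (by lia)]
      exact exact_conj Φ _ _ _ (h₄ (by lia))

variable (L U n φ) in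
/-- The complex which agrees with `L` in degrees `≤ n` and with `U` in degrees `> n`. -/
def splice (h₂ : ∀ i, i + 1 = n → L.d i n ≫ φ n (n + 1) = 0)
    (h₃ : ∀ k, n + 1 + 1 = k → φ n (n + 1) ≫ U.d (n + 1) k = 0) : Cplx R where
  X := spliceX L U n
  d := spliceD L U n φ
  shape i j h := by
    rw [spliceD, dif_neg]
    exact h
  d_comp_d' i j k (hij : i + 1 = j) (hjk : j + 1 = k) := by
    rcases lt_trichotomy j n with hj | hj | hj
    · rw [spliceD_left hij hj.le, spliceD_left hjk (by lia)]
      simp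
    · rw [spliceD_left hij hj.le, spliceD_mid hjk (by lia) hj.le]
      subst hj hjk
      simp [reassoc_of% (h₂ i hij)]
    · by_cases hi : i = n
      · rw [spliceD_mid hij (by lia) hi.le, spliceD_right hjk (by lia)]
        subst hi hij
        simp [reassoc_of% (h₃ k hjk)]
      · rw [spliceD_right hij (by lia), spliceD_right hjk (by lia)]
        simp

end Splice

/-! ### Totally acyclic complexes and Gorenstein flat modules -/

section TotallyAcyclic

open scoped ZeroObject

variable {R : Type u} [Ring R]

/-- Exactness of a complex after replacing its part in degrees `≤ n`. -/
lemma splice_exact_of_opcycles (Φ : ModuleCat.{u} R ⥤ AddCommGrpCat.{u})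
    (hΦ : ∀ ⦃A B C : ModuleCat.{u} R⦄ (f : A ⟶ B) (g : B ⟶ C), Function.Exact f g →
      Function.Surjective g → Function.Exact (Φ.map f) (Φ.map g) ∧ Function.Surjective (Φ.map g))
    {L T : Cplx R} {n : ℤ}
    (hL : ∀ i j k, i + 1 = j → j + 1 = k → j < n →
      Function.Exact (Φ.map (L.d i j)) (Φ.map (L.d j k)))
    (hT : ∀ i j k, i + 1 = j → j + 1 = k → Function.Exact (Φ.map (T.d i j)) (Φ.map (T.d j k)))
    (e : ∀ i, L.opcycles i ⟶ T.opcycles i) (he : IsIso (e n)) {i j k : ℤ}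
    (hij : i + 1 = j) (hjk : j + 1 = k) :
    Function.Exact
      (Φ.map (spliceD L T n (fun i j => L.pOpcycles i ≫ e i ≫ T.fromOpcycles i j) i j))
      (Φ.map (spliceD L T n (fun i j => L.pOpcycles i ≫ e i ≫ T.fromOpcycles i j) j k)) := by
  have map_comp {A B C : ModuleCat.{u} R} (f : A ⟶ B) (g : B ⟶ C) (x : Φ.obj A) :
      Φ.map (f ≫ g) x = Φ.map g (Φ.map f x) := by rw [Φ.map_comp]; rfl
  have hp (K : Cplx R) {i j : ℤ} (hij : i + 1 = j) :=
    hΦ _ _ (pOpcycles_exact K hij) (pOpcycles_surjective K j)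
  have hbij : Function.Bijective (Φ.map (e n)) := ConcreteCategory.bijective_of_isIso _
  refine splice_exact Φ hij hjk (hL i j k hij hjk) (fun hj => ?_) (fun hi => ?_)
    (fun _ => hT i j k hij hjk)
  -- At the last degree of L the outgoing map is L → C(L) ≅ C(T) → T; the final map is injective by
  -- exactness of T, so the kernel is the image of the differential of L.
  · subst hj
    have hinj : Function.Injective (Φ.map (T.fromOpcycles j k)) :=
      (exact_iff_injective_desc (p := (Φ.map (T.pOpcycles j)).hom)
        (q := (Φ.map (T.fromOpcycles j k)).hom) (hp T hij).1 (hp T hij).2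
        (d := Φ.map (T.d j k)) (fun x => by
          rw [← T.p_fromOpcycles]; exact (map_comp _ _ x).symm)).1 (hT i j k hij hjk)
    refine (exact_iff_injective_desc (p := (Φ.map (L.pOpcycles j)).hom)
        (q := (Φ.map (e j ≫ T.fromOpcycles j k)).hom) (hp L hij).1 (hp L hij).2
        (fun x => (map_comp _ _ x).symm)).2 ?_
    have : ⇑(Φ.map (e j ≫ T.fromOpcycles j k)).hom =
      Φ.map (T.fromOpcycles j k) ∘ Φ.map (e j) := funext (map_comp _ _)
    rw [this]
    exact hinj.comp hbij.1
  -- Just past the joint, the glued map has the same image as the differential of T, since both come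
  -- from surjections onto the common cokernel.
  · subst hi
    intro y
    rw [hT i j k hij hjk]
    have hL' := (hp L (sub_add_cancel i 1)).2
    have hT' := (hp T (sub_add_cancel i 1)).2
    constructor
    · rintro ⟨x, rfl⟩
      obtain ⟨z, hz⟩ := hbij.2 (Φ.map (T.pOpcycles i) x)
      obtain ⟨z, rfl⟩ := hL' z
      exact ⟨z, by rw [map_comp, map_comp, hz, ← map_comp, T.p_fromOpcycles]⟩
    · rintro ⟨x, rfl⟩
      obtain ⟨z, hz⟩ := hT' (Φ.map (e i) (Φ.map (L.pOpcycles i) x))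
      exact ⟨z, by rw [map_comp, map_comp, ← hz, ← map_comp, T.p_fromOpcycles]⟩

lemma isTotallyAcyclicFlat_iff (T : Cplx R) : IsTotallyAcyclicFlat T ↔
    (∀ i, IsFlat R (T.X i)) ∧
    (∀ i j k, i + 1 = j → j + 1 = k → Function.Exact (T.d i j) (T.d j k)) ∧
    ∀ I : ModuleCat.{u} Rᵐᵒᵖ, Module.Injective Rᵐᵒᵖ I → ∀ i j k, i + 1 = j → j + 1 = k →
      Function.Exact (tR I (T.d i j)) (tR I (T.d j k)) := by
  refine and_congr Iff.rfl (and_congr ?_ (forall_congr' fun I => forall_congr' fun _ => ?_))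
  · exact ⟨fun h i j k hij hjk => (exactAt_iff_exact T hij hjk).1 (h j),
      fun h j => (exactAt_iff_exact T (sub_add_cancel j 1) rfl).2 (h _ _ _ (by lia) rfl)⟩
  · exact ⟨fun h i j k hij hjk => (tC_exactAt_iff I T hij hjk).1 (h j),
      fun h j => (tC_exactAt_iff I T (sub_add_cancel j 1) rfl).2 (h _ _ _ (by lia) rfl)⟩

lemma IsTotallyAcyclicFlat.torVanishing {T : Cplx R} (hT : IsTotallyAcyclicFlat T) (n : ℤ)
    (I : ModuleCat.{u} Rᵐᵒᵖ) (hI : Module.Injective Rᵐᵒᵖ I) : TorVanishing I (T.opcycles n) :=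
  (tC_exactAt_iff_torVanishing I T n (fun i _ => hT.1 i) (fun i _ => hT.2.1 i)).1
    fun i _ => hT.2.2 I hI i

/-- The part of a totally acyclic complex in degrees `≤ n` may be replaced by any flat resolution
of the cokernel in degree `n`. -/
lemma IsTotallyAcyclicFlat.exists_splice {L T : Cplx R} (hT : IsTotallyAcyclicFlat T) (n : ℤ)
    (hL : ∀ i ≤ n, IsFlat R (L.X i)) (hL' : ∀ i < n, L.ExactAt i)
    (e : L.opcycles n ≅ T.opcycles n) :
    ∃ S : Cplx R, IsTotallyAcyclicFlat S ∧ ∃ ι : ∀ i ≤ n, S.X i ≅ L.X i,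
      ∀ i j (hi : i ≤ n) (hj : j ≤ n), (ι i hi).hom ≫ L.d i j = S.d i j ≫ (ι j hj).hom := by
  -- The gluing map is a family over all degrees, but only its value at n enters; elsewhere 0 will
  -- do.
  let e' (i : ℤ) : L.opcycles i ⟶ T.opcycles i :=
    if h : i = n then eqToHom (by rw [h]) ≫ e.hom ≫ eqToHom (by rw [h]) else 0
  have he' : e' n = e.hom := by simp [e']
  have he : IsIso (e' n) := by rw [he']; infer_instance
  let S := splice L T n (fun i j => L.pOpcycles i ≫ e' i ≫ T.fromOpcycles i j)
    (fun i _ => by simp) (fun k hk => by simp)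
  have hT' := (isTotallyAcyclicFlat_iff T).1 hT
  refine ⟨S, (isTotallyAcyclicFlat_iff S).2 ⟨fun i => ?_, fun i j k hij hjk => ?_,
    fun I hI i j k hij hjk => ?_⟩, fun i hi => spliceXIsoLeft L T hi, fun i j hi hj => ?_⟩
  · change IsFlat R (spliceX L T n i)
    rw [spliceX]
    split_ifs with h
    · exact hL i h
    · exact hT.1 i
  · exact splice_exact_of_opcycles (forget₂ (ModuleCat.{u} R) AddCommGrpCat.{u})
      (fun _ _ _ f g h hg => ⟨h, hg⟩)
      (fun i j k hij hjk hj => (exactAt_iff_exact L hij hjk).1 (hL' j hj)) hT'.2.1 e' he hij hjk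
  -- Exactness of I ⊗ L below n depends only on the higher Tor of I with the cokernel in degree n,
  -- which L shares with T.
  · have hI' := (tC_exactAt_iff_torVanishing I L n hL hL').2
      ((hT.torVanishing n I hI).of_iso e.symm)
    exact splice_exact_of_opcycles ((tensor R).obj I)
      (fun _ _ _ f g h hg => ⟨tR_exact I h hg, tR_surjective I hg⟩)
      (fun i j k hij hjk hj => (tC_exactAt_iff I L hij hjk).1 (hI' j hj)) (hT'.2.2 I hI)
      e' he hij hjk
  · by_cases hij : i + 1 = j
    · change _ = spliceD _ _ _ _ _ _ ≫ _
      rw [spliceD_left hij hj]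
      simp only [Category.assoc, Iso.inv_hom_id, Category.comp_id]
      rfl
    · rw [L.shape _ _ hij, S.shape _ _ hij, comp_zero, zero_comp]

/-- The complex with modules `T.X (i + k)` and the differentials of `T`. -/
def reindex (T : Cplx R) (k : ℤ) : Cplx R where
  X i := T.X (i + k)
  d i j := T.d (i + k) (j + k)
  shape i j h := T.shape _ _ (fun h' => h (by simp only [ComplexShape.up_Rel] at h' ⊢; lia))

lemma IsTotallyAcyclicFlat.reindex {T : Cplx R} (hT : IsTotallyAcyclicFlat T) (k : ℤ) :
    IsTotallyAcyclicFlat (reindex T k) := by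
  rw [isTotallyAcyclicFlat_iff] at hT ⊢
  exact ⟨fun i => hT.1 _, fun _ _ _ hij hjk => hT.2.1 _ _ _ (by lia) (by lia),
    fun I hI _ _ _ hij hjk => hT.2.2 I hI _ _ _ (by lia) (by lia)⟩

lemma nonempty_reindex_opcycles_iso (T : Cplx R) {i j k : ℤ} (h : i + k = j) :
    Nonempty ((reindex T k).opcycles i ≅ T.opcycles j) := by
  subst h
  exact nonempty_opcycles_iso_of_iso (K := GFlat.reindex T k) (sub_add_cancel i 1)
    (i' := i - 1 + k) (by lia) (Iso.refl _) (Iso.refl _) (by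
      rw [Iso.refl_hom, Iso.refl_hom]
      exact (Category.id_comp _).trans (Category.comp_id _).symm)

lemma IsGorensteinFlat.of_iso {G G' : ModuleCat.{u} R} (h : IsGorensteinFlat G) (e : G ≅ G') :
    IsGorensteinFlat G' := by
  obtain ⟨T, hT, ⟨e'⟩⟩ := h
  exact ⟨T, hT, ⟨e' ≪≫ e⟩⟩

lemma IsTotallyAcyclicFlat.isGorensteinFlat {T : Cplx R} (hT : IsTotallyAcyclicFlat T) (n : ℤ) :
    IsGorensteinFlat (T.opcycles n) :=
  ⟨_, hT.reindex n, nonempty_reindex_opcycles_iso T (by lia)⟩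

lemma IsGorensteinFlat.exists_totallyAcyclic {G : ModuleCat.{u} R} (h : IsGorensteinFlat G)
    (n : ℤ) : ∃ T : Cplx R, IsTotallyAcyclicFlat T ∧ Nonempty (T.opcycles n ≅ G) := by
  obtain ⟨T, hT, ⟨e⟩⟩ := h
  obtain ⟨e'⟩ := nonempty_reindex_opcycles_iso T (i := n) (k := -n) (j := -0) (by lia)
  exact ⟨_, hT.reindex (-n), ⟨e' ≪≫ e⟩⟩

lemma IsGorensteinFlat.torVanishing {G : ModuleCat.{u} R} (h : IsGorensteinFlat G)
    (I : ModuleCat.{u} Rᵐᵒᵖ) (hI : Module.Injective Rᵐᵒᵖ I) : TorVanishing I G := by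
  obtain ⟨T, hT, ⟨e⟩⟩ := h
  exact (hT.torVanishing _ I hI).of_iso e

/-- A Gorenstein flat module embeds in a flat module with Gorenstein flat cokernel. -/
lemma IsGorensteinFlat.exists_embedding {G : ModuleCat.{u} R} (h : IsGorensteinFlat G) :
    ∃ (U G' : ModuleCat.{u} R) (f : G ⟶ U) (g : U ⟶ G'), IsFlat R U ∧ IsGorensteinFlat G' ∧
      Function.Injective f ∧ Function.Exact f g ∧ Function.Surjective g := by
  obtain ⟨T, hT, ⟨e⟩⟩ := h.exists_totallyAcyclic 0
  have hb : Function.Bijective e.inv := ConcreteCategory.bijective_of_isIso e.inv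
  refine ⟨T.X 1, T.opcycles 1, e.inv ≫ T.fromOpcycles 0 1, T.pOpcycles 1, hT.1 1,
    hT.isGorensteinFlat 1, ?_, fun x => ?_, pOpcycles_surjective T 1⟩
  · exact ((exactAt_iff_fromOpcycles_injective T (zero_add 1)).1 (hT.2.1 0)).comp hb.1
  · rw [fromOpcycles_exact T (zero_add 1) x]
    constructor
    · rintro ⟨y, rfl⟩
      obtain ⟨y, rfl⟩ := hb.2 y
      exact ⟨y, rfl⟩
    · rintro ⟨y, rfl⟩
      exact ⟨e.inv y, rfl⟩

lemma IsFlat.of_iso {F F' : ModuleCat.{u} R} (hF : IsFlat R F) (e : F ≅ F') : IsFlat R F' := by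
  rw [isFlat_iff_injective] at hF ⊢
  exact Injective.of_iso ⟨dualMap _ e.inv, dualMap _ e.hom,
    by rw [← dualMap_comp, e.hom_inv_id, dualMap_id],
    by rw [← dualMap_comp, e.inv_hom_id, dualMap_id]⟩ hF

lemma isFlat_of_isZero {M : ModuleCat.{u} R} (h : IsZero M) : IsFlat R M := by
  have : Projective M := h.projective
  exact isFlat_of_projective M

/-- A monomorphism into a flat module is the tail of a flat resolution of its cokernel. -/
lemma exists_flat_resolution {N F : ModuleCat.{u} R} (hF : IsFlat R F) {f : N ⟶ F}
    (hf : Function.Injective f) : ∃ L : Cplx R, (∀ i, IsFlat R (L.X i)) ∧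
      (∀ i < 0, L.ExactAt i) ∧ Nonempty (L.opcycles (-1) ≅ N) ∧
      ∀ (G : ModuleCat.{u} R) (g : F ⟶ G), Function.Exact f g → Function.Surjective g →
        Nonempty (L.opcycles 0 ≅ G) := by
  let P : ProjectiveResolution N := projectiveResolution N
  let π : P.complex.X 0 ⟶ N := P.π.f 0
  have w : P.complex.d 1 0 ≫ π = 0 := P.complex_d_comp_π_f_zero
  have hπ : Function.Surjective π := (ModuleCat.epi_iff_surjective π).1
    (inferInstanceAs (Epi (P.π.f 0)))
  have hex : Function.Exact (P.complex.d 1 0) π :=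
    (ShortComplex.ShortExact.moduleCat_exact_iff_function_exact _).1 P.exact₀
  -- A projective resolution of N is prolonged by P₀ → N → F, with F in degree 0 and each P_k moved
  -- one place up; so N becomes the cokernel in cohomological degree -1, and coker f the one in
  -- degree 0.
  let A := ChainComplex.augment P.complex (π ≫ f) (by rw [reassoc_of% w, zero_comp])
  let e := ComplexShape.embeddingDownNat
  have hA (k : ℕ) : IsFlat R (A.X k) := by
    cases k with
    | zero => exact hF
    | succ k => exact isFlat_of_projective (P.complex.X k)
  have hA1 : Function.Exact (A.d 2 1) (A.d 1 0) := by
    intro x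
    change f (π x) = 0 ↔ _
    rw [map_eq_zero_iff f.hom hf]
    exact hex x
  have hAE (k : ℕ) : A.ExactAt (k + 1) := by
    rw [A.exactAt_iff' (k + 2) (k + 1) k (by simp) (by simp),
      ShortComplex.ShortExact.moduleCat_exact_iff_function_exact]
    cases k with
    | zero => exact hA1
    | succ k =>
      exact (ShortComplex.ShortExact.moduleCat_exact_iff_function_exact _).1 (P.exact_succ k)
  let x (k : ℕ) {i : ℤ} (h : -(k : ℤ) = i) : (A.extend e).X i ≅ A.X k := A.extendXIso e h
  have surj_comp {B C D : ModuleCat.{u} R} (b : B ≅ C) (g : C ⟶ D) (hg : Function.Surjective g) :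
      Function.Surjective (b.hom ≫ g ≫ (Iso.refl D).inv) :=
    hg.comp (ConcreteCategory.bijective_of_isIso b.hom).2
  have ladder {a b : ℕ} {i j : ℤ} (hi : -(a : ℤ) = i) (hj : -(b : ℤ) = j) {M : ModuleCat.{u} R}
      (g : A.X b ⟶ M) (h : Function.Exact (A.d a b) g) :
      Function.Exact ((A.extend e).d i j) ((x b hj).hom ≫ g ≫ (Iso.refl M).inv) := by
    rw [A.extend_d_eq e hi hj]
    exact exact_conj (forget₂ (ModuleCat.{u} R) AddCommGrpCat.{u}) (x a hi) (x b hj) (Iso.refl M) h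
  refine ⟨A.extend e, fun i => ?_, fun i hi => ?_, ?_, fun G g hfg hg => ?_⟩
  · rcases le_or_gt i 0 with hi | hi
    · exact (hA _).of_iso (x (-i).toNat (by lia)).symm
    · refine isFlat_of_isZero (A.isZero_extend_X e i fun k hk => ?_)
      change -(k : ℤ) = i at hk
      lia
  · obtain ⟨k, rfl⟩ : ∃ k : ℕ, i = -((k + 1 : ℕ) : ℤ) := ⟨(-i - 1).toNat, by lia⟩
    exact (HomologicalComplex.extend_exactAt_iff A e rfl).2 (hAE k)
  · exact nonempty_opcycles_iso _ (i := -2) (by lia) (ladder (a := 2) (b := 1) (by lia) (by lia) π hex)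
      (surj_comp (x 1 (i := -1) (by lia)) π hπ)
  · refine nonempty_opcycles_iso _ (i := -1) (by lia)
      (ladder (a := 1) (b := 0) (by lia) (by lia) g fun y => (hfg y).trans ⟨?_, ?_⟩)
      (surj_comp (x 0 (i := 0) (by lia)) g hg)
    · rintro ⟨z, rfl⟩
      obtain ⟨t, rfl⟩ := hπ z
      exact ⟨t, rfl⟩
    · rintro ⟨t, rfl⟩
      exact ⟨π t, rfl⟩

/-- The kernel of an epimorphism from a flat module to a Gorenstein flat one is
Gorenstein flat. -/
lemma IsGorensteinFlat.of_shortExact {N F G : ModuleCat.{u} R} (hG : IsGorensteinFlat G)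
    (hF : IsFlat R F) {f : N ⟶ F} {g : F ⟶ G} (hf : Function.Injective f)
    (h : Function.Exact f g) (hg : Function.Surjective g) : IsGorensteinFlat N := by
  -- L is a flat resolution of G through F. Spliced onto a totally acyclic complex for G, it gives a
  -- totally acyclic complex whose cokernel one step earlier is N.
  obtain ⟨L, hL, hL', ⟨e⟩, H⟩ := exists_flat_resolution hF hf
  obtain ⟨e'⟩ := H G g h hg
  obtain ⟨T, hT, ⟨e''⟩⟩ := hG.exists_totallyAcyclic 0
  obtain ⟨S, hS, ι, hι⟩ := hT.exists_splice 0 (fun i _ => hL i) hL' (e' ≪≫ e''.symm)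
  obtain ⟨a⟩ := nonempty_opcycles_iso_of_iso (i := -2) (j := -1) (i' := -2) (j' := -1)
    (by lia) (by lia) (ι (-2) (by lia)) (ι (-1) (by lia)) (hι _ _ _ _)
  exact (hS.isGorensteinFlat (-1)).of_iso (a ≪≫ e)

lemma isGorensteinFlat_of_isZero {M : ModuleCat.{u} R} (h : IsZero M) : IsGorensteinFlat M := by
  have hz (i : ℤ) : IsZero ((0 : Cplx R).X i) :=
    (HomologicalComplex.eval _ _ i).map_isZero (isZero_zero _)
  have hs (i : ℤ) : Subsingleton ((0 : Cplx R).X i) := ModuleCat.subsingleton_of_isZero (hz i)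
  have hM : Subsingleton M := ModuleCat.subsingleton_of_isZero h
  have hex (i j k : ℤ) : Function.Exact ((0 : Cplx R).d i j) ((0 : Cplx R).d j k) :=
    fun x => ⟨fun _ => ⟨0, Subsingleton.elim _ _⟩, fun _ => Subsingleton.elim _ _⟩
  obtain ⟨e⟩ := nonempty_opcycles_iso (0 : Cplx R) (N := M) (i := -1) (j := -0) (p := 0) (by lia)
    (fun x => ⟨fun _ => ⟨0, Subsingleton.elim _ _⟩, fun _ => Subsingleton.elim _ _⟩)
    (fun x => ⟨0, Subsingleton.elim _ _⟩)
  refine ⟨0, (isTotallyAcyclicFlat_iff _).2 ⟨fun i => isFlat_of_isZero (hz i),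
    fun i j k _ _ => hex i j k, fun I _ i j k _ _ => tR_exact I (hex i j k) fun x =>
      ⟨0, Subsingleton.elim _ _⟩⟩, ⟨e⟩⟩

/-- F is the kernel of F → 0, an epimorphism from a flat module to a Gorenstein flat one. -/
lemma isGorensteinFlat_of_isFlat {F : ModuleCat.{u} R} (hF : IsFlat R F) : IsGorensteinFlat F := by
  refine (isGorensteinFlat_of_isZero (isZero_zero _)).of_shortExact hF (f := 𝟙 F)
    (g := (0 : F ⟶ 0)) Function.injective_id (fun x => ⟨fun _ => ⟨x, rfl⟩, fun _ => rfl⟩)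
    ((ModuleCat.epi_iff_surjective _).1 ?_)
  exact (isZero_zero _).epi _

end TotallyAcyclic

/-! ### The pure exact sequence from the mapping cone -/

section ConeSequence

open CochainComplex

variable {R : Type u} [Ring R]

lemma tR_add_apply (X : ModuleCat.{u} Rᵐᵒᵖ) {M N : ModuleCat.{u} R} (f g : M ⟶ N)
    (t : BalancedTensor R X M) : tR X (f + g) t = tR X f t + tR X g t := by
  rw [tR, Functor.map_add]; rfl

/-- An element of X ⊗ C is recovered from its two components, and by naturality these lie in the
kernels of injective maps. Only the decomposition of the identity is needed. -/
lemma isFlat_of_split {A B C : ModuleCat.{u} R} (hA : IsFlat R A) (hB : IsFlat R B)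
    {fst : C ⟶ A} {inl : A ⟶ C} {snd : C ⟶ B} {inr : B ⟶ C}
    (h : fst ≫ inl + snd ≫ inr = 𝟙 C) : IsFlat R C := by
  intro X Y f hf
  refine (injective_iff_map_eq_zero (tL f C)).2 fun t ht => ?_
  have e1 : tR X fst t = 0 := hA f hf (by
    refine (tL_tR f fst t).trans ?_
    rw [ht, map_zero]
    exact (map_zero (tL f A)).symm)
  have e2 : tR X snd t = 0 := hB f hf (by
    refine (tL_tR f snd t).trans ?_
    rw [ht, map_zero]
    exact (map_zero (tL f B)).symm)
  rw [← tR_id_apply X C t, ← h, tR_add_apply, tR_comp_apply, tR_comp_apply, e1, e2, map_zero,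
    map_zero, add_zero]

/-- The product of two modules. -/
abbrev prodObj (A B : ModuleCat.{u} R) : ModuleCat.{u} R := ModuleCat.of R (A × B)

lemma IsFlat.prod {A B : ModuleCat.{u} R} (hA : IsFlat R A) (hB : IsFlat R B) :
    IsFlat R (prodObj A B) :=
  isFlat_of_split (C := prodObj A B) hA hB (fst := ModuleCat.ofHom (LinearMap.fst R A B))
    (inl := ModuleCat.ofHom (LinearMap.inl R A B)) (snd := ModuleCat.ofHom (LinearMap.snd R A B))
    (inr := ModuleCat.ofHom (LinearMap.inr R A B))
    (ModuleCat.hom_ext (LinearMap.ext fun _ => Prod.ext (add_zero _) (zero_add _)))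

/-- If `X ⊗ C` is exact for all `X` and `C` consists of flat modules, then so are the cokernels
of `C`. -/
lemma isFlat_opcycles {C : Cplx R} (hC : ∀ i, IsFlat R (C.X i)) (h : ∀ i, C.ExactAt i)
    (h' : ∀ X i, (tC X C).ExactAt i) (n : ℤ) : IsFlat R (C.opcycles n) :=
  isFlat_of_shortExact (hC n)
    ((exactAt_iff_fromOpcycles_injective C (sub_add_cancel n 1)).1 (h (n - 1)))
    (fromOpcycles_exact C (sub_add_cancel n 1)) (pOpcycles_surjective C n)
    fun X => (tC_exactAt_iff_injective X C (sub_add_cancel n 1)).1 (h' X (n - 1))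

/-- The cokernels in degree `n` of quasi-isomorphic semi-flat complexes fit into a pure exact
sequence with flat kernel. -/
lemma exists_pure_sequence {P F : Cplx R} (hP : IsSemiFlat P) (hF : IsSemiFlat F) (f : P ⟶ F)
    [QuasiIso f] (n : ℤ) :
    ∃ (K : ModuleCat.{u} R) (a : K ⟶ prodObj (P.opcycles n) (F.X n))
      (c : prodObj (P.opcycles n) (F.X n) ⟶ F.opcycles n), IsFlat R K ∧
      (∀ X : ModuleCat.{u} Rᵐᵒᵖ, Function.Injective (tR X a)) ∧ Function.Injective a ∧
      Function.Exact a c ∧ Function.Surjective c := by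
  let C := mappingCone f
  have hCX (i : ℤ) : IsFlat R (C.X i) :=
    isFlat_of_split (hP.1 (i + 1)) (hF.1 i) (mappingCone.id_X f i (i + 1) rfl)
  have hC (i : ℤ) : C.ExactAt i := mappingCone_acyclic f i
  have hCT (X : ModuleCat.{u} Rᵐᵒᵖ) (i : ℤ) : (tC X C).ExactAt i :=
    (tC_exactAt_iff X C (sub_add_cancel i 1) rfl).2
      (mappingCone_exact ((tensor R).obj X) f (hP.quasiIso_tC hF f X) (sub_add_cancel i 1) rfl)
  obtain ⟨m, rfl⟩ : ∃ m, n = m + 1 := ⟨n - 1, by lia⟩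
  let D := prodObj (P.opcycles (m + 1)) (F.X (m + 1))
  let fst : C.X m ⟶ P.X (m + 1) := (mappingCone.fst f).1.v m (m + 1) rfl
  let snd (i : ℤ) : C.X i ⟶ F.X i := (mappingCone.snd f).v i i (add_zero i)
  let inl : P.X (m + 2) ⟶ C.X (m + 1) := (mappingCone.inl f).v (m + 2) (m + 1) (by lia)
  let inr (i : ℤ) : F.X i ⟶ C.X i := (mappingCone.inr f).f i
  let inl0 : P.X (m + 1) ⟶ C.X m := (mappingCone.inl f).v (m + 1) m (by lia)
  have d_fst (i : ℤ) (hi : i + 1 = m) (x : C.X i) : fst (C.d i m x) =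
      - P.d m (m + 1) ((mappingCone.fst f).1.v i m hi x) :=
    ConcreteCategory.congr_hom (mappingCone.d_fst_v f i m (m + 1) hi rfl) x
  have d_snd (x : C.X m) : snd (m + 1) (C.d m (m + 1) x) =
      f.f (m + 1) (fst x) + F.d m (m + 1) (snd m x) :=
    ConcreteCategory.congr_hom (mappingCone.d_snd_v f m (m + 1) rfl) x
  have dd (i : ℤ) (x : C.X i) : C.d m (m + 1) (C.d i m x) = 0 :=
    ConcreteCategory.congr_hom (C.d_comp_d i m (m + 1)) x
  have pd (x) : P.pOpcycles (m + 1) (P.d m (m + 1) x) = 0 :=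
    (pOpcycles_exact P rfl _).2 ⟨x, rfl⟩
  -- With cone elements written (p, w), b sends (p, w) to ([p], f(p) + dw). It kills boundaries, and
  -- the second map c below sends ([p], z) to [z - f(p)].
  let b : C.X m ⟶ D := ModuleCat.ofHom
    (LinearMap.prod (fst ≫ P.pOpcycles (m + 1)).hom (C.d m (m + 1) ≫ snd (m + 1)).hom)
  have hb (x : C.X m) : b x = (P.pOpcycles (m + 1) (fst x), snd (m + 1) (C.d m (m + 1) x)) := rfl
  have wb : C.d (m - 1) m ≫ b = 0 := by
    refine ModuleCat.hom_ext (LinearMap.ext fun x => Prod.ext ?_ ?_)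
    · change P.pOpcycles (m + 1) (fst (C.d (m - 1) m x)) = 0
      rw [d_fst (m - 1) (by lia), map_neg, pd, neg_zero]
    · change snd (m + 1) (C.d m (m + 1) (C.d (m - 1) m x)) = 0
      rw [dd, map_zero]
  let a : C.opcycles m ⟶ D := C.descOpcycles b (m - 1) (by simp) wb
  have ha (x : C.X m) : a (C.pOpcycles m x) = b x :=
    ConcreteCategory.congr_hom (C.p_descOpcycles b (m - 1) (by simp) wb) x
  let c : D ⟶ F.opcycles (m + 1) := ModuleCat.ofHom
    (LinearMap.coprod (-(HomologicalComplex.opcyclesMap f (m + 1)).hom)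
      (F.pOpcycles (m + 1)).hom)
  have hc (x : P.X (m + 1)) (z : F.X (m + 1)) : c (P.pOpcycles (m + 1) x, z) =
      F.pOpcycles (m + 1) (z - f.f (m + 1) x) := by
    have : HomologicalComplex.opcyclesMap f (m + 1) (P.pOpcycles (m + 1) x) =
      F.pOpcycles (m + 1) (f.f (m + 1) x) :=
        ConcreteCategory.congr_hom (HomologicalComplex.p_opcyclesMap f (m + 1)) x
    change -HomologicalComplex.opcyclesMap f (m + 1) (P.pOpcycles (m + 1) x) +
      F.pOpcycles (m + 1) z = _
    rw [this, map_sub]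
    abel
  -- The map h factors the inclusion of the cokernel of the cone into its next term through a. That
  -- inclusion stays injective under every X ⊗ -, hence so does a.
  let h : D ⟶ C.X (m + 1) := ModuleCat.ofHom
    (LinearMap.coprod (-(P.fromOpcycles (m + 1) (m + 2) ≫ inl).hom) (inr (m + 1)).hom)
  have hah : a ≫ h = C.fromOpcycles m (m + 1) := by
    rw [← cancel_epi (C.pOpcycles m), C.p_fromOpcycles]
    ext x
    change h (a (C.pOpcycles m x)) = C.d m (m + 1) x
    rw [ha, hb]
    change -inl (P.fromOpcycles (m + 1) (m + 2) (P.pOpcycles (m + 1) (fst x))) +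
      inr (m + 1) (snd (m + 1) (C.d m (m + 1) x)) = _
    have e1 : (mappingCone.fst f).1.v (m + 1) (m + 2) (by lia) (C.d m (m + 1) x) =
      -P.d (m + 1) (m + 2) (fst x) :=
      ConcreteCategory.congr_hom (mappingCone.d_fst_v f m (m + 1) (m + 2) rfl (by lia)) x
    have e2 : inl ((mappingCone.fst f).1.v (m + 1) (m + 2) (by lia) (C.d m (m + 1) x)) +
      inr (m + 1) (snd (m + 1) (C.d m (m + 1) x)) = C.d m (m + 1) x :=
      ConcreteCategory.congr_hom (mappingCone.id_X f (m + 1) (m + 2) (by lia)) (C.d m (m + 1) x)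
    rw [fromOpcycles_pOpcycles, ← map_neg, ← e1, e2]
  have hinj : Function.Injective a := by
    have := (exactAt_iff_fromOpcycles_injective C (i := m) rfl).1 (hC m)
    rw [← hah] at this
    exact Function.Injective.of_comp (f := h) this
  refine ⟨C.opcycles m, a, c, isFlat_opcycles hCX hC hCT m, fun X => ?_, hinj, ?_, ?_⟩
  · have := (tC_exactAt_iff_injective X C (i := m) rfl).1 (hCT X m)
    rw [← hah] at this
    refine Function.Injective.of_comp (f := tR X h) ?_
    exact fun s t hst => this (by rw [tR_comp_apply, tR_comp_apply]; exact hst)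
  · rintro ⟨y, z⟩
    obtain ⟨x, rfl⟩ := pOpcycles_surjective P _ y
    rw [hc, pOpcycles_exact F rfl]
    constructor
    · rintro ⟨w, hw⟩
      refine ⟨C.pOpcycles m (inl0 x + inr m w), ?_⟩
      have e1 : fst (inl0 x) = x := ConcreteCategory.congr_hom
        (mappingCone.inl_v_fst_v f (m + 1) m (by lia)) x
      have e2 : fst (inr m w) = 0 := ConcreteCategory.congr_hom
        (mappingCone.inr_f_fst_v f m (m + 1) rfl) w
      have e3 : snd m (inl0 x) = 0 := ConcreteCategory.congr_hom
        (mappingCone.inl_v_snd_v f (m + 1) m (by lia)) x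
      have e4 : snd m (inr m w) = w := ConcreteCategory.congr_hom
        (mappingCone.inr_f_snd_v f m) w
      have e5 : fst (inl0 x + inr m w) = x := by rw [map_add, e1, e2, add_zero]
      have e6 : snd m (inl0 x + inr m w) = w := by rw [map_add, e3, e4, zero_add]
      rw [ha, hb, d_snd, e5, e6, hw, add_sub_cancel]
    · rintro ⟨t, ht⟩
      obtain ⟨t, rfl⟩ := pOpcycles_surjective C _ t
      rw [ha, hb, d_snd] at ht
      obtain ⟨h1, rfl⟩ := Prod.mk.inj ht
      obtain ⟨w, hw⟩ := (pOpcycles_exact P rfl (fst t - x)).1 (by rw [map_sub, h1, sub_self])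
      refine ⟨f.f m w + snd m t, ?_⟩
      have e1 : F.d m (m + 1) (f.f m w) = f.f (m + 1) (P.d m (m + 1) w) :=
        ConcreteCategory.congr_hom (f.comm m (m + 1)) w
      rw [map_add, e1, hw, map_sub]
      abel
  · intro y
    obtain ⟨z, rfl⟩ := pOpcycles_surjective F _ y
    exact ⟨(P.pOpcycles (m + 1) 0, z), by rw [hc, map_zero, sub_zero]⟩

/-- Given exact sequences `0 → K → D → Q → 0` and `0 → D → E → G → 0`, there are exact sequences
`0 → K → E → N → 0` and `0 → Q → N → G → 0`. -/
lemma exists_quotient_sequence {K D Q E G : ModuleCat.{u} R} {a : K ⟶ D} {c : D ⟶ Q}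
    (hac : Function.Exact a c) (hc : Function.Surjective c)
    {i : D ⟶ E} {p : E ⟶ G} (hi : Function.Injective i) (hip : Function.Exact i p)
    (hp : Function.Surjective p) :
    ∃ (N : ModuleCat.{u} R) (q : E ⟶ N) (j : Q ⟶ N) (r : N ⟶ G),
      Function.Exact (a ≫ i) q ∧ Function.Surjective q ∧
      Function.Injective j ∧ Function.Exact j r ∧ Function.Surjective r := by
  -- N is E modulo the image of K, in other words the pushout of Q and E under D.
  let S := LinearMap.range (a ≫ i).hom
  let q : E ⟶ ModuleCat.of R (E ⧸ S) := ModuleCat.ofHom S.mkQ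
  have hq : Function.Surjective q := S.mkQ_surjective
  have haq : Function.Exact (a ≫ i) q := fun x => Submodule.Quotient.mk_eq_zero S
  obtain ⟨j, hj⟩ := hom_factor hac hc (i ≫ q) (by
    ext x; exact (haq _).2 ⟨x, rfl⟩)
  obtain ⟨r, hr⟩ := hom_factor haq hq p (by
    ext x; exact (hip _).2 ⟨a x, rfl⟩)
  have hj' (x) : j (c x) = q (i x) := ConcreteCategory.congr_hom hj x
  have hr' (x) : r (q x) = p x := ConcreteCategory.congr_hom hr x
  refine ⟨_, q, j, r, haq, hq, ?_, ?_, ?_⟩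
  · refine (injective_iff_map_eq_zero j.hom).2 fun y hy => ?_
    obtain ⟨x, rfl⟩ := hc y
    obtain ⟨t, ht⟩ := (haq (i x)).1 ((hj' x).symm.trans hy)
    obtain rfl : a t = x := hi ht
    exact (hac _).2 ⟨t, rfl⟩
  · intro y
    obtain ⟨x, rfl⟩ := hq y
    rw [hr', hip]
    constructor
    · rintro ⟨z, rfl⟩
      exact ⟨c z, hj' z⟩
    · rintro ⟨z, hz⟩
      obtain ⟨z, rfl⟩ := hc z
      rw [hj', ← sub_eq_zero, ← map_sub] at hz
      obtain ⟨t, ht⟩ := (haq _).1 hz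
      exact ⟨z - a t, by
        rw [map_sub, sub_eq_iff_eq_add, ← sub_eq_iff_eq_add']
        exact ht.symm⟩
  · intro y
    obtain ⟨x, rfl⟩ := hp y
    exact ⟨q x, hr' x⟩

end ConeSequence

/-! ### Isomorphisms of brutal truncations, degree by degree -/

section Truncation

variable {R : Type u} [Ring R]

lemma nonempty_truncGE_iso_iff {K L : Cplx R} {g : ℤ} : Nonempty (truncGE K g ≅ truncGE L g) ↔
    ∃ ι : ∀ i ≤ -g, K.X i ≅ L.X i,
      ∀ i j (hi : i ≤ -g) (hj : j ≤ -g), (ι i hi).hom ≫ L.d i j = K.d i j ≫ (ι j hj).hom := by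
  let e := ComplexShape.embeddingUpIntLE (-g)
  constructor
  · rintro ⟨φ⟩
    -- The truncation is the restriction to degrees ≤ -g extended by zero, and extension by zero is
    -- fully faithful.
    let ψ : K.restriction e ≅ L.restriction e :=
      (e.fullyFaithfulExtendFunctor (ModuleCat.{u} R)).preimageIso φ
    have h (i : ℤ) (hi : i ≤ -g) : e.f (-g - i).toNat = i := by
      change -g - ((-g - i).toNat : ℤ) = i
      lia
    refine ⟨fun i hi => (K.restrictionXIso e (h i hi)).symm ≪≫
      (HomologicalComplex.eval _ _ (-g - i).toNat).mapIso ψ ≪≫ L.restrictionXIso e (h i hi),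
      fun i j hi hj => ?_⟩
    have := ψ.hom.comm (-g - i).toNat (-g - j).toNat
    rw [K.restriction_d_eq e (h i hi) (h j hj), L.restriction_d_eq e (h i hi) (h j hj)] at this
    have h2 := congrArg (fun z => (K.restrictionXIso e (h i hi)).inv ≫ z ≫
      (L.restrictionXIso e (h j hj)).hom) this
    change ((K.restrictionXIso e (h i hi)).inv ≫ ψ.hom.f _ ≫
      (L.restrictionXIso e (h i hi)).hom) ≫ L.d i j = K.d i j ≫
      ((K.restrictionXIso e (h j hj)).inv ≫ ψ.hom.f _ ≫ (L.restrictionXIso e (h j hj)).hom)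
    simpa using h2
  · rintro ⟨ι, hι⟩
    have h (n : ℕ) : e.f n ≤ -g := by
      change -g - (n : ℤ) ≤ -g
      lia
    exact ⟨(e.extendFunctor (ModuleCat.{u} R)).mapIso
      (HomologicalComplex.Hom.isoOfComponents (C₁ := K.restriction e) (C₂ := L.restriction e)
        (fun n => ι (e.f n) (h n)) fun m n _ => hι _ _ (h m) (h n))⟩

lemma exactAt_of_iso {K L : Cplx R} {i j k : ℤ} (hij : i + 1 = j) (hjk : j + 1 = k)
    (a : K.X i ≅ L.X i) (b : K.X j ≅ L.X j) (c : K.X k ≅ L.X k)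
    (h₁ : a.hom ≫ L.d i j = K.d i j ≫ b.hom) (h₂ : b.hom ≫ L.d j k = K.d j k ≫ c.hom)
    (hK : K.ExactAt j) : L.ExactAt j := by
  rw [HomologicalComplex.exactAt_iff' _ i j k (by simp; lia) (by simp; lia)] at hK ⊢
  exact ShortComplex.exact_of_iso (ShortComplex.isoMk a b c h₁ h₂) hK

end Truncation

/-! ### Comparison of cokernels and the Gorenstein flat dimension -/

section Dimension

variable {R : Type u} [Ring R]

lemma IsSemiProjectiveResolution.isSemiFlatReplacement {P M : Cplx R} {π : P ⟶ M}
    (h : IsSemiProjectiveResolution π) : IsSemiFlatReplacement P M :=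
  have := h.2
  ⟨h.1.isSemiFlat, .of_quasiIso π⟩

lemma IsSemiProjectiveResolution.exists_quasiIso {P M F : Cplx R} {π : P ⟶ M}
    (h : IsSemiProjectiveResolution π) (hF : DerivedIso F M) : ∃ f : P ⟶ F, QuasiIso f :=
  have := h.1.isKProjective
  (h.isSemiFlatReplacement.2.trans hF.symm).exists_quasiIso

lemma exists_injective_hom (X : ModuleCat.{u} Rᵐᵒᵖ) :
    ∃ (I : ModuleCat.{u} Rᵐᵒᵖ) (f : X ⟶ I), Module.Injective Rᵐᵒᵖ I ∧ Function.Injective f :=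
  ⟨Injective.under X, Injective.ι X,
    (Module.injective_iff_injective_object _ _).2 (inferInstanceAs (Injective (Injective.under X))),
    (ModuleCat.mono_iff_injective _).1 inferInstance⟩

/-- A pure monomorphism from a flat module into a module that embeds in a flat module with
Gorenstein flat cokernel composes to a monomorphism with flat cokernel. -/
lemma isFlat_of_comp {K D E G N : ModuleCat.{u} R} {a : K ⟶ D} {i : D ⟶ E} {p : E ⟶ G}
    {q : E ⟶ N} (hK : IsFlat R K) (ha : ∀ X : ModuleCat.{u} Rᵐᵒᵖ, Function.Injective (tR X a))
    (ha' : Function.Injective a) (hE : IsFlat R E) (hG : IsGorensteinFlat G)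
    (hi : Function.Injective i) (hip : Function.Exact i p) (hp : Function.Surjective p)
    (hq : Function.Exact (a ≫ i) q) (hq' : Function.Surjective q) : IsFlat R N := by
  refine isFlat_of_shortExact (f := a ≫ i) hE (hi.comp ha') hq hq' fun X => ?_
  -- Tor_1(X, G) need not vanish for a general X, so injectivity is checked after embedding X in an
  -- injective I: X ⊗ K → I ⊗ K is injective by flatness of K, then I ⊗ K → I ⊗ D by purity, then I
  -- ⊗ D → I ⊗ E by Tor_1(I, G) = 0.
  obtain ⟨I, f, hI, hf⟩ := exists_injective_hom X
  refine (injective_iff_map_eq_zero (tR X (a ≫ i))).2 fun t ht => ?_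
  refine (injective_iff_map_eq_zero (tL f K)).1 (hK f hf) t ?_
  refine (injective_iff_map_eq_zero (tR I a)).1 (ha I) _ ?_
  refine (injective_iff_map_eq_zero (tR I i)).1
    ((hG.torVanishing I hI).tR_injective hi hip hp) _ ?_
  rw [← tR_comp_apply, ← tL_tR, ht, map_zero]

/-- The cokernel in degree `n` of a semi-flat complex is Gorenstein flat if that of a
quasi-isomorphic one is. -/
lemma isGorensteinFlat_opcycles_of_quasiIso {P F : Cplx R} (hP : IsSemiFlat P)
    (hF : IsSemiFlat F) (f : P ⟶ F) [QuasiIso f] (n : ℤ) (h : IsGorensteinFlat (P.opcycles n)) :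
    IsGorensteinFlat (F.opcycles n) := by
  obtain ⟨K, a, c, hK, ha, ha', hac, hc⟩ := exists_pure_sequence hP hF f n
  obtain ⟨U, G, s, t, hU, hG, hs, hst, ht⟩ := h.exists_embedding
  -- Enlarging C(P) to U and keeping the flat summand of F fixed embeds the middle term of the pure
  -- sequence in a flat module, still with cokernel G.
  let i : prodObj (P.opcycles n) (F.X n) ⟶ prodObj U (F.X n) :=
    ModuleCat.ofHom (s.hom.prodMap LinearMap.id)
  let p : prodObj U (F.X n) ⟶ G := ModuleCat.ofHom (t.hom ∘ₗ LinearMap.fst R U (F.X n))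
  have hi : Function.Injective i := hs.prodMap Function.injective_id
  have hip : Function.Exact i p := by
    rintro ⟨u, z⟩
    refine (hst u).trans ⟨?_, ?_⟩
    · rintro ⟨y, rfl⟩
      exact ⟨(y, z), rfl⟩
    · rintro ⟨⟨y, w⟩, hy⟩
      exact ⟨y, congrArg Prod.fst hy⟩
  have hp : Function.Surjective p := ht.comp Prod.fst_surjective
  have hE : IsFlat R (prodObj U (F.X n)) := hU.prod (hF.1 n)
  obtain ⟨N, q, j, r, hq, hq', hj, hjr, hr⟩ := exists_quotient_sequence hac hc hi hip hp
  exact hG.of_shortExact (isFlat_of_comp hK ha ha' hE hG hi hip hp hq hq') hj hjr hr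

lemma IsLeftGFClosed.of_exact (hR : IsLeftGFClosed R) {A B C : ModuleCat.{u} R} {f : A ⟶ B}
    {g : B ⟶ C} (hf : Function.Injective f) (h : Function.Exact f g)
    (hg : Function.Surjective g) (hA : IsGorensteinFlat A) (hC : IsGorensteinFlat C) :
    IsGorensteinFlat B := by
  have w : f ≫ g = 0 := by
    ext x
    exact (h _).2 ⟨x, rfl⟩
  exact hR (ShortComplex.mk f g w)
    { exact := (ShortComplex.ShortExact.moduleCat_exact_iff_function_exact _).2 h
      mono_f := (ModuleCat.mono_iff_injective _).2 hf
      epi_g := (ModuleCat.epi_iff_surjective _).2 hg } hA hC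

/-- The converse passage uses closure under extensions twice: first C(P) ⊕ F_n is an extension of
C(F) by a flat K; then, with this sum embedded in a flat U, U/C(P) is an extension of a Gorenstein
flat module by F_n. So C(P) is the kernel of a map from U onto a Gorenstein flat module. -/
lemma IsLeftGFClosed.isGorensteinFlat_opcycles (hR : IsLeftGFClosed R) {P F : Cplx R}
    (hP : IsSemiFlat P) (hF : IsSemiFlat F) (f : P ⟶ F) [QuasiIso f] (n : ℤ)
    (h : IsGorensteinFlat (F.opcycles n)) : IsGorensteinFlat (P.opcycles n) := by
  obtain ⟨K, a, c, hK, -, ha, hac, hc⟩ := exists_pure_sequence hP hF f n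
  have hD := hR.of_exact ha hac hc (isGorensteinFlat_of_isFlat hK) h
  obtain ⟨U, G, s, t, hU, hG, hs, hst, ht⟩ := hD.exists_embedding
  let b : P.opcycles n ⟶ prodObj (P.opcycles n) (F.X n) :=
    ModuleCat.ofHom (LinearMap.inl R (P.opcycles n) (F.X n))
  let d : prodObj (P.opcycles n) (F.X n) ⟶ F.X n :=
    ModuleCat.ofHom (LinearMap.snd R (P.opcycles n) (F.X n))
  have hb : Function.Injective b := LinearMap.inl_injective
  have hbd : Function.Exact b d := Function.Exact.inl_snd
  have hd : Function.Surjective d := Prod.snd_surjective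
  obtain ⟨N, q, j, r, hq, hq', hj, hjr, hr⟩ := exists_quotient_sequence hbd hd hs hst ht
  have hN := hR.of_exact hj hjr hr (isGorensteinFlat_of_isFlat (hF.1 n)) hG
  exact hN.of_shortExact hU (f := b ≫ s) (hs.comp hb) hq hq'

lemma SemiFlatCondition.semiProjectiveCondition {M : Cplx R} {g : ℤ}
    (h : SemiFlatCondition M g) : SemiProjectiveCondition M g := by
  obtain ⟨P, π, hπ⟩ := exists_semiProjectiveResolution M
  exact ⟨h.1, P, π, hπ, h.2 P hπ.isSemiFlatReplacement⟩

lemma SemiProjectiveCondition.semiFlatCondition {M : Cplx R} {g : ℤ}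
    (h : SemiProjectiveCondition M g) : SemiFlatCondition M g := by
  obtain ⟨hM, P, π, hπ, hG⟩ := h
  refine ⟨hM, fun F hF => ?_⟩
  obtain ⟨f, hf⟩ := hπ.exists_quasiIso hF.2
  exact isGorensteinFlat_opcycles_of_quasiIso hπ.1.isSemiFlat hF.1 f (-g) hG

lemma SemiProjectiveCondition.gfd_le {M : Cplx R} {g : ℤ}
    (h : SemiProjectiveCondition M g) : gfd M ≤ ((g : ℝ) : EReal) := by
  obtain ⟨hM, P, π, hπ, hG⟩ := h
  have hP := hπ.isSemiFlatReplacement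
  obtain ⟨T, hT, ⟨e⟩⟩ := hG.exists_totallyAcyclic (-g)
  -- P is acyclic above homological degree g, so its part there resolves C_g(P) by flat modules and
  -- can replace that half of T.
  have hP' (i : ℤ) (hi : i < -g) : P.ExactAt i := by
    rw [HomologicalComplex.exactAt_iff_isZero_homology]
    obtain ⟨k, rfl⟩ : ∃ k, i = -k := ⟨-i, (neg_neg i).symm⟩
    exact hP.2.isZero_homology _ (hM k (by lia))
  obtain ⟨S, hS, hι⟩ := hT.exists_splice (-g) (fun i _ => hP.1.1 i) hP' e.symm
  exact sInf_le ⟨g, rfl, S, P, hS, hP, nonempty_truncGE_iso_iff.2 hι⟩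

/-- Admissible degrees are integers, so if none is ≤ g, all are ≥ g + 1 and so is the infimum. This
also covers the value -∞, where the infimum need not be attained. -/
lemma exists_isTateFlatResolution_of_gfd_le {M : Cplx R} {g : ℤ}
    (h : gfd M ≤ ((g : ℝ) : EReal)) : ∃ n ≤ g, ∃ T F : Cplx R, IsTateFlatResolution T F M n := by
  by_contra! hn
  have : (((g + 1 : ℤ) : ℝ) : EReal) ≤ gfd M := by
    refine le_sInf ?_
    rintro _ ⟨n, rfl, T, F, hTF⟩
    have : g < n := not_le.1 fun hng => hn n hng T F hTF
    exact_mod_cast this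
  have := this.trans h
  rw [EReal.coe_le_coe_iff, Int.cast_le] at this
  lia

lemma IsLeftGFClosed.semiProjectiveCondition (hR : IsLeftGFClosed R) {M : Cplx R} {g : ℤ}
    (h : gfd M ≤ ((g : ℝ) : EReal)) : SemiProjectiveCondition M g := by
  obtain ⟨n, hn, T, F, hT, hF, hTF⟩ := exists_isTateFlatResolution_of_gfd_le h
  obtain ⟨ι, hι⟩ := nonempty_truncGE_iso_iff.1 hTF
  refine ⟨fun i hi => hF.2.symm.isZero_homology (-i) ?_, ?_⟩
  -- For i > g ≥ n the three homological degrees i + 1, i, i - 1 are all ≥ n, within the range where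
  -- F agrees with T.
  · rw [← HomologicalComplex.exactAt_iff_isZero_homology]
    exact exactAt_of_iso (i := -i - 1) (j := -i) (k := -i + 1) (by lia) rfl
      (ι _ (by lia)) (ι _ (by lia)) (ι _ (by lia)) (hι _ _ _ _) (hι _ _ _ _) (hT.2.1 (-i))
  · obtain ⟨P, π, hπ⟩ := exists_semiProjectiveResolution M
    refine ⟨P, π, hπ, ?_⟩
    obtain ⟨f, hf⟩ := hπ.exists_quasiIso hF.2
    refine hR.isGorensteinFlat_opcycles hπ.1.isSemiFlat hF.1 f (-g) ?_
    -- C_g involves only homological degrees g and g + 1, both ≥ n, so C_g(F) ≅ C_g(T) even when n <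
    -- g.
    obtain ⟨e⟩ := nonempty_opcycles_iso_of_iso (K := T) (L := F) (i := -g - 1) (j := -g)
      (i' := -g - 1) (j' := -g) (by lia) (by lia) (ι _ (by lia)) (ι _ (by lia)) (hι _ _ _ _)
    exact (hT.isGorensteinFlat (-g)).of_iso e

end Dimension

end

end GFlat

theorem mainTheorem6 {R : Type u} [Ring R] (M : GFlat.Cplx R) (g : ℤ) :
    (GFlat.SemiFlatCondition M g ↔ GFlat.SemiProjectiveCondition M g) ∧
    (GFlat.SemiFlatCondition M g → GFlat.gfd M ≤ ((g : ℝ) : EReal)) ∧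
    (GFlat.SemiProjectiveCondition M g → GFlat.gfd M ≤ ((g : ℝ) : EReal)) ∧
    (GFlat.IsLeftGFClosed R →
      [GFlat.SemiFlatCondition M g, GFlat.SemiProjectiveCondition M g,
        GFlat.gfd M ≤ ((g : ℝ) : EReal)].TFAE) := by
  refine ⟨⟨GFlat.SemiFlatCondition.semiProjectiveCondition,
    GFlat.SemiProjectiveCondition.semiFlatCondition⟩, fun h => h.semiProjectiveCondition.gfd_le,
    GFlat.SemiProjectiveCondition.gfd_le, fun hR => ?_⟩
  tfae_have 1 → 2 := GFlat.SemiFlatCondition.semiProjectiveCondition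
  tfae_have 2 → 1 := GFlat.SemiProjectiveCondition.semiFlatCondition
  tfae_have 2 → 3 := GFlat.SemiProjectiveCondition.gfd_le
  tfae_have 3 → 2 := hR.semiProjectiveCondition
  tfae_finish
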